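/- Let $N$ be a lattice of rank $d\ge 0$, $M=\operatorname{Hom}_{\mathbb Z}(N,\mathbb Z)$ the dual lattice with pairing $\langle\cdot,\cdot\rangle$, and $M_{\mathbb R}=M\otimes_{\mathbb Z}\mathbb R$. Let $\triangle$ be a complete fan of strongly convex rational polyhedral cones in $N_{\mathbb R}=N\otimes_{\mathbb Z}\mathbb R$, and let $X=X(N,\triangle)$ be the associated complete toric variety over $\mathbb C$. For a ray $\tau\in\triangle(1)$ let $v_\tau$ be the generator of the monoid $N\cap\tau$. The set of Demazure roots of $\triangle$ is $$\mathcal R=\{m\in M:\ \exists\,\tau\in\triangle(1)\ \text{with}\ \langle v_\tau,m\rangle=-1\ \text{and}\ \langle v_{\tau'},m\rangle\ge 0\ \ \forall\,\tau'\in\triangle(1)\setminus\{\tau\}\}.$$ For $m\in\mathcal R$ let $\eta_m$ be the unique $v_\tau$ with $\langle v_\tau,m\rangle=-1$, and put $\eta(A)=\{\eta_m: m\in A\}$ for $A\subseteq\mathcal R$. Let $\mathcal S=\mathcal R\cap(-\mathcal R)$ be the set of semisimple roots and $\mathcal U=\mathcal R\setminus\mathcal S$ the set of unipotent roots. Let $\operatorname{lin}(\mathcal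 S)$ be the real linear hull of $\mathcal S$ in $M_{\mathbb R}$. Then: 1. $|\eta(\mathcal U)|\le d$ and $|\eta(\mathcal U)\setminus\eta(\mathcal S)|\le\operatorname{codim}_{\mathbb R}\operatorname{lin}(\mathcal S)$, the codimension being taken in $M_{\mathbb R}$. 2. $|\eta(\mathcal R)|\le 2d$, with equality if and only if $X\cong(\mathbb P^1)^d$ as varieties over $\mathbb C$. 3. $|\mathcal S|\le d^2+d$, with equality if and only if $X\cong\mathbb P^d$ as varieties over $\mathbb C$. -/

import Mathlib

open CategoryTheory CategoryTheory.Limits AlgebraicGeometry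
open scoped TensorProduct

noncomputable section

namespace Toric

section Cones

variable {N : Type} [AddCommGroup N]

/-- The canonical map `N → N_ℝ = ℝ ⊗ N` (it is also used for the dual lattice). -/
def toReal (n : N) : ℝ ⊗[ℤ] N := (1 : ℝ) ⊗ₜ[ℤ] n

/-- The real-linear extension `⟨·, m⟩ : N_ℝ → ℝ` of a linear form `m ∈ M = Hom(N, ℤ)`. -/
def pairing (m : Module.Dual ℤ N) : (ℝ ⊗[ℤ] N) →ₗ[ℝ] ℝ :=
  LinearMap.liftBaseChange ℝ ((Algebra.linearMap ℤ ℝ).comp m)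

lemma pairing_toReal (m : Module.Dual ℤ N) (n : N) : pairing m (toReal n) = (m n : ℝ) := by
  simp [pairing, toReal]

lemma pairing_add (m m' : Module.Dual ℤ N) (x : ℝ ⊗[ℤ] N) :
    pairing (m + m') x = pairing m x + pairing m' x := by
  simp [pairing, LinearMap.comp_add]

lemma pairing_zero (x : ℝ ⊗[ℤ] N) : pairing (0 : Module.Dual ℤ N) x = 0 := by
  simp [pairing]

/-- A cone generated by finitely many lattice points. -/
def IsRationalPolyhedral (σ : PointedCone ℝ (ℝ ⊗[ℤ] N)) : Prop :=
  ∃ s : Finset N, σ = PointedCone.hull ℝ (toReal '' (s : Set N))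

/-- The cone contains no line. -/
def IsStronglyConvex (σ : PointedCone ℝ (ℝ ⊗[ℤ] N)) : Prop :=
  ∀ x ∈ σ, -x ∈ σ → x = 0

/-- The semigroup `S_σ = σ^∨ ∩ M`. -/
def dualMonoid (σ : PointedCone ℝ (ℝ ⊗[ℤ] N)) : AddSubmonoid (Module.Dual ℤ N) where
  carrier := {m | ∀ x ∈ σ, 0 ≤ pairing m x}
  zero_mem' := fun x _ => by rw [pairing_zero]
  add_mem' := fun ha hb x hx => by
    rw [pairing_add]; exact add_nonneg (ha x hx) (hb x hx)

lemma mem_dualMonoid {σ : PointedCone ℝ (ℝ ⊗[ℤ] N)} {m : Module.Dual ℤ N} :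
    m ∈ dualMonoid σ ↔ ∀ x ∈ σ, 0 ≤ pairing m x := Iff.rfl

lemma dualMonoid_anti {τ σ : PointedCone ℝ (ℝ ⊗[ℤ] N)} (h : τ ≤ σ) :
    dualMonoid σ ≤ dualMonoid τ := fun _ hm x hx => hm x (h hx)

/-- `τ` is a face of the (rational polyhedral) cone `σ`: it is cut out of `σ` by a supporting
hyperplane `m^⊥` with `m ∈ σ^∨ ∩ M`. -/
def IsFace (τ σ : PointedCone ℝ (ℝ ⊗[ℤ] N)) : Prop :=
  ∃ m ∈ dualMonoid σ, ∀ x, x ∈ τ ↔ x ∈ σ ∧ pairing m x = 0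

lemma IsFace.le {τ σ : PointedCone ℝ (ℝ ⊗[ℤ] N)} (h : IsFace τ σ) : τ ≤ σ := by
  obtain ⟨m, _, h⟩ := h
  exact fun x hx => ((h x).1 hx).1

/-- The semigroup algebra `ℂ[S_σ]`. -/
abbrev coordRing (σ : PointedCone ℝ (ℝ ⊗[ℤ] N)) : Type := AddMonoidAlgebra ℂ (dualMonoid σ)

/-- The inclusion `ℂ[S_σ] → ℂ[S_τ]` for `τ ⊆ σ`. -/
def coordMap {τ σ : PointedCone ℝ (ℝ ⊗[ℤ] N)} (h : τ ≤ σ) : coordRing σ →ₐ[ℂ] coordRing τ :=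
  AddMonoidAlgebra.mapDomainAlgHom ℂ ℂ (AddSubmonoid.inclusion (dualMonoid_anti h))

lemma coordMap_single {τ σ : PointedCone ℝ (ℝ ⊗[ℤ] N)} (h : τ ≤ σ) (a : dualMonoid σ) (c : ℂ) :
    coordMap h (AddMonoidAlgebra.single a c) =
      AddMonoidAlgebra.single (AddSubmonoid.inclusion (dualMonoid_anti h) a) c := by
  simp [coordMap]

lemma coordMap_injective {τ σ : PointedCone ℝ (ℝ ⊗[ℤ] N)} (h : τ ≤ σ) :
    Function.Injective (coordMap h) :=
  AddMonoidAlgebra.mapDomain_injective (AddSubmonoid.inclusion_injective (dualMonoid_anti h))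

lemma exists_add_nsmul_mem {τ σ : PointedCone ℝ (ℝ ⊗[ℤ] N)} (hσ : IsRationalPolyhedral σ)
    {m : Module.Dual ℤ N} (hm : m ∈ dualMonoid σ)
    (hτ : ∀ x, x ∈ τ ↔ x ∈ σ ∧ pairing m x = 0) {w : Module.Dual ℤ N} (hw : w ∈ dualMonoid τ) :
    ∃ p : ℕ, w + p • m ∈ dualMonoid σ := by
  obtain ⟨s, rfl⟩ := hσ
  refine ⟨∑ n ∈ s, (w n).natAbs, fun x hx => ?_⟩
  induction hx using Submodule.span_induction with
  | mem x hx =>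
    obtain ⟨n, hn, rfl⟩ := hx
    have hmem : toReal n ∈ PointedCone.hull ℝ (toReal '' (s : Set N)) :=
      Submodule.subset_span ⟨n, hn, rfl⟩
    have h1 : 0 ≤ m n := by
      have := hm _ hmem
      rw [pairing_toReal] at this
      exact_mod_cast this
    rw [pairing_toReal]
    have h2 : ((w n).natAbs : ℤ) ≤ ((∑ n ∈ s, (w n).natAbs : ℕ) : ℤ) := by
      exact_mod_cast Finset.single_le_sum (f := fun n => (w n).natAbs)
        (fun _ _ => Nat.zero_le _) hn
    have h3 : 0 ≤ (w + (∑ n ∈ s, (w n).natAbs) • m) n := by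
      rw [LinearMap.add_apply, LinearMap.smul_apply, nsmul_eq_mul]
      rcases h1.eq_or_lt with h0 | h0
      · have := hw (toReal n) ((hτ _).2 ⟨hmem, by rw [pairing_toReal, ← h0]; simp⟩)
        rw [pairing_toReal] at this
        rw [← h0, mul_zero, add_zero]
        exact_mod_cast this
      · have h4 : -(w n) ≤ ((w n).natAbs : ℤ) := by omega
        nlinarith
    exact_mod_cast h3
  | zero => simp
  | add x y _ _ hx hy => rw [map_add]; exact add_nonneg hx hy
  | smul a x _ hx =>
    have : a • x = (a : ℝ) • x := rfl
    rw [this, map_smul, smul_eq_mul]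
    exact mul_nonneg a.2 hx

lemma neg_mem_dualMonoid {τ σ : PointedCone ℝ (ℝ ⊗[ℤ] N)} {m : Module.Dual ℤ N}
    (hτ : ∀ x, x ∈ τ ↔ x ∈ σ ∧ pairing m x = 0) : -m ∈ dualMonoid τ := fun x hx => by
  have h : pairing (-m) x + pairing m x = 0 := by rw [← pairing_add]; simp [pairing_zero]
  rw [((hτ x).1 hx).2, add_zero] at h
  exact h.ge

/-- The inclusion attached to a face `τ = σ ∩ m^⊥` is the localization at `χ^m`. -/
lemma isLocalization_coordMap {τ σ : PointedCone ℝ (ℝ ⊗[ℤ] N)} (hσ : IsRationalPolyhedral σ)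
    (h : τ ≤ σ) {m : Module.Dual ℤ N} (hm : m ∈ dualMonoid σ)
    (hτ : ∀ x, x ∈ τ ↔ x ∈ σ ∧ pairing m x = 0) :
    @IsLocalization.Away _ _ (AddMonoidAlgebra.single (⟨m, hm⟩ : dualMonoid σ) (1 : ℂ))
      (coordRing τ) _ (coordMap h).toRingHom.toAlgebra := by
  let _ : Algebra (coordRing σ) (coordRing τ) := (coordMap h).toRingHom.toAlgebra
  have hmap : ∀ a : coordRing σ, algebraMap (coordRing σ) (coordRing τ) a = coordMap h a :=
    fun _ => rfl
  have hpow : ∀ n : ℕ, (AddMonoidAlgebra.single (⟨m, hm⟩ : dualMonoid σ) (1 : ℂ)) ^ n =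
      AddMonoidAlgebra.single (n • (⟨m, hm⟩ : dualMonoid σ)) (1 : ℂ) := fun n => by
    rw [AddMonoidAlgebra.single_pow, one_pow]
  refine IsLocalization.Away.mk _ ?_ ?_ ?_
  · rw [hmap, coordMap_single]
    refine IsUnit.of_mul_eq_one
      (AddMonoidAlgebra.single (⟨-m, neg_mem_dualMonoid hτ⟩ : dualMonoid τ) (1 : ℂ)) ?_
    rw [AddMonoidAlgebra.single_mul_single, one_mul, AddMonoidAlgebra.one_def]
    congr 1
    exact Subtype.ext (by simp)
  · intro f
    induction f using AddMonoidAlgebra.induction_linear with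
    | zero => exact ⟨0, 0, by simp⟩
    | add f g hf hg =>
      obtain ⟨n, a, ha⟩ := hf
      obtain ⟨k, b, hb⟩ := hg
      refine ⟨n + k, a * (AddMonoidAlgebra.single (⟨m, hm⟩ : dualMonoid σ) (1 : ℂ)) ^ k +
        b * (AddMonoidAlgebra.single (⟨m, hm⟩ : dualMonoid σ) (1 : ℂ)) ^ n, ?_⟩
      rw [map_add, map_mul, map_mul, ← ha, ← hb, map_pow, map_pow]
      ring
    | single w c =>
      obtain ⟨p, hp⟩ := exists_add_nsmul_mem hσ hm hτ w.2
      refine ⟨p, AddMonoidAlgebra.single ⟨_, hp⟩ c, ?_⟩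
      rw [← map_pow, hpow, hmap, hmap, coordMap_single, coordMap_single,
        AddMonoidAlgebra.single_mul_single, mul_one]
      congr 1
  · intro a b hab
    exact ⟨0, by rw [coordMap_injective h hab]⟩

/-- The affine toric variety `U_σ = Spec ℂ[S_σ]`. -/
abbrev affineChart (σ : PointedCone ℝ (ℝ ⊗[ℤ] N)) : Scheme.{0} :=
  Spec (CommRingCat.of (coordRing σ))

/-- The morphism `U_τ → U_σ` for `τ ⊆ σ`. -/
def affineChartMap {τ σ : PointedCone ℝ (ℝ ⊗[ℤ] N)} (h : τ ≤ σ) :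
    affineChart τ ⟶ affineChart σ :=
  Spec.map (CommRingCat.ofHom (coordMap h).toRingHom)

/-- The structure morphism `U_σ → Spec ℂ`. -/
def affineChartStr (σ : PointedCone ℝ (ℝ ⊗[ℤ] N)) : affineChart σ ⟶ Spec (CommRingCat.of ℂ) :=
  Spec.map (CommRingCat.ofHom (algebraMap ℂ (coordRing σ)))

lemma affineChartMap_refl (σ : PointedCone ℝ (ℝ ⊗[ℤ] N)) :
    affineChartMap (le_refl σ) = 𝟙 (affineChart σ) := by
  have : (coordMap (le_refl σ)).toRingHom = RingHom.id _ := by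
    have h := AddMonoidAlgebra.mapDomainAlgHom_id (M := dualMonoid σ) (R := ℂ) (A := ℂ)
    exact congrArg AlgHom.toRingHom h
  rw [affineChartMap, this]
  exact Spec.map_id _

lemma affineChartMap_comp {ρ τ σ : PointedCone ℝ (ℝ ⊗[ℤ] N)} (h : ρ ≤ τ) (h' : τ ≤ σ) :
    affineChartMap h ≫ affineChartMap h' = affineChartMap (h.trans h') := by
  have : (coordMap (h.trans h')).toRingHom =
      (coordMap h).toRingHom.comp (coordMap h').toRingHom := by
    have := AddMonoidAlgebra.mapDomainAlgHom_comp (R := ℂ) (A := ℂ)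
      (AddSubmonoid.inclusion (dualMonoid_anti h')) (AddSubmonoid.inclusion (dualMonoid_anti h))
    exact congrArg AlgHom.toRingHom this
  rw [affineChartMap, affineChartMap, affineChartMap, this, CommRingCat.ofHom_comp, Spec.map_comp]

lemma affineChartMap_str {τ σ : PointedCone ℝ (ℝ ⊗[ℤ] N)} (h : τ ≤ σ) :
    affineChartMap h ≫ affineChartStr σ = affineChartStr τ := by
  rw [affineChartMap, affineChartStr, affineChartStr, ← Spec.map_comp, ← CommRingCat.ofHom_comp]
  congr 2
  exact (coordMap h).comp_algebraMap

lemma isOpenImmersion_affineChartMap {τ σ : PointedCone ℝ (ℝ ⊗[ℤ] N)}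
    (hσ : IsRationalPolyhedral σ) (h : IsFace τ σ) : IsOpenImmersion (affineChartMap h.le) := by
  have hle := h.le
  obtain ⟨m, hm, hτ⟩ := h
  let _ : Algebra (coordRing σ) (coordRing τ) := (coordMap hle).toRingHom.toAlgebra
  have := isLocalization_coordMap hσ hle hm hτ
  exact IsOpenImmersion.of_isLocalization (S := coordRing τ)
    (AddMonoidAlgebra.single (⟨m, hm⟩ : dualMonoid σ) (1 : ℂ))

/-- The image of `U_τ` in `U_σ`, for `τ = σ ∩ m^⊥`, is the principal open set of `χ^m`. -/
lemma range_affineChartMap {τ σ : PointedCone ℝ (ℝ ⊗[ℤ] N)} (hσ : IsRationalPolyhedral σ)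
    (h : τ ≤ σ) {m : Module.Dual ℤ N} (hm : m ∈ dualMonoid σ)
    (hτ : ∀ x, x ∈ τ ↔ x ∈ σ ∧ pairing m x = 0) :
    Set.range (affineChartMap h) =
      (PrimeSpectrum.basicOpen (AddMonoidAlgebra.single (⟨m, hm⟩ : dualMonoid σ) (1 : ℂ)) :
        Set (PrimeSpectrum (coordRing σ))) := by
  let _ : Algebra (coordRing σ) (coordRing τ) := (coordMap h).toRingHom.toAlgebra
  have := isLocalization_coordMap hσ h hm hτ
  exact PrimeSpectrum.localization_away_comap_range (coordRing τ)
    (AddMonoidAlgebra.single (⟨m, hm⟩ : dualMonoid σ) (1 : ℂ))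

end Cones

variable {N : Type} [AddCommGroup N]

variable (N) in
/-- A fan in `N_ℝ`: a finite collection of strongly convex rational polyhedral cones, containing
the faces of its members, any two of which meet in a common face. -/
structure Fan where
  cones : Set (PointedCone ℝ (ℝ ⊗[ℤ] N))
  finite_cones : cones.Finite
  rational : ∀ σ ∈ cones, IsRationalPolyhedral σ
  stronglyConvex : ∀ σ ∈ cones, IsStronglyConvex σ
  face_mem : ∀ σ ∈ cones, ∀ τ, IsFace τ σ → τ ∈ cones
  inter_face : ∀ σ ∈ cones, ∀ τ ∈ cones, IsFace (σ ⊓ τ) σ ∧ IsFace (σ ⊓ τ) τ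

namespace Fan

variable (Δ : Fan N)

/-- The cones of `Δ` cover `N_ℝ`. -/
def IsComplete : Prop := ∀ x : ℝ ⊗[ℤ] N, ∃ σ ∈ Δ.cones, x ∈ σ

lemma isFace_of_le {Δ : Fan N} {τ σ : Δ.cones} (h : τ ≤ σ) : IsFace τ.1 σ.1 := by
  have := (Δ.inter_face τ.1 τ.2 σ.1 σ.2).2
  rwa [inf_eq_left.2 (show τ.1 ≤ σ.1 from h)] at this

/-- The diagram of the affine charts `U_σ`, `σ ∈ Δ`, and the inclusions `U_τ → U_σ`, `τ ≤ σ`. -/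
def chartFunctor : Δ.cones ⥤ Scheme.{0} where
  obj σ := affineChart σ.1
  map f := affineChartMap (leOfHom f)
  map_id σ := affineChartMap_refl σ.1
  map_comp f g := (affineChartMap_comp (leOfHom f) (leOfHom g)).symm

instance {τ σ : Δ.cones} (f : τ ⟶ σ) : IsOpenImmersion (Δ.chartFunctor.map f) :=
  isOpenImmersion_affineChartMap (Δ.rational σ.1 σ.2) (isFace_of_le (leOfHom f))

instance : (Δ.chartFunctor ⋙ Scheme.forget).IsLocallyDirected where
  cond := by
    intro i j k fi fj xi xj hij
    replace hij : Δ.chartFunctor.map fi xi = Δ.chartFunctor.map fj xj := hij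
    obtain ⟨mi, hmi, hi⟩ := isFace_of_le (leOfHom fi)
    obtain ⟨mj, hmj, hj⟩ := isFace_of_le (leOfHom fj)
    let l : Δ.cones := ⟨i.1 ⊓ j.1, Δ.face_mem _ i.2 _ (Δ.inter_face _ i.2 _ j.2).1⟩
    let gi : l ⟶ i := homOfLE (show i.1 ⊓ j.1 ≤ i.1 from inf_le_left)
    let gj : l ⟶ j := homOfLE (show i.1 ⊓ j.1 ≤ j.1 from inf_le_right)
    have hm : mi + mj ∈ dualMonoid k.1 := add_mem hmi hmj
    have hl : ∀ x, x ∈ l.1 ↔ x ∈ k.1 ∧ pairing (mi + mj) x = 0 := by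
      intro x
      change x ∈ i.1 ⊓ j.1 ↔ _
      rw [Submodule.mem_inf, hi, hj, pairing_add]
      constructor
      · rintro ⟨⟨h1, h2⟩, _, h3⟩
        exact ⟨h1, by rw [h2, h3, add_zero]⟩
      · rintro ⟨h1, h2⟩
        have h3 := hmi x h1
        have h4 := hmj x h1
        exact ⟨⟨h1, by linarith⟩, h1, by linarith⟩
    have hk := Δ.rational k.1 k.2
    have ri := range_affineChartMap hk (leOfHom fi) hmi hi
    have rj := range_affineChartMap hk (leOfHom fj) hmj hj
    have rl := range_affineChartMap hk (leOfHom (gi ≫ fi)) hm hl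
    have h1 : Δ.chartFunctor.map fi xi ∈ Set.range (affineChartMap (leOfHom fi)) := ⟨xi, rfl⟩
    have h2 : Δ.chartFunctor.map fi xi ∈ Set.range (affineChartMap (leOfHom fj)) :=
      hij ▸ ⟨xj, rfl⟩
    have h3 : Δ.chartFunctor.map fi xi ∈ Set.range (affineChartMap (leOfHom (gi ≫ fi))) := by
      rw [ri] at h1
      rw [rj] at h2
      rw [rl]
      have hmul : (AddMonoidAlgebra.single (⟨mi + mj, hm⟩ : dualMonoid k.1) (1 : ℂ)) =
          AddMonoidAlgebra.single (⟨mi, hmi⟩ : dualMonoid k.1) (1 : ℂ) *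
            AddMonoidAlgebra.single (⟨mj, hmj⟩ : dualMonoid k.1) (1 : ℂ) := by
        rw [AddMonoidAlgebra.single_mul_single, one_mul]
        rfl
      rw [hmul, PrimeSpectrum.basicOpen_mul]
      exact ⟨h1, h2⟩
    obtain ⟨y, hy⟩ := h3
    replace hy : Δ.chartFunctor.map (gi ≫ fi) y = Δ.chartFunctor.map fi xi := hy
    refine ⟨l, gi, gj, y, ?_, ?_⟩
    · change Δ.chartFunctor.map gi y = xi
      apply (Δ.chartFunctor.map fi).isOpenEmbedding.injective
      rw [← hy, Functor.map_comp]
      rfl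
    · change Δ.chartFunctor.map gj y = xj
      apply (Δ.chartFunctor.map fj).isOpenEmbedding.injective
      rw [← hij, ← hy, show gi ≫ fi = gj ≫ fj from rfl, Functor.map_comp]
      rfl

/-- The toric variety `X(N, Δ)`: the scheme obtained by gluing the affine charts `U_σ`, `σ ∈ Δ`,
along the open subschemes given by common faces. -/
def toricVariety : Scheme.{0} := colimit Δ.chartFunctor

/-- The structure morphism `X(N, Δ) → Spec ℂ`. -/
def toricVarietyStr : Δ.toricVariety ⟶ Spec (CommRingCat.of ℂ) :=
  colimit.desc Δ.chartFunctor
    { pt := Spec (CommRingCat.of ℂ)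
      ι :=
        { app := fun σ => affineChartStr σ.1
          naturality := fun _ _ f => by
            exact (affineChartMap_str (leOfHom f)).trans (Category.comp_id _).symm } }

/-- `X(N, Δ)` as a scheme over `ℂ`. -/
def toricVarietyOver : Over (Spec (CommRingCat.of ℂ)) := Over.mk Δ.toricVarietyStr

/-- The set `Δ(1)` of rays. -/
def rays : Set (PointedCone ℝ (ℝ ⊗[ℤ] N)) :=
  {τ ∈ Δ.cones | Module.finrank ℝ (Submodule.span ℝ (τ : Set (ℝ ⊗[ℤ] N))) = 1}

/-- The set of the primitive generators `v_τ`, `τ ∈ Δ(1)`: the element `v_τ` generates the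
monoid `N ∩ τ`. -/
def rayGenerators : Set N :=
  {v | ∃ τ ∈ Δ.rays, ∀ n : N, toReal n ∈ τ ↔ ∃ k : ℕ, n = k • v}

/-- The set `R` of Demazure roots. -/
def roots : Set (Module.Dual ℤ N) :=
  {m | ∃ v ∈ Δ.rayGenerators, m v = -1 ∧ ∀ v' ∈ Δ.rayGenerators, v' ≠ v → 0 ≤ m v'}

/-- The set `S = R ∩ (-R)` of semisimple roots. -/
def semisimpleRoots : Set (Module.Dual ℤ N) := {m ∈ Δ.roots | -m ∈ Δ.roots}

/-- The set `U = R \ S` of unipotent roots. -/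
def unipotentRoots : Set (Module.Dual ℤ N) := Δ.roots \ Δ.semisimpleRoots

/-- `η(A) = {η_m : m ∈ A}` for `A ⊆ R`, where `η_m` is the unique primitive generator `v` of a ray
with `⟨v, m⟩ = -1`. -/
def eta (A : Set (Module.Dual ℤ N)) : Set N := {v ∈ Δ.rayGenerators | ∃ m ∈ A, m v = -1}

end Fan

/-- The real linear hull of `A ⊆ M` in `M_ℝ = ℝ ⊗ M`. -/
def linHull (A : Set (Module.Dual ℤ N)) : Submodule ℝ (ℝ ⊗[ℤ] Module.Dual ℤ N) :=
  Submodule.span ℝ (toReal '' A)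

/-- Projective space `ℙⁿ = Proj ℂ[x₀, …, xₙ]` as a scheme over `ℂ`. -/
def projectiveSpace (n : ℕ) : Over (Spec (CommRingCat.of ℂ)) :=
  letI := MvPolynomial.gradedAlgebra (σ := Fin (n + 1)) (R := ℂ)
  Over.mk (Proj.toSpecZero (MvPolynomial.homogeneousSubmodule (Fin (n + 1)) ℂ) ≫
    Spec.map (CommRingCat.ofHom
      (algebraMap ℂ (MvPolynomial.homogeneousSubmodule (Fin (n + 1)) ℂ 0))))

end Toric

end

/-!
# Bounds for the roots of a complete toric variety

**Combinatorics.** Let `P` be the set of ray generators of a complete fan. It spans `N_ℝ`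
positively, so a linear form that is nonnegative on `P` vanishes (`PositivelySpans`). A semisimple
root is a form with the values `-1`, `1` at two vectors `v`, `v'` of `P` and `0` at the others. Being
joined by such a root is an equivalence relation on `P` (`Linked`), so the semisimple roots
correspond to the ordered pairs of distinct vectors in a common class. The roots that join a chosen
representative of a class to the other members of the class (`simpleRoot`) are linearly independent;
there are `t ≤ d` of them, indexed by `nonReps`, and at most `t (t + 1)` semisimple roots. For
unipotent roots one chooses `u_v` with `u_v(v) = -1` for each `v` in `η(U)`. Every nonempty
set of these `v` has a sink, a member `v` such that `u_v` vanishes at all the others: otherwise there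
is a cycle, the sum of the `u_v` along it is nonnegative on `P`, hence zero, and this makes the `u_v`
semisimple (`exists_sink`). So the `u_v` are linearly independent, even modulo the span of the
semisimple roots if `v` is not in `η(S)`. This gives all the inequalities, and if `η` takes `2d`
values, or if there are `d² + d` semisimple roots, then the rays are those of the fan of `(ℙ¹)ᵈ` or
of `ℙᵈ` (`exists_orthantFrame`, `exists_simplexFrame`). Completeness then determines the cones.

**From the fan to the variety.** The varieties `ℙᵈ` and `(ℙ¹)ᵈ` have open covers by the charts `U_σ`
of the maximal cones of these fans, compatible with the embeddings of the torus
(`SimplexFrame.projectiveAtlas`, `OrthantFrame.linePowerAtlas`). Such an atlas identifies the variety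
with the toric variety of the fan (`Fan.nonempty_iso_of_atlas`).

**From the variety to the fan.** An isomorphism of varieties need not respect the tori. It does
transport the Lie algebra of global vector fields, realized as the derivations of the function field
that preserve the coordinate rings of an affine cover
(`ToricAtlas.exists_vectorFields_equiv`). This Lie algebra is graded by `M`; its part of degree `0`
is `N ⊗ ℂ`, and each root contributes one dimension (`IsRaySet.rank_vectorFields`). It is perfect if
and only if the coroots `v' - v` span `N ⊗ ℂ` (`IsRaySet.perfect_iff`), which forces `t = d`, and then
all roots are semisimple (`rootsOf_eq_ssRootsOf`). The Lie algebras of `ℙᵈ` and `(ℙ¹)ᵈ` are perfect.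
So perfectness and dimension show that a toric variety isomorphic to `ℙᵈ` has `d² + d` semisimple
roots, and that one isomorphic to `(ℙ¹)ᵈ` has `2d` roots and `t = d`, in which case all classes have
two members and `η` takes `2d` values.
-/

namespace Toric

/-! ### Rational cones and rays of fans -/

section Polyhedral

variable {N : Type} [AddCommGroup N]

lemma toReal_zero : toReal (0 : N) = 0 := TensorProduct.tmul_zero _ _

lemma toReal_neg (a : N) : toReal (-a) = -toReal a := TensorProduct.tmul_neg _ _

lemma toReal_nsmul (k : ℕ) (a : N) : toReal (k • a) = (k : ℝ) • toReal a := by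
  simp [toReal, TensorProduct.smul_tmul']

lemma toReal_sum {ι : Type*} (s : Finset ι) (a : ι → N) :
    toReal (∑ i ∈ s, a i) = ∑ i ∈ s, toReal (a i) := TensorProduct.tmul_sum _ _ _

lemma exists_dual_ne_zero [Module.Free ℤ N] {n : N} (hn : n ≠ 0) :
    ∃ m : Module.Dual ℤ N, m n ≠ 0 := by
  by_contra! h
  let b := Module.Free.chooseBasis ℤ N
  exact hn (b.ext_elem fun i => by simpa using h (b.coord i))

lemma eq_of_dual_eq [Module.Free ℤ N] {n n' : N} (h : ∀ m : Module.Dual ℤ N, m n = m n') :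
    n = n' := by
  by_contra hne
  obtain ⟨m, hm⟩ := exists_dual_ne_zero (sub_ne_zero.2 hne)
  exact hm (by rw [map_sub, h, sub_self])

lemma toReal_injective [Module.Free ℤ N] : Function.Injective (toReal : N → ℝ ⊗[ℤ] N) := by
  intro a b hab
  refine eq_of_dual_eq fun m => ?_
  have := congrArg (pairing m) hab
  rw [pairing_toReal, pairing_toReal] at this
  exact_mod_cast this

/-- Gordan's alternative over `ℤ`, by elimination of one vector at a time. -/
theorem exists_dual_pos_or_exists_sum_eq_zero [Module.Free ℤ N] {ι : Type*} (s : Finset ι)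
    (a : ι → N) : (∃ m : Module.Dual ℤ N, ∀ i ∈ s, 0 < m (a i)) ∨
      ∃ c : ι → ℕ, (∃ i ∈ s, c i ≠ 0) ∧ ∑ i ∈ s, c i • a i = 0 := by
  classical
  induction s using Finset.induction_on generalizing a with
  | empty => exact Or.inl ⟨0, by simp⟩
  | insert k s hk ih =>
    rcases ih a with ⟨f, hf⟩ | ⟨c, ⟨i, hi, hci⟩, hc⟩
    swap
    · refine Or.inr ⟨Function.update c k 0, ⟨i, Finset.mem_insert_of_mem hi, ?_⟩, ?_⟩
      · rwa [Function.update_of_ne (by rintro rfl; exact hk hi)]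
      · rw [Finset.sum_insert hk, Function.update_self, zero_smul, zero_add, ← hc]
        refine Finset.sum_congr rfl fun j hj => ?_
        rw [Function.update_of_ne (by rintro rfl; exact hk hj)]
    have hbound : ∀ g : N → ℤ, ∃ K : ℤ, ∀ i ∈ s, g (a i) < K ∧ 0 < K := by
      intro g
      refine ⟨1 + ∑ i ∈ s, |g (a i)|, fun i hi => ?_⟩
      have h1 := Finset.single_le_sum (f := fun i => |g (a i)|) (fun _ _ => abs_nonneg _) hi
      have h2 := le_abs_self (g (a i))
      have h3 := abs_nonneg (g (a i))
      constructor <;> linarith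
    rcases lt_trichotomy (f (a k)) 0 with hneg | hzero | hpos
    · -- push the other vectors along `a k` into the kernel of `f`
      rcases ih (fun i => (-f (a k)).toNat • a i + (f (a i)).toNat • a k) with
        ⟨g, hg⟩ | ⟨c, ⟨i, hi, hci⟩, hc⟩
      · obtain ⟨K, hK⟩ := hbound f
        rcases s.eq_empty_or_nonempty with rfl | ⟨i0, hi0⟩
        · exact Or.inl ⟨-f, by simpa using hneg⟩
        have hK0 := (hK i0 hi0).2
        refine Or.inl ⟨(K * -f (a k)) • g + (K * g (a k) - 1) • f, fun i hi => ?_⟩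
        rcases Finset.mem_insert.1 hi with rfl | hi
        · simp only [LinearMap.add_apply, LinearMap.smul_apply, smul_eq_mul]
          nlinarith
        · have h1 := hg i hi
          have h2 := hf i hi
          have h3 := (hK i hi).1
          simp only [map_add, map_nsmul, nsmul_eq_mul] at h1
          rw [Int.toNat_of_nonneg (by linarith), Int.toNat_of_nonneg h2.le] at h1
          simp only [LinearMap.add_apply, LinearMap.smul_apply, smul_eq_mul]
          nlinarith
      · refine Or.inr ⟨Function.update (fun i => c i * (-f (a k)).toNat) k
          (∑ i ∈ s, c i * (f (a i)).toNat), ⟨i, Finset.mem_insert_of_mem hi, ?_⟩, ?_⟩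
        · rw [Function.update_of_ne (by rintro rfl; exact hk hi)]
          exact mul_ne_zero hci (by omega)
        · rw [Finset.sum_insert hk, Function.update_self, ← hc, Finset.sum_smul, add_comm,
            ← Finset.sum_add_distrib]
          refine Finset.sum_congr rfl fun j hj => ?_
          rw [Function.update_of_ne (by rintro rfl; exact hk hj), smul_add, mul_smul, mul_smul]
    · by_cases h0 : a k = 0
      · refine Or.inr ⟨Function.update 0 k 1, ⟨k, Finset.mem_insert_self _ _, by simp⟩, ?_⟩
        rw [Finset.sum_insert hk, h0, smul_zero, zero_add]
        refine Finset.sum_eq_zero fun j hj => ?_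
        rw [Function.update_of_ne (by rintro rfl; exact hk hj), Pi.zero_apply, zero_smul]
      obtain ⟨g, hg⟩ : ∃ g : Module.Dual ℤ N, 0 < g (a k) := by
        obtain ⟨g, hg⟩ := exists_dual_ne_zero h0
        rcases lt_or_gt_of_ne hg with h | h
        · exact ⟨-g, by simpa using h⟩
        · exact ⟨g, h⟩
      obtain ⟨K, hK⟩ := hbound (fun x => -g x)
      refine Or.inl ⟨g + K • f, fun i hi => ?_⟩
      simp only [LinearMap.add_apply, LinearMap.smul_apply, smul_eq_mul]
      rcases Finset.mem_insert.1 hi with rfl | hi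
      · rw [hzero]; linarith
      · have h1 := hf i hi
        have h2 := hK i hi
        nlinarith
    · exact Or.inl ⟨f, fun i hi => (Finset.mem_insert.1 hi).elim (fun h => h ▸ hpos) (hf i)⟩

/-- Gordan's alternative modulo the line spanned by `n`. -/
theorem exists_dual_pos_or_exists_sum_eq_smul [Module.Free ℤ N] {ι : Type*} (s : Finset ι)
    (a : ι → N) {n : N} (hn : n ≠ 0) :
    (∃ m : Module.Dual ℤ N, m n = 0 ∧ ∀ i ∈ s, 0 < m (a i)) ∨
      ∃ (c : ι → ℕ) (e : ℤ), (∃ i ∈ s, c i ≠ 0) ∧ ∑ i ∈ s, c i • a i = e • n := by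
  classical
  obtain ⟨g, hg⟩ : ∃ g : Module.Dual ℤ N, 0 < g n := by
    obtain ⟨g, hg⟩ := exists_dual_ne_zero hn
    rcases lt_or_gt_of_ne hg with h | h
    · exact ⟨-g, by simpa using h⟩
    · exact ⟨g, h⟩
  rcases exists_dual_pos_or_exists_sum_eq_zero s (fun i => g n • a i - g (a i) • n) with
    ⟨m, hm⟩ | ⟨c, ⟨i, hi, hci⟩, hc⟩
  · refine Or.inl ⟨g n • m - m n • g, by simp [mul_comm], fun i hi => ?_⟩
    have := hm i hi
    simp only [map_sub, map_smul, smul_eq_mul] at this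
    simp only [LinearMap.sub_apply, LinearMap.smul_apply, smul_eq_mul]
    linarith
  · refine Or.inr ⟨fun i => c i * (g n).toNat, ∑ i ∈ s, c i * g (a i), ⟨i, hi, ?_⟩, ?_⟩
    · exact mul_ne_zero hci (by omega)
    · rw [Finset.sum_smul, ← sub_eq_zero, ← Finset.sum_sub_distrib, ← hc]
      refine Finset.sum_congr rfl fun j _ => ?_
      rw [smul_sub, mul_smul, mul_smul, ← natCast_zsmul ((g n).toNat • a j),
        ← natCast_zsmul (a j), Int.toNat_of_nonneg hg.le]
      simp

lemma toReal_mem_hull {s : Set N} {n : N} (hn : n ∈ s) :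
    toReal n ∈ PointedCone.hull ℝ (toReal '' s) := Submodule.subset_span ⟨n, hn, rfl⟩

lemma smul_mem_cone {σ : PointedCone ℝ (ℝ ⊗[ℤ] N)} {c : ℝ} (hc : 0 ≤ c) {x : ℝ ⊗[ℤ] N}
    (hx : x ∈ σ) : c • x ∈ σ := σ.smul_mem hc hx

lemma mem_hull_singleton {n : N} {x : ℝ ⊗[ℤ] N} :
    x ∈ PointedCone.hull ℝ (toReal '' ({n} : Set N)) ↔ ∃ c : ℝ, 0 ≤ c ∧ x = c • toReal n := by
  rw [Set.image_singleton]
  change x ∈ Submodule.span _ _ ↔ _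
  rw [Submodule.mem_span_singleton]
  constructor
  · rintro ⟨c, rfl⟩
    exact ⟨c, c.2, rfl⟩
  · rintro ⟨c, hc, rfl⟩
    exact ⟨⟨c, hc⟩, rfl⟩

lemma mem_dualMonoid_hull {s : Set N} {m : Module.Dual ℤ N} :
    m ∈ dualMonoid (PointedCone.hull ℝ (toReal '' s)) ↔ ∀ n ∈ s, 0 ≤ m n := by
  constructor
  · intro h n hn
    have := h _ (toReal_mem_hull hn)
    rw [pairing_toReal] at this
    exact_mod_cast this
  · intro h x hx
    induction hx using Submodule.span_induction with
    | mem x hx =>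
      obtain ⟨n, hn, rfl⟩ := hx
      rw [pairing_toReal]
      exact_mod_cast h n hn
    | zero => simp
    | add x y _ _ hx hy => rw [map_add]; exact add_nonneg hx hy
    | smul a x _ hx =>
      have : a • x = (a : ℝ) • x := rfl
      rw [this, map_smul, smul_eq_mul]
      exact mul_nonneg a.2 hx

/-- The face of a cone cut out by `m` is generated by the generators on which `m` vanishes. -/
lemma mem_hull_and_pairing_eq_zero_iff {s : Set N} {m : Module.Dual ℤ N}
    (hm : ∀ n ∈ s, 0 ≤ m n) {x : ℝ ⊗[ℤ] N} :
    x ∈ PointedCone.hull ℝ (toReal '' {n ∈ s | m n = 0}) ↔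
      x ∈ PointedCone.hull ℝ (toReal '' s) ∧ pairing m x = 0 := by
  constructor
  · intro hx
    refine ⟨Submodule.span_mono (Set.image_mono fun n hn => hn.1) hx, ?_⟩
    induction hx using Submodule.span_induction with
    | mem x hx =>
      obtain ⟨n, hn, rfl⟩ := hx
      rw [pairing_toReal, hn.2, Int.cast_zero]
    | zero => simp
    | add x y _ _ hx hy => rw [map_add, hx, hy, add_zero]
    | smul a x _ hx =>
      have : a • x = (a : ℝ) • x := rfl
      rw [this, map_smul, hx, smul_zero]
  · rintro ⟨hx, h0⟩
    induction hx using Submodule.span_induction with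
    | mem x hx =>
      obtain ⟨n, hn, rfl⟩ := hx
      rw [pairing_toReal] at h0
      exact toReal_mem_hull ⟨hn, by exact_mod_cast h0⟩
    | zero => exact Submodule.zero_mem _
    | add x y hx' hy' hx hy =>
      have h1 := mem_dualMonoid_hull.2 hm x hx'
      have h2 := mem_dualMonoid_hull.2 hm y hy'
      rw [map_add] at h0
      exact Submodule.add_mem _ (hx (by linarith)) (hy (by linarith))
    | smul a x hx' hx =>
      have h : a • x = (a : ℝ) • x := rfl
      rw [h, map_smul, smul_eq_mul, mul_eq_zero] at h0
      rcases h0 with h0 | h0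
      · rw [h, h0, zero_smul]
        exact Submodule.zero_mem _
      · exact Submodule.smul_mem _ _ (hx h0)

/-- A nonzero lattice vector is a positive multiple of a primitive one. -/
lemma exists_primitive [Module.Free ℤ N] {n : N} (hn : n ≠ 0) :
    ∃ (v : N) (g : ℕ) (w : Module.Dual ℤ N), 0 < g ∧ n = g • v ∧ w v = 1 := by
  let I : Ideal ℤ := LinearMap.range (Module.Dual.eval ℤ N n)
  obtain ⟨g, hg⟩ : ∃ g : ℕ, I = Ideal.span {(g : ℤ)} := by
    obtain ⟨g, hg⟩ := (IsPrincipalIdealRing.principal I).principal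
    exact ⟨g.natAbs, by rw [hg]; exact Int.span_natAbs g |>.symm⟩
  have hdvd : ∀ m : Module.Dual ℤ N, (g : ℤ) ∣ m n := fun m =>
    Ideal.mem_span_singleton.1 (hg ▸ (⟨m, rfl⟩ : m n ∈ I))
  obtain ⟨w, hw⟩ : ∃ w : Module.Dual ℤ N, w n = g := by
    have : (g : ℤ) ∈ I := hg ▸ Ideal.mem_span_singleton_self _
    exact this
  have hg0 : g ≠ 0 := by
    rintro rfl
    obtain ⟨m, hm⟩ := exists_dual_ne_zero hn
    exact hm (by simpa using hdvd m)
  let b := Module.Free.chooseBasis ℤ N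
  choose q hq using fun i => hdvd (b.coord i)
  have hfin : (Function.support q).Finite := by
    refine (b.repr n).support.finite_toSet.subset fun i hi => ?_
    rw [Finset.mem_coe, Finsupp.mem_support_iff]
    intro h0
    have := hq i
    rw [Module.Basis.coord_apply, h0] at this
    exact hi (by simpa [hg0] using this.symm)
  have hv : n = g • b.repr.symm (Finsupp.ofSupportFinite q hfin) := by
    refine b.ext_elem fun i => ?_
    have := hq i
    rw [Module.Basis.coord_apply] at this
    rw [this]
    simp [Finsupp.ofSupportFinite_coe]
  refine ⟨_, g, w, Nat.pos_of_ne_zero hg0, hv, ?_⟩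
  have h1 : (g : ℤ) * w (b.repr.symm (Finsupp.ofSupportFinite q hfin)) = g := by
    conv_rhs => rw [← hw, hv]
    simp
  exact mul_left_cancel₀ (Nat.cast_ne_zero.2 hg0) (h1.trans (mul_one _).symm)

/-- The lattice points on the ray through a primitive vector. -/
lemma toReal_mem_hull_primitive_iff [Module.Free ℤ N] {v : N} {w : Module.Dual ℤ N} (hw : w v = 1)
    (n : N) : toReal n ∈ PointedCone.hull ℝ (toReal '' ({v} : Set N)) ↔ ∃ k : ℕ, n = k • v := by
  rw [mem_hull_singleton]
  constructor
  · rintro ⟨c, hc, h⟩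
    have h1 := congrArg (pairing w) h
    rw [map_smul, pairing_toReal, pairing_toReal, hw, smul_eq_mul, Int.cast_one, mul_one] at h1
    have h2 : 0 ≤ w n := by exact_mod_cast h1 ▸ hc
    refine ⟨(w n).toNat, toReal_injective ?_⟩
    rw [h, toReal_nsmul, ← h1]
    congr 1
    exact_mod_cast (Int.toNat_of_nonneg h2).symm
  · rintro ⟨k, rfl⟩
    exact ⟨k, Nat.cast_nonneg _, toReal_nsmul _ _⟩

lemma hull_nsmul {v : N} {g : ℕ} (hg : 0 < g) :
    PointedCone.hull ℝ (toReal '' ({g • v} : Set N)) =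
      PointedCone.hull ℝ (toReal '' ({v} : Set N)) := by
  have hg' : (0 : ℝ) < g := Nat.cast_pos.2 hg
  ext x
  rw [mem_hull_singleton, mem_hull_singleton]
  constructor
  · rintro ⟨c, hc, rfl⟩
    exact ⟨c * g, by positivity, by rw [toReal_nsmul, smul_smul]⟩
  · rintro ⟨c, hc, rfl⟩
    exact ⟨c / g, by positivity, by rw [toReal_nsmul, smul_smul, div_mul_cancel₀ _ hg'.ne']⟩

/-- A generator of a strongly convex cone that is not redundant spans a one-dimensional face. -/
lemma isFace_hull_singleton [Module.Free ℤ N] {s : Finset N} (hs : (0 : N) ∉ s)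
    (hσ : IsStronglyConvex (PointedCone.hull ℝ (toReal '' (s : Set N)))) {n : N} (hn : n ∈ s)
    (hmin : toReal n ∉ PointedCone.hull ℝ (toReal '' ((s : Set N) \ {n}))) :
    IsFace (PointedCone.hull ℝ (toReal '' ({n} : Set N)))
      (PointedCone.hull ℝ (toReal '' (s : Set N))) := by
  classical
  have hn0 : n ≠ 0 := fun h => hs (h ▸ hn)
  rcases exists_dual_pos_or_exists_sum_eq_smul (s.erase n) id hn0 with ⟨m, hm0, hm⟩ | ⟨c, e, hc, he⟩
  · have hm' : ∀ x ∈ (s : Set N), 0 ≤ m x := fun x hx => by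
      by_cases h : x = n
      · rw [h, hm0]
      · exact (hm x (Finset.mem_erase.2 ⟨h, hx⟩)).le
    refine ⟨m, mem_dualMonoid_hull.2 hm', fun x => ?_⟩
    rw [← mem_hull_and_pairing_eq_zero_iff hm']
    have : {x ∈ (s : Set N) | m x = 0} = {n} := by
      ext x
      simp only [Set.mem_ofPred_eq, Set.mem_singleton_iff, Finset.mem_coe]
      refine ⟨fun h => ?_, fun h => h ▸ ⟨hn, hm0⟩⟩
      by_contra hne
      exact (hm x (Finset.mem_erase.2 ⟨hne, h.1⟩)).ne' h.2
    rw [this]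
  · exfalso
    have hsum : ∀ t : Set N, (∀ x ∈ s, x ≠ n → x ∈ t) → ∑ i ∈ s.erase n, (c i : ℝ) • toReal i ∈
        PointedCone.hull ℝ (toReal '' t) := fun t ht =>
      Submodule.sum_mem _ fun i hi => smul_mem_cone (Nat.cast_nonneg _)
        (toReal_mem_hull (ht i (Finset.mem_of_mem_erase hi) (Finset.ne_of_mem_erase hi)))
    have he' : ∑ i ∈ s.erase n, (c i : ℝ) • toReal i = (e : ℝ) • toReal n := by
      have := congrArg toReal he
      rw [toReal_sum] at this
      simp only [toReal_nsmul, id] at this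
      rw [this]
      simp [toReal, TensorProduct.smul_tmul']
    rcases lt_or_ge 0 e with hpos | hneg
    · have hpos' : (0 : ℝ) < e := by exact_mod_cast hpos
      refine hmin ?_
      have h1 := smul_mem_cone (inv_nonneg.2 hpos'.le)
        (hsum ((s : Set N) \ {n}) fun x hx hne => ⟨hx, hne⟩)
      rwa [he', smul_smul, inv_mul_cancel₀ hpos'.ne', one_smul] at h1
    · obtain ⟨i, hi, hci⟩ := hc
      have hi' := Finset.mem_of_mem_erase hi
      -- the relation makes `-i` a member of the cone
      have h1 : (c i : ℝ) • toReal i + (∑ j ∈ (s.erase n).erase i, (c j : ℝ) • toReal j +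
          (-e : ℝ) • toReal n) = 0 := by
        rw [← add_assoc, Finset.add_sum_erase _ (fun j => (c j : ℝ) • toReal j) hi, he', neg_smul,
          add_neg_cancel]
      have h2 : -((c i : ℝ) • toReal i) ∈ PointedCone.hull ℝ (toReal '' (s : Set N)) := by
        rw [neg_eq_of_add_eq_zero_right h1]
        refine Submodule.add_mem _ (Submodule.sum_mem _ fun j hj => ?_) ?_
        · exact smul_mem_cone (Nat.cast_nonneg _) (toReal_mem_hull
            (Finset.mem_of_mem_erase (Finset.mem_of_mem_erase hj)))
        · refine smul_mem_cone ?_ (toReal_mem_hull hn)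
          have : (e : ℝ) ≤ 0 := by exact_mod_cast hneg
          linarith
      have h3 := hσ _ (smul_mem_cone (Nat.cast_nonneg (c i)) (toReal_mem_hull hi')) h2
      rcases smul_eq_zero.1 h3 with h | h
      · exact hci (by exact_mod_cast h)
      · have : i = 0 := toReal_injective (h.trans toReal_zero.symm)
        exact hs (this ▸ hi')

/-- Every rational polyhedral cone has an irredundant finite set of nonzero generators. -/
lemma exists_irredundant {σ : PointedCone ℝ (ℝ ⊗[ℤ] N)} (hσ : IsRationalPolyhedral σ) :
    ∃ s : Finset N, σ = PointedCone.hull ℝ (toReal '' (s : Set N)) ∧ (0 : N) ∉ s ∧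
      ∀ n ∈ s, toReal n ∉ PointedCone.hull ℝ (toReal '' ((s : Set N) \ {n})) := by
  classical
  have hex : ∃ k : ℕ, ∃ s : Finset N, s.card = k ∧
      σ = PointedCone.hull ℝ (toReal '' (s : Set N)) := by
    obtain ⟨s, hs⟩ := hσ
    exact ⟨_, s, rfl, hs⟩
  obtain ⟨s, hcard, hs⟩ := Nat.find_spec hex
  have hmin : ∀ n ∈ s, toReal n ∉ PointedCone.hull ℝ (toReal '' ((s : Set N) \ {n})) := by
    intro n hn hmem
    refine Nat.find_min hex (m := (s.erase n).card)
      (hcard ▸ Finset.card_erase_lt_of_mem hn) ⟨s.erase n, rfl, ?_⟩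
    rw [hs]
    refine le_antisymm (Submodule.span_le.2 ?_)
      (Submodule.span_mono (Set.image_mono (by simp [Finset.coe_erase])))
    rintro _ ⟨x, hx, rfl⟩
    rw [Finset.coe_erase]
    by_cases h : x = n
    · exact h ▸ hmem
    · exact toReal_mem_hull ⟨hx, h⟩
  refine ⟨s, hs, fun h0 => hmin 0 h0 ?_, hmin⟩
  rw [toReal_zero]
  exact Submodule.zero_mem _

lemma finrank_span_hull_singleton [Module.Free ℤ N] {n : N} (hn : n ≠ 0) :
    Module.finrank ℝ (Submodule.span ℝ
      ((PointedCone.hull ℝ (toReal '' ({n} : Set N)) : PointedCone ℝ (ℝ ⊗[ℤ] N)) :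
        Set (ℝ ⊗[ℤ] N))) = 1 := by
  have : Submodule.span ℝ ((PointedCone.hull ℝ (toReal '' ({n} : Set N)) :
      PointedCone ℝ (ℝ ⊗[ℤ] N)) : Set (ℝ ⊗[ℤ] N)) = Submodule.span ℝ {toReal n} := by
    refine le_antisymm (Submodule.span_le.2 fun x hx => ?_) (Submodule.span_le.2 ?_)
    · obtain ⟨c, _, rfl⟩ := mem_hull_singleton.1 hx
      exact Submodule.smul_mem _ _ (Submodule.mem_span_singleton_self _)
    · rintro _ rfl
      exact Submodule.subset_span (toReal_mem_hull rfl)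
  rw [this]
  exact finrank_span_singleton fun h => hn (toReal_injective (h.trans toReal_zero.symm))

namespace Fan

variable [Module.Free ℤ N] (Δ : Fan N)

/-- A ray generator is primitive, and it generates its ray. -/
lemma rayGenerators_primitive {v : N} (hv : v ∈ Δ.rayGenerators) :
    PointedCone.hull ℝ (toReal '' ({v} : Set N)) ∈ Δ.cones ∧
      ∃ w : Module.Dual ℤ N, w v = 1 := by
  obtain ⟨τ, ⟨hτ, hdim⟩, h⟩ := hv
  obtain ⟨s, hs⟩ := Δ.rational τ hτ
  have hvτ : toReal v ∈ τ := (h v).2 ⟨1, (one_smul _ _).symm⟩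
  have hle : τ = PointedCone.hull ℝ (toReal '' ({v} : Set N)) := by
    refine le_antisymm ?_ (Submodule.span_le.2 ?_)
    · conv_lhs => rw [hs]
      refine Submodule.span_le.2 ?_
      rintro _ ⟨n, hn, rfl⟩
      obtain ⟨k, rfl⟩ := (h n).1 (hs ▸ toReal_mem_hull hn)
      exact mem_hull_singleton.2 ⟨k, Nat.cast_nonneg _, toReal_nsmul _ _⟩
    · rintro _ ⟨_, rfl, rfl⟩
      exact hvτ
  have hv0 : v ≠ 0 := by
    rintro rfl
    have : Submodule.span ℝ (τ : Set (ℝ ⊗[ℤ] N)) = ⊥ := by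
      refine Submodule.span_eq_bot.2 fun x hx => ?_
      rw [hle] at hx
      obtain ⟨c, _, rfl⟩ := mem_hull_singleton.1 hx
      rw [toReal_zero, smul_zero]
    rw [this, finrank_bot] at hdim
    exact zero_ne_one hdim
  refine ⟨hle ▸ hτ, ?_⟩
  obtain ⟨u, g, w, hg, rfl, hw⟩ := exists_primitive hv0
  have hu : toReal u ∈ τ := by
    rw [hle, hull_nsmul hg]
    exact toReal_mem_hull rfl
  obtain ⟨k, hk⟩ := (h u).1 hu
  have h1 := congrArg w hk
  simp only [map_nsmul, hw, nsmul_eq_mul, mul_one] at h1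
  have h2 : g = 1 := Nat.eq_one_of_mul_eq_one_left (m := k) (by exact_mod_cast h1.symm)
  exact ⟨w, by rw [h2, one_smul, hw]⟩

lemma mem_rayGenerators {v : N} {w : Module.Dual ℤ N} (hw : w v = 1)
    (hv : PointedCone.hull ℝ (toReal '' ({v} : Set N)) ∈ Δ.cones) : v ∈ Δ.rayGenerators :=
  ⟨_, ⟨hv, finrank_span_hull_singleton (by rintro rfl; simp at hw)⟩,
    toReal_mem_hull_primitive_iff hw⟩

lemma rayGenerators_finite : Δ.rayGenerators.Finite := by
  refine Set.Finite.of_finite_image (f := fun v => PointedCone.hull ℝ (toReal '' ({v} : Set N)))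
    (Δ.finite_cones.subset ?_) ?_
  · rintro _ ⟨v, hv, rfl⟩
    exact (Δ.rayGenerators_primitive hv).1
  · intro v hv v' hv' h
    replace h : PointedCone.hull ℝ (toReal '' ({v} : Set N)) =
      PointedCone.hull ℝ (toReal '' ({v'} : Set N)) := h
    obtain ⟨w, hw⟩ := (Δ.rayGenerators_primitive hv).2
    obtain ⟨w', hw'⟩ := (Δ.rayGenerators_primitive hv').2
    obtain ⟨k, hk⟩ := (toReal_mem_hull_primitive_iff hw' v).1 (h ▸ toReal_mem_hull rfl)
    have h1 := congrArg w hk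
    simp only [map_nsmul, hw, nsmul_eq_mul] at h1
    have h2 : k = 1 := by
      have := Int.eq_one_or_neg_one_of_mul_eq_one h1.symm
      omega
    rw [hk, h2, one_smul]

/-- A cone of a fan is generated by the rays of the fan that it contains. -/
lemma exists_cone_eq_hull {σ : PointedCone ℝ (ℝ ⊗[ℤ] N)} (hσ : σ ∈ Δ.cones) :
    ∃ t ⊆ Δ.rayGenerators, σ = PointedCone.hull ℝ (toReal '' t) := by
  obtain ⟨s, rfl, h0, hmin⟩ := exists_irredundant (Δ.rational σ hσ)
  refine ⟨{v ∈ Δ.rayGenerators | toReal v ∈ PointedCone.hull ℝ (toReal '' (s : Set N))},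
    Set.sep_subset _ _, ?_⟩
  refine le_antisymm (Submodule.span_le.2 ?_) (Submodule.span_le.2 ?_)
  · rintro _ ⟨n, hn, rfl⟩
    have hface := isFace_hull_singleton h0 (Δ.stronglyConvex _ hσ) hn (hmin n hn)
    have hmem := Δ.face_mem _ hσ _ hface
    obtain ⟨v, g, w, hg, rfl, hw⟩ := exists_primitive (n := n) (fun h => h0 (h ▸ hn))
    rw [hull_nsmul hg] at hmem hface
    rw [toReal_nsmul]
    exact smul_mem_cone (Nat.cast_nonneg _) (toReal_mem_hull
      ⟨Δ.mem_rayGenerators hw hmem, hface.le (toReal_mem_hull rfl)⟩)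
  · rintro _ ⟨n, hn, rfl⟩
    exact hn.2

/-- A linear form that is nonnegative on all rays of a complete fan vanishes. -/
lemma IsComplete.exists_neg {Δ : Fan N} (hΔ : Δ.IsComplete) {m : Module.Dual ℤ N} (hm : m ≠ 0) :
    ∃ v ∈ Δ.rayGenerators, m v < 0 := by
  by_contra! h
  refine hm (LinearMap.ext fun n => ?_)
  have key : ∀ n : N, 0 ≤ m n := fun n => by
    obtain ⟨σ, hσ, hn⟩ := hΔ (toReal n)
    obtain ⟨t, ht, rfl⟩ := Δ.exists_cone_eq_hull hσ
    have := mem_dualMonoid_hull.2 (fun v hv => h v (ht hv)) _ hn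
    rw [pairing_toReal] at this
    exact_mod_cast this
  have h1 := key n
  have h2 := key (-n)
  rw [map_neg] at h2
  rw [LinearMap.zero_apply]
  omega

lemma IsComplete.bot_mem {Δ : Fan N} (hΔ : Δ.IsComplete) : ⊥ ∈ Δ.cones := by
  obtain ⟨σ, hσ, -⟩ := hΔ 0
  obtain ⟨s, hs⟩ := Δ.rational σ hσ
  classical
  -- a form that is positive on all nonzero generators cuts out the zero face
  rcases exists_dual_pos_or_exists_sum_eq_zero (s.erase 0) id with ⟨m, hm⟩ | ⟨c, ⟨i, hi, hci⟩, hc⟩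
  · have hm' : ∀ x ∈ (s : Set N), 0 ≤ m x := fun x hx => by
      by_cases h : x = 0
      · rw [h, map_zero]
      · exact (hm x (Finset.mem_erase.2 ⟨h, hx⟩)).le
    refine Δ.face_mem σ hσ ⊥ ⟨m, hs ▸ mem_dualMonoid_hull.2 hm', fun x => ?_⟩
    rw [hs, ← mem_hull_and_pairing_eq_zero_iff hm']
    have : PointedCone.hull ℝ (toReal '' {x ∈ (s : Set N) | m x = 0}) = ⊥ := by
      refine Submodule.span_eq_bot.2 ?_
      rintro _ ⟨x, ⟨hx, hx0⟩, rfl⟩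
      by_cases h : x = 0
      · rw [h, toReal_zero]
      · exact absurd hx0 (hm x (Finset.mem_erase.2 ⟨h, hx⟩)).ne'
    rw [this]
  · exfalso
    have h1 : (c i : ℝ) • toReal i + ∑ j ∈ (s.erase 0).erase i, (c j : ℝ) • toReal j = 0 := by
      rw [Finset.add_sum_erase _ (fun j => (c j : ℝ) • toReal j) hi]
      have := congrArg toReal hc
      rw [toReal_sum, toReal_zero] at this
      simpa only [toReal_nsmul, id] using this
    have h2 : -((c i : ℝ) • toReal i) ∈ σ := by
      rw [neg_eq_of_add_eq_zero_right h1, hs]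
      exact Submodule.sum_mem _ fun j hj => smul_mem_cone (Nat.cast_nonneg _) (toReal_mem_hull
        (Finset.mem_of_mem_erase (Finset.mem_of_mem_erase hj)))
    have h3 := Δ.stronglyConvex σ hσ _ (smul_mem_cone (Nat.cast_nonneg (c i))
      (hs ▸ toReal_mem_hull (Finset.mem_of_mem_erase hi))) h2
    rcases smul_eq_zero.1 h3 with h | h
    · exact hci (by exact_mod_cast h)
    · exact (Finset.mem_erase.1 hi).1 (toReal_injective (h.trans toReal_zero.symm))

end Fan

end Polyhedral

/-! ### Linked vectors, simple roots and sinks -/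

section Combinatorics

variable {N : Type} [AddCommGroup N]

/-- The Demazure roots of a set `P` of lattice vectors, playing the role of the ray generators. -/
def rootsOf (P : Set N) : Set (Module.Dual ℤ N) :=
  {m | ∃ v ∈ P, m v = -1 ∧ ∀ v' ∈ P, v' ≠ v → 0 ≤ m v'}

/-- The semisimple roots of a set of lattice vectors. -/
def ssRootsOf (P : Set N) : Set (Module.Dual ℤ N) := {m ∈ rootsOf P | -m ∈ rootsOf P}

/-- The vectors of `P` on which some element of `A` takes the value `-1`. -/
def etaOf (P : Set N) (A : Set (Module.Dual ℤ N)) : Set N := {v ∈ P | ∃ m ∈ A, m v = -1}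

/-- `P` spans `N_ℝ` positively: a linear form that is nonnegative on `P` vanishes. -/
def PositivelySpans (P : Set N) : Prop := ∀ m : Module.Dual ℤ N, m ≠ 0 → ∃ v ∈ P, m v < 0

lemma PositivelySpans.eq_zero {P : Set N} (hP : PositivelySpans P) {m : Module.Dual ℤ N}
    (h : ∀ v ∈ P, 0 ≤ m v) : m = 0 := by
  by_contra hm
  obtain ⟨v, hv, hlt⟩ := hP m hm
  exact absurd (h v hv) (not_le.2 hlt)

lemma PositivelySpans.ext {P : Set N} (hP : PositivelySpans P) {m m' : Module.Dual ℤ N}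
    (h : ∀ v ∈ P, m v = m' v) : m = m' :=
  sub_eq_zero.1 (hP.eq_zero fun v hv => by simp [h v hv])

/-- The form `s` takes the values `-1` at `v`, `1` at `v'` and `0` on the rest of `P`. -/
structure IsRootPair (P : Set N) (s : Module.Dual ℤ N) (v v' : N) : Prop where
  left_mem : v ∈ P
  right_mem : v' ∈ P
  ne : v ≠ v'
  left : s v = -1
  right : s v' = 1
  other : ∀ w ∈ P, w ≠ v → w ≠ v' → s w = 0

lemma IsRootPair.neg {P : Set N} {s : Module.Dual ℤ N} {v v' : N} (h : IsRootPair P s v v') :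
    IsRootPair P (-s) v' v :=
  ⟨h.right_mem, h.left_mem, h.ne.symm, by simp [h.right], by simp [h.left],
    fun w hw h1 h2 => by simp [h.other w hw h2 h1]⟩

lemma IsRootPair.mem_rootsOf {P : Set N} {s : Module.Dual ℤ N} {v v' : N}
    (h : IsRootPair P s v v') : s ∈ rootsOf P :=
  ⟨v, h.left_mem, h.left, fun w hw hne => by
    by_cases h' : w = v'
    · rw [h', h.right]; exact zero_le_one
    · exact (h.other w hw hne h').ge⟩

lemma IsRootPair.mem_ssRootsOf {P : Set N} {s : Module.Dual ℤ N} {v v' : N}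
    (h : IsRootPair P s v v') : s ∈ ssRootsOf P := ⟨h.mem_rootsOf, h.neg.mem_rootsOf⟩

lemma exists_isRootPair {P : Set N} {s : Module.Dual ℤ N} (hs : s ∈ ssRootsOf P) :
    ∃ v v', IsRootPair P s v v' := by
  obtain ⟨⟨v, hv, h1, h2⟩, v', hv', h3, h4⟩ := hs
  rw [LinearMap.neg_apply] at h3
  refine ⟨v, v', hv, hv', fun h => ?_, h1, by omega, fun w hw hne hne' => ?_⟩
  · rw [← h] at h3; omega
  · have h5 := h2 w hw hne
    have h6 := h4 w hw hne'
    rw [LinearMap.neg_apply] at h6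
    omega

lemma IsRootPair.left_unique {P : Set N} {s : Module.Dual ℤ N} {v v' w w' : N}
    (h : IsRootPair P s v v') (h' : IsRootPair P s w w') : v = w := by
  by_contra hne
  have h1 := h'.left
  by_cases h2 : w = v'
  · rw [h2, h.right] at h1; omega
  · rw [h.other w h'.left_mem (Ne.symm hne) h2] at h1; omega

lemma IsRootPair.eta_unique {P : Set N} {s : Module.Dual ℤ N} {v v' w : N}
    (h : IsRootPair P s v v') (hw : w ∈ P) (h' : s w = -1) : w = v := by
  by_contra hne
  by_cases h2 : w = v'
  · rw [h2, h.right] at h'; omega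
  · rw [h.other w hw hne h2] at h'; omega

/-- Two vectors are linked if they are equal or the values `-1`, `1` of a semisimple root are taken
at them. -/
def Linked (P : Set N) (v v' : N) : Prop := v = v' ∨ ∃ s, IsRootPair P s v v'

lemma Linked.symm {P : Set N} {v v' : N} (h : Linked P v v') : Linked P v' v := by
  rcases h with rfl | ⟨s, hs⟩
  · exact Or.inl rfl
  · exact Or.inr ⟨-s, hs.neg⟩

/-- The sum of the roots of two consecutive links is the root of the composite link. -/
lemma Linked.trans {P : Set N} {v v' v'' : N} (h : Linked P v v') (h' : Linked P v' v'') :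
    Linked P v v'' := by
  rcases h with rfl | ⟨s, hs⟩
  · exact h'
  rcases h' with rfl | ⟨s', hs'⟩
  · exact Or.inr ⟨s, hs⟩
  by_cases hne : v = v''
  · exact Or.inl hne
  refine Or.inr ⟨s + s', hs.left_mem, hs'.right_mem, hne, ?_, ?_, fun w hw h1 h2 => ?_⟩
  · rw [LinearMap.add_apply, hs.left, hs'.other v hs.left_mem hs.ne hne, add_zero]
  · rw [LinearMap.add_apply, hs'.right, hs.other v'' hs'.right_mem (Ne.symm hne) hs'.ne.symm,
      zero_add]
  · rw [LinearMap.add_apply]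
    by_cases h3 : w = v'
    · rw [h3, hs.right, hs'.left]; norm_num
    · rw [hs.other w hw h1 h3, hs'.other w hw h3 h2, add_zero]

/-- Being linked is an equivalence relation. -/
def linkedSetoid (P : Set N) : Setoid N :=
  ⟨Linked P, fun _ => Or.inl rfl, Linked.symm, Linked.trans⟩

/-- A chosen representative of the class of linked vectors containing `v`. -/
noncomputable def classRep (P : Set N) (v : N) : N :=
  Quotient.out (Quotient.mk (linkedSetoid P) v)

lemma linked_classRep (P : Set N) (v : N) : Linked P (classRep P v) v :=
  Quotient.mk_out (s := linkedSetoid P) v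

lemma classRep_eq {P : Set N} {v v' : N} (h : Linked P v v') : classRep P v = classRep P v' := by
  unfold classRep
  rw [Quotient.sound (s := linkedSetoid P) h]

lemma classRep_classRep (P : Set N) (v : N) : classRep P (classRep P v) = classRep P v :=
  classRep_eq (linked_classRep P v)

lemma linked_of_classRep_eq {P : Set N} {v v' : N} (h : classRep P v = classRep P v') :
    Linked P v v' :=
  (linked_classRep P v).symm.trans (h ▸ linked_classRep P v')

/-- The vectors of `P` that are not the representatives of their classes. Their number is the
rank of the root system of semisimple roots. -/
def nonReps (P : Set N) : Set N := {v ∈ P | classRep P v ≠ v}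

lemma exists_isRootPair_classRep {P : Set N} {v : N} (hv : v ∈ nonReps P) :
    ∃ s, IsRootPair P s (classRep P v) v :=
  (linked_classRep P v).resolve_left hv.2

lemma classRep_not_mem_nonReps (P : Set N) (v : N) : classRep P v ∉ nonReps P :=
  fun h => h.2 (classRep_classRep P v)

/-- For `v ∈ nonReps P`, the semisimple root with values `-1` at the representative of the class
and `1` at `v`. -/
noncomputable def simpleRoot (P : Set N) (v : N) : Module.Dual ℤ N :=
  open Classical in if h : v ∈ nonReps P then (exists_isRootPair_classRep h).choose else 0

lemma simpleRoot_spec {P : Set N} {v : N} (hv : v ∈ nonReps P) :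
    IsRootPair P (simpleRoot P v) (classRep P v) v := by
  rw [simpleRoot, dif_pos hv]
  exact (exists_isRootPair_classRep hv).choose_spec

lemma simpleRoot_apply {P : Set N} {v w : N} (hv : v ∈ nonReps P) (hw : w ∈ nonReps P)
    (hne : w ≠ v) : simpleRoot P v w = 0 :=
  (simpleRoot_spec hv).other w hw.1
    (fun h => classRep_not_mem_nonReps P v (h ▸ hw)) hne

/-- A triangularity criterion: if every nonempty set of indices `G` has a member `v` such that the
functionals `ℓ w`, `w ∈ G \ {v}`, vanish on `x v`, then the `ℓ v` are linearly independent. -/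
lemma card_le_finrank_of_triangular {k W ι : Type*} [Field k] [AddCommGroup W] [Module k W]
    [FiniteDimensional k W] (F : Finset ι) (ℓ : ι → Module.Dual k W) (x : ι → W)
    (hdiag : ∀ v ∈ F, ℓ v (x v) ≠ 0)
    (hsink : ∀ G ⊆ F, G.Nonempty → ∃ v ∈ G, ∀ w ∈ G, w ≠ v → ℓ w (x v) = 0) :
    F.card ≤ Module.finrank k W := by
  classical
  have hli : LinearIndependent k (fun v : F => ℓ v) := by
    rw [linearIndependent_iff']
    intro s g hg
    by_contra! hne
    obtain ⟨i, hi, hgi⟩ := hne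
    obtain ⟨v, hv, hz⟩ := hsink ((s.filter fun i => g i ≠ 0).image Subtype.val)
      (fun w hw => by obtain ⟨a, -, rfl⟩ := Finset.mem_image.1 hw; exact a.2)
      ⟨i, Finset.mem_image.2 ⟨i, Finset.mem_filter.2 ⟨hi, hgi⟩, rfl⟩⟩
    obtain ⟨v', hv', rfl⟩ := Finset.mem_image.1 hv
    have hv'' := Finset.mem_filter.1 hv'
    have h1 := congrArg (fun f : Module.Dual k W => f (x v')) hg
    simp only [LinearMap.sum_apply, LinearMap.smul_apply, LinearMap.zero_apply, smul_eq_mul] at h1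
    rw [Finset.sum_eq_single_of_mem v' hv''.1] at h1
    · exact (mul_ne_zero hv''.2 (hdiag v' v'.2)) h1
    · intro b hb hbne
      by_cases h0 : g b = 0
      · rw [h0, zero_mul]
      · rw [hz b (Finset.mem_image.2 ⟨b, Finset.mem_filter.2 ⟨hb, h0⟩, rfl⟩)
          (fun h => hbne (Subtype.ext h)), mul_zero]
  have := hli.fintype_card_le_finrank
  rwa [Fintype.card_coe, Subspace.dual_finrank_eq] at this

/-- The real-linear extension of the evaluation of linear forms at a lattice vector. -/
noncomputable def evalReal (n : N) : Module.Dual ℝ (ℝ ⊗[ℤ] Module.Dual ℤ N) :=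
  LinearMap.liftBaseChange ℝ ((Algebra.linearMap ℤ ℝ).comp (Module.Dual.eval ℤ N n))

lemma evalReal_toReal (n : N) (m : Module.Dual ℤ N) : evalReal n (toReal m) = (m n : ℝ) := by
  simp [evalReal, toReal]

lemma evalReal_eq_zero {A : Set (Module.Dual ℤ N)} {n : N} (h : ∀ s ∈ A, s n = 0) :
    linHull A ≤ LinearMap.ker (evalReal n) := by
  refine Submodule.span_le.2 ?_
  rintro _ ⟨s, hs, rfl⟩
  rw [SetLike.mem_coe, LinearMap.mem_ker, evalReal_toReal, h s hs, Int.cast_zero]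

/-- Among finitely many unipotent roots `u v` with `u v v = -1` there is one that vanishes at all
the other vectors `w`. Otherwise a cycle `v₁ → v₂ → ⋯ → v₁` with `u vᵢ vᵢ₊₁ > 0` exists; the sum of
the `u vᵢ` along it is nonnegative on `P`, hence zero, which makes every `u vᵢ` semisimple. -/
lemma exists_sink {P : Set N} (hP : PositivelySpans P) (u : N → Module.Dual ℤ N) (G : Finset N)
    (hG : G.Nonempty) (hmem : ∀ v ∈ G, v ∈ P) (hdiag : ∀ v ∈ G, u v v = -1)
    (hoff : ∀ v ∈ G, ∀ w ∈ P, w ≠ v → 0 ≤ u v w) (huni : ∀ v ∈ G, -u v ∉ rootsOf P) :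
    ∃ v ∈ G, ∀ w ∈ G, w ≠ v → u v w = 0 := by
  classical
  by_contra! hcon
  have hex : ∀ v, ∃ w, v ∈ G → w ∈ G ∧ w ≠ v ∧ u v w ≠ 0 := fun v => by
    by_cases hv : v ∈ G
    · obtain ⟨w, h⟩ := hcon v hv
      exact ⟨w, fun _ => h⟩
    · exact ⟨v, fun h => absurd h hv⟩
  choose f hf using hex
  have hne : (G.powerset.filter fun H => H.Nonempty ∧ ∀ v ∈ H, f v ∈ H).Nonempty :=
    ⟨G, Finset.mem_filter.2 ⟨Finset.mem_powerset_self _, hG, fun v hv => (hf v hv).1⟩⟩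
  obtain ⟨H, hH, hmin⟩ := Finset.exists_min_image _ Finset.card hne
  rw [Finset.mem_filter, Finset.mem_powerset] at hH
  obtain ⟨hHG, hHne, hHf⟩ := hH
  -- a minimal set stable under `f` is mapped onto itself
  have himg : H.image f = H := by
    have hsub : H.image f ⊆ H := Finset.image_subset_iff.2 hHf
    refine Finset.eq_of_subset_of_card_le hsub (hmin _ (Finset.mem_filter.2 ⟨?_, ?_, ?_⟩))
    · exact Finset.mem_powerset.2 (hsub.trans hHG)
    · exact hHne.image f
    · exact fun v hv => Finset.mem_image_of_mem f (hsub hv)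
  have hpred : ∀ w ∈ H, ∃ x ∈ H, f x = w := fun w hw => by
    rw [← himg] at hw
    obtain ⟨x, hx, rfl⟩ := Finset.mem_image.1 hw
    exact ⟨x, hx, rfl⟩
  have hpos : ∀ x ∈ H, 1 ≤ u x (f x) := fun x hx => by
    obtain ⟨h1, h2, h3⟩ := hf x (hHG hx)
    have := hoff x (hHG hx) (f x) (hmem _ h1) h2
    omega
  have hsplit : ∀ x ∈ H, ∀ z ∈ H, z ≠ x → ∀ g : N → ℤ, ∑ y ∈ H, g y =
      g x + (g z + ∑ y ∈ (H.erase x).erase z, g y) := fun x hx z hz hne g => by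
    rw [Finset.add_sum_erase _ g (Finset.mem_erase.2 ⟨hne, hz⟩), Finset.add_sum_erase _ g hx]
  have hrest : ∀ z ∈ P, ∀ K ⊆ H, z ∉ K → 0 ≤ ∑ y ∈ K, u y z := fun z hz K hK hzK =>
    Finset.sum_nonneg fun y hy => hoff y (hHG (hK hy)) z hz fun h => hzK (h ▸ hy)
  have hsum : ∑ v ∈ H, u v = 0 := by
    refine hP.eq_zero fun z hz => ?_
    rw [LinearMap.sum_apply]
    by_cases hzH : z ∈ H
    · obtain ⟨x, hx, rfl⟩ := hpred z hzH
      rw [hsplit x hx _ hzH (hf x (hHG hx)).2.1]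
      have h1 := hpos x hx
      have h2 := hdiag _ (hHG hzH)
      have h3 := hrest _ hz ((H.erase x).erase (f x))
        ((Finset.erase_subset _ _).trans (Finset.erase_subset _ _)) (Finset.notMem_erase _ _)
      omega
    · exact hrest z hz H subset_rfl hzH
  have hsum' : ∀ z, ∑ v ∈ H, u v z = 0 := fun z => by
    rw [← LinearMap.sum_apply, hsum, LinearMap.zero_apply]
  obtain ⟨v, hv⟩ := hHne
  have hfv := hHf v hv
  have hfne := (hf v (hHG hv)).2.1
  refine huni v (hHG hv) ⟨f v, hmem _ (hHG hfv), ?_, fun z hz hzne => ?_⟩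
  · have h1 := hsum' (f v)
    rw [hsplit v hv _ hfv hfne] at h1
    have h2 := hpos v hv
    have h3 := hdiag _ (hHG hfv)
    have h4 := hrest _ (hmem _ (hHG hfv)) ((H.erase v).erase (f v))
      ((Finset.erase_subset _ _).trans (Finset.erase_subset _ _)) (Finset.notMem_erase _ _)
    rw [LinearMap.neg_apply]
    omega
  · rw [LinearMap.neg_apply]
    by_cases hzv : z = v
    · rw [hzv, hdiag v (hHG hv)]; norm_num
    have h0 := hoff v (hHG hv) z hz hzv
    have h1 := hsum' z
    by_cases hzH : z ∈ H
    · obtain ⟨x, hx, rfl⟩ := hpred z hzH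
      have hxv : v ≠ x := by rintro rfl; exact hzne rfl
      have hxf := (hf x (hHG hx)).2.1
      rw [hsplit x hx _ hzH hxf, ← Finset.add_sum_erase _ _ (Finset.mem_erase.2
        ⟨Ne.symm hzv, Finset.mem_erase.2 ⟨hxv, hv⟩⟩)] at h1
      have h2 := hpos x hx
      have h3 := hdiag _ (hHG hzH)
      have h4 := hrest _ hz (((H.erase x).erase (f x)).erase v)
        (((Finset.erase_subset _ _).trans (Finset.erase_subset _ _)).trans
          (Finset.erase_subset _ _))
        (fun h => Finset.notMem_erase _ _ (Finset.mem_of_mem_erase h))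
      omega
    · rw [← Finset.add_sum_erase _ _ hv] at h1
      have h4 := hrest _ hz (H.erase v) (Finset.erase_subset _ _)
        (fun h => hzH (Finset.mem_of_mem_erase h))
      omega

variable [Module.Free ℤ N] [Module.Finite ℤ N]

lemma finrank_real_dual :
    Module.finrank ℝ (ℝ ⊗[ℤ] Module.Dual ℤ N) = Module.finrank ℤ N := by
  rw [Module.finrank_baseChange]
  exact (Module.finrank_linearMap ℤ ℤ N ℤ).trans (by rw [Module.finrank_self, mul_one])

/-- The simple roots are linearly independent: they are dual to the members of `nonReps P`. -/
lemma card_nonReps_le {P : Set N} (T : Finset N) (hT : ∀ v ∈ T, v ∈ nonReps P) :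
    T.card ≤ Module.finrank ℝ (linHull (ssRootsOf P)) := by
  refine card_le_finrank_of_triangular T
    (fun v => (evalReal v).comp (linHull (ssRootsOf P)).subtype)
    (fun v => (open Classical in if h : v ∈ nonReps P then
      ⟨toReal (simpleRoot P v), Submodule.subset_span
        ⟨_, (simpleRoot_spec h).mem_ssRootsOf, rfl⟩⟩ else 0)) ?_ ?_
  · intro v hv
    rw [dif_pos (hT v hv), LinearMap.comp_apply, Submodule.subtype_apply, evalReal_toReal,
      (simpleRoot_spec (hT v hv)).right]
    simp
  · rintro G hG ⟨v, hv⟩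
    refine ⟨v, hv, fun w hw hne => ?_⟩
    rw [dif_pos (hT v (hG hv)), LinearMap.comp_apply, Submodule.subtype_apply, evalReal_toReal,
      simpleRoot_apply (hT v (hG hv)) (hT w (hG hw)) hne, Int.cast_zero]

/-- The bound on the values of `η` at unipotent roots, relative to a set `A` of forms that vanish
on these values. -/
lemma encard_eta_unipotent_le {P : Set N} (hP : PositivelySpans P) (A : Set (Module.Dual ℤ N))
    (F : Set N) (hF : F ⊆ etaOf P (rootsOf P \ ssRootsOf P)) (hA : ∀ s ∈ A, ∀ w ∈ F, s w = 0) :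
    F.encard ≤ (Module.finrank ℝ ((ℝ ⊗[ℤ] Module.Dual ℤ N) ⧸ linHull A) : ℕ∞) := by
  classical
  have hex : ∀ v, ∃ m : Module.Dual ℤ N, v ∈ F → v ∈ P ∧ m v = -1 ∧
      (∀ w ∈ P, w ≠ v → 0 ≤ m w) ∧ -m ∉ rootsOf P := fun v => by
    by_cases hv : v ∈ F
    · obtain ⟨hvP, m, ⟨⟨v', hv', h1, h2⟩, hm'⟩, h3⟩ := hF hv
      have : v' = v := by
        by_contra hne
        have := h2 v hvP (Ne.symm hne)
        omega
      subst this
      exact ⟨m, fun _ => ⟨hvP, h3, h2, fun h => hm' ⟨⟨v', hv', h1, h2⟩, h⟩⟩⟩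
    · exact ⟨0, fun h => absurd h hv⟩
  choose u hu using hex
  have hfin : ∀ G : Finset N, (G : Set N) ⊆ F →
      G.card ≤ Module.finrank ℝ ((ℝ ⊗[ℤ] Module.Dual ℤ N) ⧸ linHull A) := fun G hG => by
    refine card_le_finrank_of_triangular G
      (fun w => if h : w ∈ F then
        (linHull A).liftQ (evalReal w) (evalReal_eq_zero fun s hs => hA s hs w h) else 0)
      (fun v => (linHull A).mkQ (toReal (u v))) ?_ ?_
    · intro v hv
      simp only [dif_pos (hG hv), Submodule.mkQ_apply, Submodule.liftQ_apply]
      rw [evalReal_toReal, (hu v (hG hv)).2.1]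
      simp
    · intro H hH hne
      have hHF : ∀ v ∈ H, v ∈ F := fun v hv => hG (hH hv)
      obtain ⟨v, hv, h⟩ := exists_sink hP u H hne (fun v hv => (hu v (hHF v hv)).1)
        (fun v hv => (hu v (hHF v hv)).2.1) (fun v hv => (hu v (hHF v hv)).2.2.1)
        (fun v hv => (hu v (hHF v hv)).2.2.2)
      refine ⟨v, hv, fun w hw hwne => ?_⟩
      simp only [dif_pos (hHF w hw), Submodule.mkQ_apply, Submodule.liftQ_apply]
      rw [evalReal_toReal, h w hw hwne, Int.cast_zero]
  by_contra! hlt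
  obtain ⟨G, hGF, hG⟩ := Set.exists_subset_encard_eq (Order.add_one_le_of_lt hlt)
  have hGfin : G.Finite := Set.finite_of_encard_eq_coe (k := Module.finrank ℝ
    ((ℝ ⊗[ℤ] Module.Dual ℤ N) ⧸ linHull A) + 1) (by rw [hG]; push_cast; rfl)
  have h1 := hfin hGfin.toFinset (by simpa using hGF)
  rw [hGfin.encard_eq_coe_toFinset_card] at hG
  have h2 : hGfin.toFinset.card = Module.finrank ℝ
    ((ℝ ⊗[ℤ] Module.Dual ℤ N) ⧸ linHull A) + 1 := by exact_mod_cast hG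
  omega

end Combinatorics

/-! ### Counting roots -/

section Counting

variable {N : Type} [AddCommGroup N]

lemma nonReps_finite {P : Set N} (hfin : P.Finite) : (nonReps P).Finite :=
  hfin.subset (Set.sep_subset _ _)

/-- The values of `η` at semisimple roots are the vectors in the classes with at least two members. -/
lemma etaOf_ssRootsOf (P : Set N) :
    etaOf P (ssRootsOf P) = nonReps P ∪ classRep P '' nonReps P := by
  ext v
  constructor
  · rintro ⟨hv, s, hs, hsv⟩
    obtain ⟨x, v', h⟩ := exists_isRootPair hs
    obtain rfl := h.eta_unique hv hsv
    by_cases hb : classRep P v = v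
    · have hb' : classRep P v' = v := by rw [← classRep_eq (Or.inr ⟨s, h⟩), hb]
      exact Or.inr ⟨v', ⟨h.right_mem, fun h' => h.ne (hb'.symm.trans h')⟩, hb'⟩
    · exact Or.inl ⟨hv, hb⟩
  · rintro (hv | ⟨v, hv, rfl⟩)
    · have h := (simpleRoot_spec hv).neg
      exact ⟨hv.1, _, h.mem_ssRootsOf, h.left⟩
    · have h := simpleRoot_spec hv
      exact ⟨h.left_mem, _, h.mem_ssRootsOf, h.left⟩

lemma encard_etaOf_ssRootsOf_le (P : Set N) :
    (etaOf P (ssRootsOf P)).encard ≤ (nonReps P).encard + (classRep P '' nonReps P).encard := by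
  rw [etaOf_ssRootsOf]
  exact Set.encard_union_le _ _

lemma encard_etaOf_rootsOf_le (P : Set N) :
    (etaOf P (rootsOf P)).encard ≤ (etaOf P (ssRootsOf P)).encard +
      (etaOf P (rootsOf P \ ssRootsOf P) \ etaOf P (ssRootsOf P)).encard := by
  refine (Set.encard_le_encard ?_).trans (Set.encard_union_le _ _)
  rintro v ⟨hv, m, hm, h⟩
  by_cases h' : v ∈ etaOf P (ssRootsOf P)
  · exact Or.inl h'
  · exact Or.inr ⟨⟨hv, m, ⟨hm, fun hs => h' ⟨hv, m, hs, h⟩⟩, h⟩, h'⟩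

/-- A code for an ordered pair `(v, v')` of distinct linked vectors. If `v'` is not a representative,
the code is `(v', v)`, where `none` stands for the representative of the class; otherwise it is
`(v, v)`, which is not the code of a pair of the first kind since the vectors are distinct. -/
noncomputable def pairCode (P : Set N) (v v' : N) : N × Option N :=
  open Classical in
  if v' ∈ nonReps P then (v', if v ∈ nonReps P then some v else none) else (v, some v)

/-- The code of the pair of vectors attached to a semisimple root. -/
noncomputable def rootCode (P : Set N) (s : Module.Dual ℤ N) : N × Option N :=
  open Classical in
  if h : s ∈ ssRootsOf P then
    pairCode P (exists_isRootPair h).choose (exists_isRootPair h).choose_spec.choose else (0, none)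

lemma rootCode_spec {P : Set N} {s : Module.Dual ℤ N} (hs : s ∈ ssRootsOf P) :
    ∃ v v', IsRootPair P s v v' ∧ rootCode P s = pairCode P v v' :=
  ⟨_, _, (exists_isRootPair hs).choose_spec.choose_spec, by rw [rootCode, dif_pos hs]⟩

lemma eq_classRep_of_not_mem {P : Set N} {s : Module.Dual ℤ N} {v v' : N}
    (h : IsRootPair P s v v') (hv : v ∉ nonReps P) : v = classRep P v' := by
  rw [← classRep_eq (Or.inr ⟨s, h⟩)]
  by_contra hne
  exact hv ⟨h.left_mem, Ne.symm hne⟩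

lemma mem_nonReps_or {P : Set N} {s : Module.Dual ℤ N} {v v' : N}
    (h : IsRootPair P s v v') : v ∈ nonReps P ∨ v' ∈ nonReps P := by
  by_contra! hcon
  have h1 := eq_classRep_of_not_mem h hcon.1
  have h2 := eq_classRep_of_not_mem h.neg hcon.2
  rw [classRep_eq (Or.inr ⟨s, h⟩)] at h2
  exact h.ne (h1.trans h2.symm)

open Classical in
/-- The set in which the codes of the semisimple roots lie. -/
noncomputable def codeSet {α : Type*} (T : Finset α) : Finset (α × Option α) := T ×ˢ Finset.insertNone T

lemma card_codeSet {α : Type*} (T : Finset α) : (codeSet T).card = T.card * (T.card + 1) := by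
  rw [codeSet, Finset.card_product, Finset.card_insertNone]

lemma rootCode_mem {P : Set N} {T : Finset N} (hT : ∀ v, v ∈ T ↔ v ∈ nonReps P)
    {s : Module.Dual ℤ N} (hs : s ∈ ssRootsOf P) : rootCode P s ∈ codeSet T := by
  obtain ⟨v, v', h, hc⟩ := rootCode_spec hs
  rw [hc, pairCode, codeSet]
  split_ifs with h1 h2
  · simp [hT, h1, h2]
  · simp [hT, h1]
  · have := (mem_nonReps_or h).resolve_right h1
    simp [hT, this]

/-- A semisimple root is determined by its pair of vectors, and the pair by its code. -/
lemma rootCode_injOn {P : Set N} (hP : PositivelySpans P) :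
    Set.InjOn (rootCode P) (ssRootsOf P) := by
  intro s hs s' hs' heq
  obtain ⟨v, v', h, hc⟩ := rootCode_spec hs
  obtain ⟨w, w', h', hc'⟩ := rootCode_spec hs'
  have key : v = w ∧ v' = w' := by
    rw [hc, hc', pairCode, pairCode] at heq
    by_cases h1 : v' ∈ nonReps P <;> by_cases h2 : w' ∈ nonReps P
    · rw [if_pos h1, if_pos h2, Prod.mk.injEq] at heq
      obtain ⟨h3, h4⟩ := heq
      subst h3
      refine ⟨?_, rfl⟩
      by_cases h5 : v ∈ nonReps P <;> by_cases h6 : w ∈ nonReps P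
      · simpa [h5, h6] using h4
      · simp [h5, h6] at h4
      · simp [h5, h6] at h4
      · rw [eq_classRep_of_not_mem h h5, eq_classRep_of_not_mem h' h6]
    · rw [if_pos h1, if_neg h2, Prod.mk.injEq] at heq
      obtain ⟨h3, h4⟩ := heq
      subst h3
      split_ifs at h4 with h5
      exact absurd (Option.some.inj h4) h.ne
    · rw [if_neg h1, if_pos h2, Prod.mk.injEq] at heq
      obtain ⟨h3, h4⟩ := heq
      subst h3
      split_ifs at h4 with h5
      exact absurd (Option.some.inj h4).symm h'.ne
    · rw [if_neg h1, if_neg h2, Prod.mk.injEq] at heq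
      obtain ⟨h3, -⟩ := heq
      subst h3
      refine ⟨rfl, ?_⟩
      rw [eq_classRep_of_not_mem h.neg h1, eq_classRep_of_not_mem h'.neg h2]
  obtain ⟨rfl, rfl⟩ := key
  refine hP.ext fun x hx => ?_
  by_cases h1 : x = v
  · rw [h1, h.left, h'.left]
  by_cases h2 : x = v'
  · rw [h2, h.right, h'.right]
  · rw [h.other x hx h1 h2, h'.other x hx h1 h2]

/-- The number of ordered pairs of distinct linked vectors is at most the number `t (t + 1)` that is
reached when there is a single class with `t + 1` members. -/
lemma encard_ssRootsOf_le {P : Set N} (hP : PositivelySpans P) {T : Finset N}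
    (hT : ∀ v, v ∈ T ↔ v ∈ nonReps P) :
    (ssRootsOf P).encard ≤ ((T.card * (T.card + 1) : ℕ) : ℕ∞) := by
  rw [← card_codeSet, ← Set.encard_coe_eq_coe_finsetCard]
  exact Set.encard_le_encard_of_injOn (fun s hs => rootCode_mem hT hs) (rootCode_injOn hP)

/-- If the bound on the number of semisimple roots is attained, then there is only one class. -/
lemma linked_of_encard_ssRootsOf_eq {P : Set N} (hP : PositivelySpans P) {T : Finset N}
    (hT : ∀ v, v ∈ T ↔ v ∈ nonReps P)
    (h : (ssRootsOf P).encard = ((T.card * (T.card + 1) : ℕ) : ℕ∞)) {v w : N} (hv : v ∈ T)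
    (hw : w ∈ T) : Linked P v w := by
  by_cases hne : v = w
  · exact Or.inl hne
  have himg : rootCode P '' ssRootsOf P = codeSet T := by
    have hsub : rootCode P '' ssRootsOf P ⊆ codeSet T := by
      rintro _ ⟨s, hs, rfl⟩
      exact rootCode_mem hT hs
    refine Set.Finite.eq_of_subset_of_encard_le ((Finset.finite_toSet _).subset hsub) hsub ?_
    rw [(rootCode_injOn hP).encard_image, h, Set.encard_coe_eq_coe_finsetCard, card_codeSet]
  obtain ⟨s, hs, hsw⟩ : (w, some v) ∈ rootCode P '' ssRootsOf P := by
    rw [himg]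
    simp [codeSet, hv, hw]
  obtain ⟨x, y, hxy, hc⟩ := rootCode_spec hs
  rw [hc, pairCode] at hsw
  split_ifs at hsw with h1 h2
  · obtain ⟨rfl, h3⟩ := Prod.mk.inj hsw
    obtain rfl := Option.some.inj h3
    exact Or.inr ⟨s, hxy⟩
  · exact absurd (Prod.mk.inj hsw).2 (by simp)
  · obtain ⟨rfl, h3⟩ := Prod.mk.inj hsw
    exact absurd (Option.some.inj h3).symm hne

lemma encard_image_classRep_le {P : Set N} {T : Finset N} (hT : ∀ v, v ∈ T ↔ v ∈ nonReps P) :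
    (classRep P '' nonReps P).encard ≤ T.card := by
  refine (Set.encard_image_le _ _).trans ?_
  rw [← Set.encard_coe_eq_coe_finsetCard]
  exact Set.encard_le_encard fun v hv => (hT v).2 hv

variable [Module.Free ℤ N] [Module.Finite ℤ N]

/-- If there are as many simple roots as the rank of the lattice, then they separate points. -/
lemma eq_zero_of_simpleRoot_eq_zero {P : Set N} {T : Finset N} (hT : ∀ v ∈ T, v ∈ nonReps P)
    (hcard : T.card = Module.finrank ℤ N) {n : N} (hn : ∀ v ∈ T, simpleRoot P v n = 0) :
    n = 0 := by
  classical
  by_contra hne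
  have hli : LinearIndependent ℤ (fun o : Option T => o.elim n (fun v => (v : N))) := by
    rw [Fintype.linearIndependent_iff]
    intro g hg
    rw [Fintype.sum_option] at hg
    have hv : ∀ v : T, g (some v) = 0 := fun v => by
      have h1 := congrArg (simpleRoot P v) hg
      simp only [Option.elim, map_add, map_smul, map_sum, hn v v.2, smul_zero, zero_add,
        map_zero] at h1
      rwa [Finset.sum_eq_single_of_mem v (Finset.mem_univ _) (fun w _ hw => by
        rw [simpleRoot_apply (hT v v.2) (hT w w.2) (fun h => hw (Subtype.ext h)), smul_zero]),
        (simpleRoot_spec (hT v v.2)).right, smul_eq_mul, mul_one] at h1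
    rintro (_ | v)
    · simp only [hv, zero_smul, Finset.sum_const_zero, add_zero, Option.elim] at hg
      obtain ⟨m, hm⟩ := exists_dual_ne_zero hne
      have h1 := congrArg m hg
      rw [map_smul, map_zero, smul_eq_mul] at h1
      exact (mul_eq_zero.1 h1).resolve_right hm
    · exact hv v
  have := hli.fintype_card_le_finrank
  rw [Fintype.card_option, Fintype.card_coe, hcard] at this
  omega

/-- The sum of a class of linked vectors, if there are as many simple roots as the rank. -/
lemma sum_class_eq_zero {P : Set N} {T : Finset N}
    (hT : ∀ v ∈ T, v ∈ nonReps P) (hcard : T.card = Module.finrank ℤ N) (v₀ : N) (C : Finset N)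
    (hC : ∀ v, v ∈ C ↔ v ∈ P ∧ Linked P v v₀) : ∑ v ∈ C, v = 0 := by
  classical
  refine eq_zero_of_simpleRoot_eq_zero hT hcard fun x hx => ?_
  have h := simpleRoot_spec (hT x hx)
  rw [map_sum]
  by_cases hxC : x ∈ C
  · have hyC : classRep P x ∈ C :=
      (hC _).2 ⟨h.left_mem, (linked_classRep P x).trans ((hC x).1 hxC).2⟩
    rw [← Finset.add_sum_erase _ _ hxC, ← Finset.add_sum_erase _ _
      (Finset.mem_erase.2 ⟨h.ne, hyC⟩), h.right, h.left, Finset.sum_eq_zero]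
    · norm_num
    · intro w hw
      simp only [Finset.mem_erase] at hw
      exact h.other w ((hC w).1 hw.2.2).1 hw.1 hw.2.1
  · refine Finset.sum_eq_zero fun w hw => h.other w ((hC w).1 hw).1 ?_ ?_
    · rintro rfl
      exact hxC ((hC _).2 ⟨h.right_mem, (linked_classRep P x).symm.trans ((hC _).1 hw).2⟩)
    · rintro rfl
      exact hxC hw

/-- If there are as many simple roots as the rank, then all roots are semisimple: a root `u` has sum
`0` over the class of the vector where it is `-1`, so its only other nonzero value on that class is
a `1`, and it coincides with a semisimple root. -/
lemma rootsOf_eq_ssRootsOf {P : Set N} (hP : PositivelySpans P) (hfin : P.Finite)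
    {T : Finset N} (hT : ∀ v ∈ T, v ∈ nonReps P) (hcard : T.card = Module.finrank ℤ N) :
    rootsOf P = ssRootsOf P := by
  classical
  refine Set.Subset.antisymm (fun u hu => ?_) (Set.sep_subset _ _)
  obtain ⟨v₀, hv₀, h1, h2⟩ := hu
  let C : Finset N := hfin.toFinset.filter fun v => Linked P v v₀
  have hC : ∀ v, v ∈ C ↔ v ∈ P ∧ Linked P v v₀ := fun v => by simp [C]
  have hsum := congrArg u (sum_class_eq_zero hT hcard v₀ C hC)
  have hv₀C : v₀ ∈ C := (hC _).2 ⟨hv₀, Or.inl rfl⟩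
  rw [map_sum, map_zero, ← Finset.add_sum_erase _ _ hv₀C, h1] at hsum
  obtain ⟨v', hv', hpos⟩ : ∃ v' ∈ C.erase v₀, 0 < u v' := by
    by_contra! hcon
    have := Finset.sum_nonpos hcon
    omega
  have hne := Finset.ne_of_mem_erase hv'
  have hv'C := Finset.mem_of_mem_erase hv'
  obtain ⟨s, hs⟩ := ((hC v').1 hv'C).2.symm.resolve_left (Ne.symm hne)
  have hle : ∀ w ∈ P, 0 ≤ (u - s) w := fun w hw => by
    rw [LinearMap.sub_apply]
    by_cases hw1 : w = v₀
    · rw [hw1, h1, hs.left]; norm_num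
    by_cases hw2 : w = v'
    · rw [hw2, hs.right]; omega
    · rw [hs.other w hw hw1 hw2]
      have := h2 w hw hw1
      omega
  rw [sub_eq_zero.1 (hP.eq_zero hle)]
  exact hs.mem_ssRootsOf

lemma finrank_linHull_add (A : Set (Module.Dual ℤ N)) :
    Module.finrank ℝ (linHull A) +
      Module.finrank ℝ ((ℝ ⊗[ℤ] Module.Dual ℤ N) ⧸ linHull A) = Module.finrank ℤ N := by
  rw [← finrank_real_dual, ← Submodule.finrank_quotient_add_finrank (linHull A), add_comm]

/-- Semisimple roots vanish at the vectors outside `η(S)`. -/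
lemma encard_eta_unipotent_diff_le {P : Set N} (hP : PositivelySpans P) :
    (etaOf P (rootsOf P \ ssRootsOf P) \ etaOf P (ssRootsOf P)).encard ≤
      (Module.finrank ℝ ((ℝ ⊗[ℤ] Module.Dual ℤ N) ⧸ linHull (ssRootsOf P)) : ℕ∞) := by
  refine encard_eta_unipotent_le hP _ _ Set.sdiff_subset fun s hs w hw => ?_
  obtain ⟨v, v', h⟩ := exists_isRootPair hs
  refine h.other w hw.1.1 ?_ ?_
  · rintro rfl
    exact hw.2 ⟨h.left_mem, s, hs, h.left⟩
  · rintro rfl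
    exact hw.2 ⟨h.right_mem, -s, h.neg.mem_ssRootsOf, h.neg.left⟩

lemma encard_eta_unipotent_le_rank {P : Set N} (hP : PositivelySpans P) :
    (etaOf P (rootsOf P \ ssRootsOf P)).encard ≤ (Module.finrank ℤ N : ℕ∞) := by
  refine (encard_eta_unipotent_le hP ∅ _ subset_rfl (by simp)).trans ?_
  have := finrank_linHull_add (∅ : Set (Module.Dual ℤ N))
  exact_mod_cast (by omega)

/-- The values of `η` are the members of `nonReps P`, the representatives of their classes, and the
values at unipotent roots only; the last two kinds are bounded by the number of classes and by the
codimension of the span of the semisimple roots. The term `T.card` on both sides avoids a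
subtraction. -/
lemma encard_eta_roots_le_aux {P : Set N} (hP : PositivelySpans P) {T : Finset N}
    (hT : ∀ v, v ∈ T ↔ v ∈ nonReps P) :
    (etaOf P (rootsOf P)).encard + T.card ≤
      (T.card + Module.finrank ℤ N : ℕ) + (classRep P '' nonReps P).encard := by
  have hTc : (nonReps P).encard = T.card := by
    rw [← Set.encard_coe_eq_coe_finsetCard]
    congr 1
    ext v
    exact (hT v).symm
  have h1 := card_nonReps_le T fun v hv => (hT v).1 hv
  have h2 := finrank_linHull_add (ssRootsOf P)
  calc (etaOf P (rootsOf P)).encard + T.card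
      ≤ ((nonReps P).encard + (classRep P '' nonReps P).encard +
        (Module.finrank ℝ ((ℝ ⊗[ℤ] Module.Dual ℤ N) ⧸ linHull (ssRootsOf P)) : ℕ∞)) + T.card := by
        gcongr
        exact (encard_etaOf_rootsOf_le P).trans
          (add_le_add (encard_etaOf_ssRootsOf_le P) (encard_eta_unipotent_diff_le hP))
    _ = ((T.card + (Module.finrank ℝ ((ℝ ⊗[ℤ] Module.Dual ℤ N) ⧸ linHull (ssRootsOf P)) +
          T.card) : ℕ) : ℕ∞) + (classRep P '' nonReps P).encard := by
        rw [hTc]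
        push_cast
        ring
    _ ≤ _ := by
        gcongr
        omega

lemma card_nonReps_le_rank {P : Set N} {T : Finset N} (hT : ∀ v ∈ T, v ∈ nonReps P) :
    T.card ≤ Module.finrank ℤ N := by
  have h1 := card_nonReps_le T hT
  have h2 := finrank_linHull_add (ssRootsOf P)
  omega

lemma encard_eta_roots_le {P : Set N} (hP : PositivelySpans P) {T : Finset N}
    (hT : ∀ v, v ∈ T ↔ v ∈ nonReps P) :
    (etaOf P (rootsOf P)).encard ≤ ((2 * Module.finrank ℤ N : ℕ) : ℕ∞) := by
  have h1 := encard_eta_roots_le_aux hP hT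
  have h2 : (etaOf P (rootsOf P)).encard + T.card ≤
      ((Module.finrank ℤ N + T.card : ℕ) : ℕ∞) + T.card := by
    refine h1.trans ?_
    rw [add_comm T.card]
    gcongr
    exact encard_image_classRep_le hT
  have h3 := (ENat.add_le_add_iff_right (ENat.natCast_ne_top _)).1 h2
  refine h3.trans ?_
  have := card_nonReps_le_rank fun v hv => (hT v).1 hv
  exact_mod_cast (by omega)

/-- If `η` takes `2d` values, then there are `d` classes, each consisting of two vectors. -/
lemma card_nonReps_of_encard_eta_eq {P : Set N} (hP : PositivelySpans P) {T : Finset N}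
    (hT : ∀ v, v ∈ T ↔ v ∈ nonReps P)
    (h : (etaOf P (rootsOf P)).encard = ((2 * Module.finrank ℤ N : ℕ) : ℕ∞)) :
    T.card = Module.finrank ℤ N ∧ Set.InjOn (classRep P) (nonReps P) := by
  have h1 := encard_eta_roots_le_aux hP hT
  have h2 := encard_image_classRep_le hT
  have hle := card_nonReps_le_rank fun v hv => (hT v).1 hv
  obtain ⟨k, hk⟩ := ENat.ne_top_iff_exists.1 (ne_top_of_le_ne_top (ENat.natCast_ne_top _) h2)
  rw [h, ← hk] at h1
  rw [← hk] at h2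
  have h1' : 2 * Module.finrank ℤ N + T.card ≤ T.card + Module.finrank ℤ N + k := by
    exact_mod_cast h1
  have h2' : k ≤ T.card := by exact_mod_cast h2
  refine ⟨by omega, ?_⟩
  have hTfin : (nonReps P).Finite := T.finite_toSet.subset fun v hv => (hT v).2 hv
  refine hTfin.injOn_of_encard_image_eq ?_
  have hTc : (nonReps P).encard = T.card := by
    rw [← Set.encard_coe_eq_coe_finsetCard]
    congr 1
    ext v
    exact (hT v).symm
  rw [← hk, hTc]
  exact_mod_cast (by omega)

/-- If there are `d² + d` semisimple roots, then there is one class, with `d + 1` members. -/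
lemma card_nonReps_of_encard_ssRootsOf_eq {P : Set N} (hP : PositivelySpans P) {T : Finset N}
    (hT : ∀ v, v ∈ T ↔ v ∈ nonReps P)
    (h : (ssRootsOf P).encard =
      ((Module.finrank ℤ N ^ 2 + Module.finrank ℤ N : ℕ) : ℕ∞)) :
    T.card = Module.finrank ℤ N ∧ ∀ v ∈ T, ∀ w ∈ T, classRep P v = classRep P w := by
  have hle := card_nonReps_le_rank fun v hv => (hT v).1 hv
  have h1 := encard_ssRootsOf_le hP hT
  rw [h] at h1
  have h1' : Module.finrank ℤ N ^ 2 + Module.finrank ℤ N ≤ T.card * (T.card + 1) := by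
    exact_mod_cast h1
  have h2 : T.card = Module.finrank ℤ N := by nlinarith
  refine ⟨h2, fun v hv w hw => classRep_eq (linked_of_encard_ssRootsOf_eq hP hT ?_ hv hw)⟩
  rw [h, h2]
  congr 1
  ring

/-- If there are as many simple roots as the rank `d`, and `2d` roots, then `η` takes `2d`
values. -/
lemma encard_eta_eq_of_encard_rootsOf_eq {P : Set N} (hP : PositivelySpans P) {T : Finset N}
    (hT : ∀ v, v ∈ T ↔ v ∈ nonReps P) (hcard : T.card = Module.finrank ℤ N)
    (h : (rootsOf P).encard = ((2 * Module.finrank ℤ N : ℕ) : ℕ∞)) :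
    (etaOf P (rootsOf P)).encard = ((2 * Module.finrank ℤ N : ℕ) : ℕ∞) := by
  classical
  refine le_antisymm (encard_eta_roots_le hP hT) ?_
  have hspec : ∀ v ∈ T, IsRootPair P (simpleRoot P v) (classRep P v) v :=
    fun v hv => simpleRoot_spec ((hT v).1 hv)
  -- the roots are the simple roots and their negatives
  have hne : ∀ v ∈ T, ∀ w ∈ T, simpleRoot P v ≠ -simpleRoot P w := by
    intro v hv w hw heq
    have h1 := (hspec v hv).right
    rw [heq, LinearMap.neg_apply] at h1
    by_cases hvw : v = w
    · rw [hvw, (hspec w hw).right] at h1; omega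
    · rw [simpleRoot_apply ((hT w).1 hw) ((hT v).1 hv) hvw] at h1; omega
  have hinj : Set.InjOn (simpleRoot P) T := by
    intro v hv w hw heq
    by_contra hvw
    have h1 := (hspec v hv).right
    rw [heq, simpleRoot_apply ((hT w).1 hw) ((hT v).1 hv) hvw] at h1
    omega
  let S' : Finset (Module.Dual ℤ N) :=
    T.image (simpleRoot P) ∪ T.image fun v => -simpleRoot P v
  have hS'card : S'.card = 2 * Module.finrank ℤ N := by
    rw [Finset.card_union_of_disjoint, Finset.card_image_of_injOn hinj,
      Finset.card_image_of_injOn, hcard, two_mul]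
    · intro v hv w hw heq
      exact hinj hv hw (neg_injective heq)
    · rw [Finset.disjoint_left]
      intro s hs hs'
      obtain ⟨v, hv, rfl⟩ := Finset.mem_image.1 hs
      obtain ⟨w, hw, heq⟩ := Finset.mem_image.1 hs'
      exact hne v hv w hw heq.symm
  have hS' : (S' : Set (Module.Dual ℤ N)) = rootsOf P := by
    refine Set.Finite.eq_of_subset_of_encard_le (Finset.finite_toSet _) ?_ ?_
    · intro s hs
      rcases Finset.mem_union.1 hs with hs | hs
      · obtain ⟨v, hv, rfl⟩ := Finset.mem_image.1 hs
        exact (hspec v hv).mem_rootsOf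
      · obtain ⟨v, hv, rfl⟩ := Finset.mem_image.1 hs
        exact (hspec v hv).neg.mem_rootsOf
    · rw [h, Set.encard_coe_eq_coe_finsetCard, hS'card]
  have hbinj : Set.InjOn (classRep P) T := by
    intro v hv w hw heq
    by_contra hvw
    obtain ⟨s, hs⟩ := (linked_of_classRep_eq heq).resolve_left hvw
    have hmem : s ∈ (S' : Set (Module.Dual ℤ N)) := hS' ▸ hs.mem_rootsOf
    rcases Finset.mem_union.1 hmem with hmem | hmem
    · obtain ⟨x, hx, rfl⟩ := Finset.mem_image.1 hmem
      have := (hspec x hx).left_unique hs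
      exact classRep_not_mem_nonReps P x (this ▸ (hT v).1 hv)
    · obtain ⟨x, hx, rfl⟩ := Finset.mem_image.1 hmem
      have := ((hspec x hx).neg.neg.left_unique hs.neg)
      exact classRep_not_mem_nonReps P x (this ▸ (hT w).1 hw)
  have hsub : ((T ∪ T.image (classRep P) : Finset N) : Set N) ⊆ etaOf P (rootsOf P) := by
    intro v hv
    rcases Finset.mem_union.1 hv with hv | hv
    · exact ⟨((hT v).1 hv).1, _, (hspec v hv).neg.mem_rootsOf, (hspec v hv).neg.left⟩
    · obtain ⟨w, hw, rfl⟩ := Finset.mem_image.1 hv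
      exact ⟨(hspec w hw).left_mem, _, (hspec w hw).mem_rootsOf, (hspec w hw).left⟩
  refine le_trans (le_of_eq ?_) (Set.encard_le_encard hsub)
  rw [Set.encard_coe_eq_coe_finsetCard, Finset.card_union_of_disjoint,
    Finset.card_image_of_injOn hbinj, hcard, two_mul]
  rw [Finset.disjoint_left]
  intro v hv hv'
  obtain ⟨w, -, rfl⟩ := Finset.mem_image.1 hv'
  exact classRep_not_mem_nonReps P w ((hT _).1 hv)

/-- If the differences of linked vectors span `Hom(M, ℂ)`, then there are as many simple roots as
the rank. -/
lemma card_nonReps_of_span {P : Set N} {T : Finset N} (hT : ∀ v, v ∈ T ↔ v ∈ nonReps P)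
    (ev : N →+ (Module.Dual ℤ N →ₗ[ℤ] ℂ))
    (hspan : Submodule.span ℂ {x | ∃ s v v', IsRootPair P s v v' ∧ x = ev v' - ev v} = ⊤) :
    T.card = Module.finrank ℤ N := by
  classical
  refine le_antisymm (card_nonReps_le_rank fun v hv => (hT v).1 hv) ?_
  have hgen : ∀ v, v ∈ P → ev v - ev (classRep P v) ∈ Submodule.span ℂ
      ((T.image fun v => ev v - ev (classRep P v) : Finset _) :
        Set (Module.Dual ℤ N →ₗ[ℤ] ℂ)) := fun v hv => by
    by_cases h : classRep P v = v
    · rw [h, sub_self]; exact Submodule.zero_mem _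
    · exact Submodule.subset_span (Finset.mem_image_of_mem _ ((hT v).2 ⟨hv, h⟩))
  have htop : Submodule.span ℂ ((T.image fun v => ev v - ev (classRep P v) : Finset _) :
      Set (Module.Dual ℤ N →ₗ[ℤ] ℂ)) = ⊤ := by
    rw [eq_top_iff, ← hspan]
    refine Submodule.span_le.2 ?_
    rintro _ ⟨s, v, v', h, rfl⟩
    have h1 := Submodule.sub_mem _ (hgen v' h.right_mem) (hgen v h.left_mem)
    rwa [classRep_eq (Or.inr ⟨s, h⟩), sub_sub_sub_cancel_right] at h1
  have h1 := finrank_span_finset_le_card (R := ℂ) (T.image fun v => ev v - ev (classRep P v))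
  rw [Set.finrank, htop, finrank_top] at h1
  have h2 : Module.finrank ℂ (Module.Dual ℤ N →ₗ[ℤ] ℂ) = Module.finrank ℤ N := by
    rw [Module.finrank_linearMap_self]
    exact (Module.finrank_linearMap ℤ ℤ N ℤ).trans (by rw [Module.finrank_self, mul_one])
  rw [h2] at h1
  exact h1.trans Finset.card_image_le

end Counting

/-! ### Frames of `ℙᵈ` and `(ℙ¹)ᵈ` -/

section Frames

variable {N : Type} [AddCommGroup N]

/-- The vectors `v 0, …, v d` are the ray generators of the fan of `ℙᵈ`: they have sum zero, and the
differences of the forms `u j` are the coordinates with respect to the `d`-subsets of the `v k`. -/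
structure SimplexFrame {d : ℕ} (v : Fin (d + 1) → N) (u : Fin (d + 1) → Module.Dual ℤ N) :
    Prop where
  sum_eq : ∑ k, v k = 0
  dual : ∀ j k, u j (v k) = (if j = k then 1 else 0) - (if k = 0 then 1 else 0)
  ext : ∀ m : Module.Dual ℤ N, (∀ k, m (v k) = 0) → m = 0

/-- The vectors `± e i` are the ray generators of the fan of `(ℙ¹)ᵈ`, with coordinates `f i`. -/
structure OrthantFrame {d : ℕ} (e : Fin d → N) (f : Fin d → Module.Dual ℤ N) : Prop where
  dual : ∀ i j, f i (e j) = if i = j then 1 else 0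
  ext : ∀ m : Module.Dual ℤ N, (∀ k, m (e k) = 0) → m = 0

/-- The `i`-th maximal cone of the fan of `ℙᵈ`. -/
def simplexCone {d : ℕ} (v : Fin (d + 1) → N) (i : Fin (d + 1)) : PointedCone ℝ (ℝ ⊗[ℤ] N) :=
  PointedCone.hull ℝ (toReal '' (v '' {k | k ≠ i}))

/-- The sign encoded by an element of `Fin 2`; the chart `0` of `ℙ¹` has the ray of `1`. -/
def chartSign (a : Fin 2) : ℤ := if a = 0 then 1 else -1

lemma chartSign_mul_self (a : Fin 2) : chartSign a * chartSign a = 1 := by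
  fin_cases a <;> simp [chartSign]

/-- The maximal cone of the fan of `(ℙ¹)ᵈ` with signs `ε`. -/
def orthantCone {d : ℕ} (e : Fin d → N) (ε : Fin d → Fin 2) : PointedCone ℝ (ℝ ⊗[ℤ] N) :=
  PointedCone.hull ℝ (toReal '' (Set.range fun i => chartSign (ε i) • e i))

lemma SimplexFrame.dual_sub {d : ℕ} {v : Fin (d + 1) → N} {u : Fin (d + 1) → Module.Dual ℤ N}
    (h : SimplexFrame v u) (i j k : Fin (d + 1)) :
    (u j - u i) (v k) = (if j = k then 1 else 0) - (if i = k then 1 else 0) := by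
  rw [LinearMap.sub_apply, h.dual, h.dual]
  ring

/-- The expansion of a form in the coordinates of the `i`-th cone of the fan of `ℙᵈ`. -/
lemma SimplexFrame.expand {d : ℕ} {v : Fin (d + 1) → N} {u : Fin (d + 1) → Module.Dual ℤ N}
    (h : SimplexFrame v u) (i : Fin (d + 1)) (m : Module.Dual ℤ N) :
    ∑ k, m (v k) • (u k - u i) = m := by
  refine sub_eq_zero.1 (h.ext _ fun l => ?_)
  have h0 : ∑ k, m (v k) = 0 := by rw [← map_sum, h.sum_eq, map_zero]
  rw [LinearMap.sub_apply, LinearMap.sum_apply]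
  simp only [LinearMap.smul_apply, h.dual_sub, smul_eq_mul, mul_sub, Finset.sum_sub_distrib]
  rw [← Finset.sum_mul, h0]
  simp

lemma OrthantFrame.expand {d : ℕ} {e : Fin d → N} {f : Fin d → Module.Dual ℤ N}
    (h : OrthantFrame e f) (m : Module.Dual ℤ N) : ∑ k, m (e k) • f k = m := by
  refine sub_eq_zero.1 (h.ext _ fun l => ?_)
  rw [LinearMap.sub_apply, LinearMap.sum_apply]
  simp [h.dual]

lemma mem_hull_image_iff {ι : Type*} [Fintype ι] (v : ι → N) (K : Set ι) (x : ℝ ⊗[ℤ] N) :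
    x ∈ PointedCone.hull ℝ (toReal '' (v '' K)) ↔
      ∃ a : ι → ℝ, (∀ k, 0 ≤ a k) ∧ (∀ k ∉ K, a k = 0) ∧ x = ∑ k, a k • toReal (v k) := by
  classical
  constructor
  · intro hx
    induction hx using Submodule.span_induction with
    | mem x hx =>
      obtain ⟨_, ⟨k, hk, rfl⟩, rfl⟩ := hx
      refine ⟨Pi.single k 1, fun l => ?_, fun l hl => ?_, ?_⟩
      · by_cases h : l = k
        · subst h; simp
        · simp [h]
      · exact Pi.single_eq_of_ne (by rintro rfl; exact hl hk) _
      · rw [Finset.sum_eq_single_of_mem k (Finset.mem_univ _)]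
        · simp
        · intro b _ hb
          simp [hb]
    | zero => exact ⟨0, by simp, by simp, by simp⟩
    | add x y _ _ hx hy =>
      obtain ⟨a, h1, h2, rfl⟩ := hx
      obtain ⟨b, h3, h4, rfl⟩ := hy
      refine ⟨a + b, fun k => add_nonneg (h1 k) (h3 k), fun k hk => ?_, ?_⟩
      · rw [Pi.add_apply, h2 k hk, h4 k hk, add_zero]
      · simp [add_smul, Finset.sum_add_distrib]
    | smul c x _ hx =>
      obtain ⟨a, h1, h2, rfl⟩ := hx
      refine ⟨fun k => (c : ℝ) * a k, fun k => mul_nonneg c.2 (h1 k), fun k hk => ?_, ?_⟩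
      · simp only [h2 k hk, mul_zero]
      · have hc : c • ∑ k, a k • toReal (v k) = (c : ℝ) • ∑ k, a k • toReal (v k) := rfl
        rw [hc, Finset.smul_sum]
        simp only [mul_smul]
  · rintro ⟨a, h1, h2, rfl⟩
    refine Submodule.sum_mem _ fun k _ => ?_
    by_cases hk : k ∈ K
    · exact smul_mem_cone (h1 k) (toReal_mem_hull ⟨k, hk, rfl⟩)
    · rw [h2 k hk, zero_smul]
      exact Submodule.zero_mem _

lemma SimplexFrame.pairing_sum {d : ℕ} {v : Fin (d + 1) → N} {u : Fin (d + 1) → Module.Dual ℤ N}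
    (h : SimplexFrame v u) (i j : Fin (d + 1)) (a : Fin (d + 1) → ℝ) :
    pairing (u j - u i) (∑ k, a k • toReal (v k)) = a j - a i := by
  rw [map_sum]
  simp only [map_smul, pairing_toReal, h.dual_sub, smul_eq_mul]
  push_cast
  simp [mul_sub, Finset.sum_sub_distrib]

variable [Module.Free ℤ N] [Module.Finite ℤ N]

/-- One class of `d + 1` linked vectors is a simplex frame. -/
lemma exists_simplexFrame {d : ℕ} {P : Set N} (hd : Module.finrank ℤ N = d)
    (hP : PositivelySpans P) (h0 : (0 : N) ∉ P) {T : Finset N} (hT : ∀ v ∈ T, v ∈ nonReps P)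
    (hcard : T.card = Module.finrank ℤ N)
    (hb : ∀ v ∈ T, ∀ w ∈ T, classRep P v = classRep P w) :
    ∃ v u, SimplexFrame (d := d) v u ∧ P ⊆ Set.range v := by
  classical
  obtain ⟨v₀, hv₀⟩ : ∃ v₀, ∀ t ∈ T, classRep P t = v₀ := by
    rcases T.eq_empty_or_nonempty with rfl | ⟨t, ht⟩
    · exact ⟨0, by simp⟩
    · exact ⟨classRep P t, fun s hs => hb s hs t ht⟩
  let en : Fin d ≃ T := (T.equivFinOfCardEq (hcard.trans hd)).symm
  let v : Fin (d + 1) → N := Fin.cons v₀ fun i => (en i : N)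
  let u : Fin (d + 1) → Module.Dual ℤ N := Fin.cons 0 fun i => simpleRoot P (en i)
  have hspec : ∀ i, IsRootPair P (simpleRoot P (en i)) v₀ (en i) := fun i => by
    rw [← hv₀ (en i) (en i).2]
    exact simpleRoot_spec (hT _ (en i).2)
  have hdual : ∀ j k, u j (v k) = (if j = k then 1 else 0) - (if k = 0 then 1 else 0) := by
    intro j k
    refine Fin.cases ?_ (fun j => ?_) j <;> refine Fin.cases ?_ (fun k => ?_) k
    · simp [u]
    · simp [u, (Fin.succ_ne_zero k).symm]
    · simp only [u, v, Fin.cons_succ, Fin.cons_zero]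
      rw [(hspec j).left]
      simp
    · simp only [u, v, Fin.cons_succ]
      by_cases h : j = k
      · rw [h, (hspec k).right]; simp
      · rw [simpleRoot_apply (hT _ (en j).2) (hT _ (en k).2)
          (fun h' => h (en.injective (Subtype.ext h')).symm)]
        simp [h]
  have hkill : ∀ n : N, (∀ i, simpleRoot P (en i) n = 0) → n = 0 := fun n hn =>
    eq_zero_of_simpleRoot_eq_zero hT hcard fun t ht => by simpa using hn (en.symm ⟨t, ht⟩)
  have hsub : P ⊆ Set.range v := by
    intro w hw
    by_contra hne
    refine h0 ((hkill w fun i => (hspec i).other w hw ?_ ?_) ▸ hw)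
    · rintro rfl; exact hne ⟨0, rfl⟩
    · rintro rfl; exact hne ⟨i.succ, by simp [v]⟩
  refine ⟨v, u, ⟨?_, hdual, fun m hm => hP.ext fun w hw => ?_⟩, hsub⟩
  · refine hkill _ fun i => ?_
    have : simpleRoot P (en i) = u i.succ := by simp [u]
    rw [this, map_sum]
    simp only [hdual]
    simp
  · obtain ⟨k, rfl⟩ := hsub hw
    rw [hm k, LinearMap.zero_apply]

/-- A system of `d` classes of two linked vectors each is an orthant frame. -/
lemma exists_orthantFrame {d : ℕ} {P : Set N} (hd : Module.finrank ℤ N = d)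
    (hP : PositivelySpans P) (h0 : (0 : N) ∉ P) {T : Finset N} (hT : ∀ v ∈ T, v ∈ nonReps P)
    (hcard : T.card = Module.finrank ℤ N) (hb : Set.InjOn (classRep P) (nonReps P)) :
    ∃ e f, OrthantFrame (d := d) e f ∧ ∀ w ∈ P, ∃ i, w = e i ∨ w = -e i := by
  classical
  let en : Fin d ≃ T := (T.equivFinOfCardEq (hcard.trans hd)).symm
  have hspec : ∀ i, IsRootPair P (simpleRoot P (en i)) (classRep P (en i)) (en i) := fun i =>
    simpleRoot_spec (hT _ (en i).2)
  have hdual : ∀ i j, simpleRoot P (en i) (en j) = if i = j then 1 else 0 := by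
    intro i j
    by_cases h : i = j
    · rw [h, (hspec j).right, if_pos rfl]
    · rw [simpleRoot_apply (hT _ (en i).2) (hT _ (en j).2)
        (fun h' => h (en.injective (Subtype.ext h')).symm), if_neg h]
  have hkill : ∀ n : N, (∀ i, simpleRoot P (en i) n = 0) → n = 0 := fun n hn =>
    eq_zero_of_simpleRoot_eq_zero hT hcard fun t ht => by simpa using hn (en.symm ⟨t, ht⟩)
  have hrep : ∀ i, classRep P (en i) = -(en i : N) := by
    intro i
    refine eq_neg_of_add_eq_zero_left (hkill _ fun j => ?_)
    rw [map_add, hdual]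
    by_cases h : j = i
    · rw [h, if_pos rfl, (hspec i).left]; norm_num
    · rw [if_neg h, add_zero]
      refine (hspec j).other _ (hspec i).left_mem (fun h' => h ?_) (fun h' => ?_)
      · exact (en.injective (Subtype.ext (hb (hT _ (en i).2) (hT _ (en j).2) h'))).symm
      · exact classRep_not_mem_nonReps P (en i) (h' ▸ hT _ (en j).2)
  have hsub : ∀ w ∈ P, ∃ i, w = (en i : N) ∨ w = -(en i : N) := by
    intro w hw
    by_contra! hne
    refine h0 ((hkill w fun i => (hspec i).other w hw ?_ (hne i).1) ▸ hw)
    rw [hrep]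
    exact (hne i).2
  refine ⟨fun i => en i, fun i => simpleRoot P (en i), ⟨hdual, fun m hm => hP.ext fun w hw => ?_⟩,
    hsub⟩
  obtain ⟨i, rfl | rfl⟩ := hsub w hw
  · rw [hm i, LinearMap.zero_apply]
  · rw [map_neg, hm i, neg_zero, LinearMap.zero_apply]

end Frames

section FanCones

variable {N : Type} [AddCommGroup N] [Module.Free ℤ N] {Δ : Fan N}

lemma zero_not_mem_rayGenerators : (0 : N) ∉ Δ.rayGenerators := fun h => by
  obtain ⟨w, hw⟩ := (Δ.rayGenerators_primitive h).2
  simp at hw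

/-- If the rays of a complete fan are those of the fan of `ℙᵈ`, then so are the cones. -/
lemma simplexCone_of_rays {d : ℕ} {v : Fin (d + 1) → N} {u : Fin (d + 1) → Module.Dual ℤ N}
    (h : SimplexFrame v u) (hΔ : Δ.IsComplete) (hP : Δ.rayGenerators ⊆ Set.range v) :
    (∀ i, simplexCone v i ∈ Δ.cones) ∧ ∀ σ ∈ Δ.cones, ∃ i, σ ≤ simplexCone v i := by
  classical
  have key : ∀ σ ∈ Δ.cones, ∃ K : Set (Fin (d + 1)),
      σ = PointedCone.hull ℝ (toReal '' (v '' K)) ∧ ∃ i, i ∉ K := by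
    intro σ hσ
    obtain ⟨t, ht, rfl⟩ := Δ.exists_cone_eq_hull hσ
    have htK : t = v '' {k | v k ∈ t} := by
      ext w
      constructor
      · intro hw
        obtain ⟨k, rfl⟩ := hP (ht hw)
        exact ⟨k, hw, rfl⟩
      · rintro ⟨k, hk, rfl⟩
        exact hk
    refine ⟨{k | v k ∈ t}, by rw [← htK], ?_⟩
    by_contra! hall
    have h1 : toReal (v 0) = 0 := by
      refine Δ.stronglyConvex _ hσ _ (toReal_mem_hull (hall 0)) ?_
      have h2 : v 0 + ∑ k ∈ Finset.univ.erase 0, v k = 0 := by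
        rw [Finset.add_sum_erase _ _ (Finset.mem_univ _), h.sum_eq]
      rw [← toReal_neg, neg_eq_of_add_eq_zero_right h2, toReal_sum]
      exact Submodule.sum_mem _ fun k _ => toReal_mem_hull (hall k)
    have h2 : v 0 = 0 := toReal_injective (h1.trans toReal_zero.symm)
    exact zero_not_mem_rayGenerators (h2 ▸ ht (hall 0))
  refine ⟨fun i => ?_, fun σ hσ => ?_⟩
  · obtain ⟨σ, hσ, hx⟩ := hΔ (∑ k, (if k = i then (0 : ℝ) else 1) • toReal (v k))
    obtain ⟨K, rfl, i₀, hi₀⟩ := key σ hσ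
    obtain ⟨a, ha0, haK, ha⟩ := (mem_hull_image_iff v K _).1 hx
    -- comparing coordinates with respect to the missing index `i₀` gives `i₀ = i`
    have hcoord : ∀ j, a j = (if j = i then (0 : ℝ) else 1) - (if i₀ = i then (0 : ℝ) else 1) := by
      intro j
      have h1 := h.pairing_sum i₀ j a
      rw [← ha, h.pairing_sum, haK i₀ hi₀, sub_zero] at h1
      exact h1.symm
    have hi : i₀ = i := by
      by_contra hne
      have h1 := hcoord i
      rw [if_pos rfl, if_neg hne] at h1
      have h2 := ha0 i
      linarith
    have hK : K = {k | k ≠ i} := by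
      ext k
      constructor
      · rintro hk rfl
        exact hi₀ (hi ▸ hk)
      · intro hk
        by_contra hkK
        have h1 := hcoord k
        rw [if_neg hk, if_pos hi, haK k hkK] at h1
        norm_num at h1
    rw [simplexCone, ← hK]
    exact hσ
  · obtain ⟨K, rfl, i₀, hi₀⟩ := key σ hσ
    refine ⟨i₀, Submodule.span_mono (Set.image_mono (Set.image_mono ?_))⟩
    rintro k hk rfl
    exact hi₀ hk

/-- If the rays of a complete fan are those of the fan of `(ℙ¹)ᵈ`, then so are the cones. -/
lemma orthantCone_of_rays {d : ℕ} {e : Fin d → N} {f : Fin d → Module.Dual ℤ N}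
    (h : OrthantFrame e f) (hΔ : Δ.IsComplete)
    (hP : ∀ w ∈ Δ.rayGenerators, ∃ i, w = e i ∨ w = -e i) :
    (∀ ε, orthantCone e ε ∈ Δ.cones) ∧ ∀ σ ∈ Δ.cones, ∃ ε, σ ≤ orthantCone e ε := by
  classical
  have hopp : ∀ t ⊆ Δ.rayGenerators, PointedCone.hull ℝ (toReal '' t) ∈ Δ.cones →
      ∀ w ∈ t, -w ∉ t := by
    intro t ht hσ w hw hw'
    have h1 := Δ.stronglyConvex _ hσ _ (toReal_mem_hull hw)
      (by rw [← toReal_neg]; exact toReal_mem_hull hw')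
    have h2 : w = 0 := toReal_injective (h1.trans toReal_zero.symm)
    exact zero_not_mem_rayGenerators (h2 ▸ ht hw)
  refine ⟨fun ε => ?_, fun σ hσ => ?_⟩
  · obtain ⟨σ, hσ, hx⟩ := hΔ (∑ k, toReal (chartSign (ε k) • e k))
    obtain ⟨t, ht, rfl⟩ := Δ.exists_cone_eq_hull hσ
    have hval : ∀ i j, (chartSign (ε i) • f i) (chartSign (ε j) • e j) = if i = j then 1 else 0 := by
      intro i j
      simp only [LinearMap.smul_apply, map_smul, h.dual, smul_eq_mul]
      split_ifs with hij
      · rw [hij, mul_one, chartSign_mul_self]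
      · simp
    have hsign : ∀ w ∈ t, ∃ i, w = chartSign (ε i) • e i ∨ w = -(chartSign (ε i) • e i) := by
      intro w hw
      obtain ⟨i, hi⟩ := hP w (ht hw)
      refine ⟨i, ?_⟩
      rw [chartSign]
      split_ifs
      · simpa using hi
      · simpa using hi.symm
    have hmem : ∀ i, chartSign (ε i) • e i ∈ t := by
      intro i
      by_contra hi
      have h1 : -(chartSign (ε i) • f i) ∈ dualMonoid (PointedCone.hull ℝ (toReal '' t)) := by
        refine mem_dualMonoid_hull.2 fun w hw => ?_
        obtain ⟨j, rfl | rfl⟩ := hsign w hw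
        · rw [LinearMap.neg_apply, hval, if_neg]
          · simp
          · rintro rfl; exact hi hw
        · rw [LinearMap.neg_apply, map_neg, hval]
          split_ifs <;> simp
      have h2 := h1 _ hx
      rw [← toReal_sum, pairing_toReal, LinearMap.neg_apply, map_sum] at h2
      simp only [hval] at h2
      simp at h2
      linarith
    have heq : t = Set.range fun i => chartSign (ε i) • e i := by
      refine Set.Subset.antisymm (fun w hw => ?_) ?_
      · obtain ⟨i, rfl | rfl⟩ := hsign w hw
        · exact ⟨i, rfl⟩
        · exact absurd hw (hopp t ht hσ _ (hmem i))
      · rintro _ ⟨i, rfl⟩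
        exact hmem i
    rw [orthantCone, ← heq]
    exact hσ
  · obtain ⟨t, ht, rfl⟩ := Δ.exists_cone_eq_hull hσ
    refine ⟨fun i => if -e i ∈ t then 1 else 0, Submodule.span_mono (Set.image_mono ?_)⟩
    intro w hw
    obtain ⟨i, rfl | rfl⟩ := hP w (ht hw)
    · exact ⟨i, by simp [hopp t ht hσ _ hw, chartSign]⟩
    · exact ⟨i, by simp [hw, chartSign]⟩

end FanCones

/-! ### The function field of the torus and its derivations -/

section CharField

variable {N : Type} [AddCommGroup N]

/-- The lattice `M` embeds into a power of `ℤ`, so its group algebra is a domain. -/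
instance dualTwoUniqueSums [Module.Free ℤ N] : TwoUniqueSums (Module.Dual ℤ N) :=
  TwoUniqueSums.of_injective_addHom
    (⟨fun m i => m (Module.Free.chooseBasis ℤ N i), fun _ _ => rfl⟩ :
      Module.Dual ℤ N →ₙ+ (Module.Free.ChooseBasisIndex ℤ N → ℤ))
    (fun _ _ h => (Module.Free.chooseBasis ℤ N).ext fun i => congrFun h i) inferInstance

instance torusRingIsDomain [Module.Free ℤ N] : IsDomain (AddMonoidAlgebra ℂ (Module.Dual ℤ N)) :=
  NoZeroDivisors.to_isDomain _

variable (N) in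
/-- The function field `ℂ(M)` of the torus. -/
abbrev CharField : Type := FractionRing (AddMonoidAlgebra ℂ (Module.Dual ℤ N))

/-- The inclusion `ℂ[M] → ℂ(M)`. -/
noncomputable def torusToField : AddMonoidAlgebra ℂ (Module.Dual ℤ N) →ₐ[ℂ] CharField N :=
  IsScalarTower.toAlgHom ℂ _ _

lemma torusToField_injective : Function.Injective (torusToField (N := N)) :=
  IsFractionRing.injective (AddMonoidAlgebra ℂ (Module.Dual ℤ N)) (CharField N)

/-- The inclusion `ℂ[S_σ] → ℂ[M]`. -/
noncomputable def coordToTorus (σ : PointedCone ℝ (ℝ ⊗[ℤ] N)) :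
    coordRing σ →ₐ[ℂ] AddMonoidAlgebra ℂ (Module.Dual ℤ N) :=
  AddMonoidAlgebra.mapDomainAlgHom ℂ ℂ (dualMonoid σ).subtype

lemma coordToTorus_single (σ : PointedCone ℝ (ℝ ⊗[ℤ] N)) (a : dualMonoid σ) (c : ℂ) :
    coordToTorus σ (AddMonoidAlgebra.single a c) = AddMonoidAlgebra.single a.1 c := by
  simp [coordToTorus]

lemma coordToTorus_injective (σ : PointedCone ℝ (ℝ ⊗[ℤ] N)) :
    Function.Injective (coordToTorus σ) :=
  AddMonoidAlgebra.mapDomain_injective Subtype.val_injective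

lemma coordToTorus_coordMap {τ σ : PointedCone ℝ (ℝ ⊗[ℤ] N)} (h : τ ≤ σ) (a : coordRing σ) :
    coordToTorus τ (coordMap h a) = coordToTorus σ a := by
  induction a using AddMonoidAlgebra.induction_linear with
  | zero => simp
  | add f g hf hg => rw [map_add, map_add, map_add, hf, hg]
  | single w c => rw [coordMap_single, coordToTorus_single, coordToTorus_single]; rfl

/-- Membership in the image of `ℂ[S_σ]` is a condition on the support. -/
lemma mem_range_coordToTorus {σ : PointedCone ℝ (ℝ ⊗[ℤ] N)}
    {a : AddMonoidAlgebra ℂ (Module.Dual ℤ N)} :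
    a ∈ (coordToTorus σ).range ↔ ∀ m, a.coeff m ≠ 0 → m ∈ dualMonoid σ := by
  classical
  constructor
  · rintro ⟨b, rfl⟩ m
    contrapose!
    intro hm
    refine Finsupp.mapDomain_of_notMem_range b.coeff m ?_
    rintro ⟨x, rfl⟩
    exact hm x.2
  · intro h
    rw [← AddMonoidAlgebra.sum_coeff_single a]
    refine sum_mem fun m hm => ?_
    exact ⟨AddMonoidAlgebra.single ⟨m, h m (Finsupp.mem_support_iff.1 hm)⟩ (a.coeff m),
      coordToTorus_single _ _ _⟩

lemma mem_dualMonoid_bot (m : Module.Dual ℤ N) :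
    m ∈ dualMonoid (⊥ : PointedCone ℝ (ℝ ⊗[ℤ] N)) := fun x hx => by
  rw [(Submodule.mem_bot _).1 hx, map_zero]

lemma coordToTorus_bot_surjective :
    Function.Surjective (coordToTorus (⊥ : PointedCone ℝ (ℝ ⊗[ℤ] N))) := fun _ =>
  mem_range_coordToTorus.2 fun m _ => mem_dualMonoid_bot m

/-- The inclusion `ℂ[S_σ] → ℂ(M)`. -/
noncomputable def chartToField (σ : PointedCone ℝ (ℝ ⊗[ℤ] N)) : coordRing σ →ₐ[ℂ] CharField N :=
  torusToField.comp (coordToTorus σ)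

lemma chartToField_injective (σ : PointedCone ℝ (ℝ ⊗[ℤ] N)) :
    Function.Injective (chartToField σ) :=
  torusToField_injective.comp (coordToTorus_injective σ)

instance coordRingIsDomain [Module.Free ℤ N] (σ : PointedCone ℝ (ℝ ⊗[ℤ] N)) : IsDomain (coordRing σ) :=
  (coordToTorus_injective σ).isDomain (coordToTorus σ)

lemma chartToField_comp_coordMap {τ σ : PointedCone ℝ (ℝ ⊗[ℤ] N)} (h : τ ≤ σ) :
    (chartToField τ).comp (coordMap h) = chartToField σ :=
  AlgHom.ext fun a => congrArg torusToField (coordToTorus_coordMap h a)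

lemma charField_algHom_ext {L : Type*} [Field L] [Algebra ℂ L] {θ θ' : CharField N →ₐ[ℂ] L}
    (h : θ.comp (chartToField ⊥) = θ'.comp (chartToField ⊥)) : θ = θ' := by
  refine IsLocalization.algHom_ext (nonZeroDivisors (AddMonoidAlgebra ℂ (Module.Dual ℤ N))) ?_
  refine AlgHom.ext fun a => ?_
  obtain ⟨b, rfl⟩ := coordToTorus_bot_surjective a
  exact DFunLike.congr_fun h b

variable [Module.Free ℤ N]

/-- An injective homomorphism from the coordinate ring of the torus to a field extends to the
function field. -/
lemma exists_lift_charField {L : Type*} [Field L] [Algebra ℂ L]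
    (β : coordRing (⊥ : PointedCone ℝ (ℝ ⊗[ℤ] N)) →ₐ[ℂ] L) (hβ : Function.Injective β) :
    ∃ θ : CharField N →ₐ[ℂ] L, θ.comp (chartToField ⊥) = β := by
  let E := AlgEquiv.ofBijective (coordToTorus (⊥ : PointedCone ℝ (ℝ ⊗[ℤ] N)))
    ⟨coordToTorus_injective _, coordToTorus_bot_surjective⟩
  have hinj : Function.Injective (β.comp E.symm.toAlgHom) := hβ.comp E.symm.injective
  refine ⟨IsFractionRing.liftAlgHom (K := CharField N) hinj, AlgHom.ext fun a => ?_⟩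
  have h1 : IsFractionRing.liftAlgHom (K := CharField N) hinj (algebraMap _ _ (E a)) =
      (β.comp E.symm.toAlgHom) (E a) := IsFractionRing.lift_algebraMap hinj _
  refine h1.trans ?_
  exact congrArg β (E.symm_apply_apply a)

end CharField

section ConjDerivation

variable {k K L : Type*} [CommRing k] [Field K] [Field L] [Algebra k K] [Algebra k L]

/-- Transport of derivations along an isomorphism. -/
noncomputable def conjDerivation (θ : K ≃ₐ[k] L) : Derivation k K K ≃ₗ[k] Derivation k L L where
  toFun D := Derivation.mk' (θ.toLinearMap ∘ₗ D.toLinearMap ∘ₗ θ.symm.toLinearMap) fun a b => by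
    simp
  invFun D := Derivation.mk' (θ.symm.toLinearMap ∘ₗ D.toLinearMap ∘ₗ θ.toLinearMap) fun a b => by
    simp
  map_add' D D' := Derivation.ext fun a => map_add θ (D (θ.symm a)) (D' (θ.symm a))
  map_smul' c D := Derivation.ext fun a => map_smul θ c (D (θ.symm a))
  left_inv D := Derivation.ext fun a => by
    change θ.symm (θ (D (θ.symm (θ a)))) = D a
    simp
  right_inv D := Derivation.ext fun a => by
    change θ (θ.symm (D (θ (θ.symm a)))) = D a
    simp

lemma conjDerivation_apply (θ : K ≃ₐ[k] L) (D : Derivation k K K) (a : L) :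
    conjDerivation θ D a = θ (D (θ.symm a)) := rfl

lemma conjDerivation_lie (θ : K ≃ₐ[k] L) (D D' : Derivation k K K) :
    conjDerivation θ ⁅D, D'⁆ = ⁅conjDerivation θ D, conjDerivation θ D'⁆ := by
  ext a
  simp [conjDerivation_apply, Derivation.commutator_apply]

end ConjDerivation

section StabDer

variable {N : Type} [AddCommGroup N] [Module.Free ℤ N]

/-- The Lie algebra of the derivations of `ℂ(M)` that preserve `ℂ[M]` and all the `ℂ[S_{σ i}]`. It
is the Lie algebra of global vector fields of a variety glued from the charts `U_{σ i}`. -/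
noncomputable def vectorFields {ι : Type*} (σ : ι → PointedCone ℝ (ℝ ⊗[ℤ] N)) :
    Submodule ℂ (Derivation ℂ (CharField N) (CharField N)) where
  carrier := {D | (∀ a ∈ (chartToField (N := N) ⊥).range, D a ∈ (chartToField (N := N) ⊥).range) ∧
    ∀ i, ∀ a ∈ (chartToField (σ i)).range, D a ∈ (chartToField (σ i)).range}
  zero_mem' := ⟨fun _ _ => Subalgebra.zero_mem _, fun _ _ _ => Subalgebra.zero_mem _⟩
  add_mem' h h' := ⟨fun a ha => Subalgebra.add_mem _ (h.1 a ha) (h'.1 a ha),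
    fun i a ha => Subalgebra.add_mem _ (h.2 i a ha) (h'.2 i a ha)⟩
  smul_mem' c _ h := ⟨fun a ha => Subalgebra.smul_mem _ (h.1 a ha) c,
    fun i a ha => Subalgebra.smul_mem _ (h.2 i a ha) c⟩

/-- The span of the brackets of elements of a subspace. -/
def bracketSpan {k L : Type*} [CommRing k] [LieRing L] [LieAlgebra k L] (V : Submodule k L) :
    Submodule k L := Submodule.span k {x | ∃ a ∈ V, ∃ b ∈ V, ⁅a, b⁆ = x}

end StabDer

/-! ### Isomorphisms transport vector fields -/

section Sections

variable {X : Scheme.{0}} {K : Type} [Field K] (j : Spec (CommRingCat.of K) ⟶ X)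

/-- The unique point of the spectrum of a field. -/
noncomputable def fieldPoint (K : Type) [Field K] : Spec (CommRingCat.of K) := (⊥ : PrimeSpectrum K)

lemma eq_fieldPoint (x : Spec (CommRingCat.of K)) : x = fieldPoint K :=
  Subsingleton.elim (α := PrimeSpectrum K) _ _

lemma top_le_preimage {U : X.Opens} (h : j (fieldPoint K) ∈ U) : ⊤ ≤ j ⁻¹ᵁ U := fun x _ => by
  rw [eq_fieldPoint x]
  exact h

/-- The value in `K` of a section of `X` over a neighbourhood of a `K`-valued point. -/
noncomputable def sectionToField {U : X.Opens} (h : j (fieldPoint K) ∈ U) : Γ(X, U) →+* K :=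
  (j.appLE U ⊤ (top_le_preimage j h) ≫ (Scheme.ΓSpecIso (CommRingCat.of K)).hom).hom

lemma sectionToField_res {U V : X.Opens} (hU : j (fieldPoint K) ∈ U) (hV : j (fieldPoint K) ∈ V)
    (i : V ⟶ U) (s : Γ(X, U)) :
    sectionToField j hV (X.presheaf.map i.op s) = sectionToField j hU s := by
  have := Scheme.Hom.map_appLE j (top_le_preimage j hV) i.op
  exact congrArg (fun f => (Scheme.ΓSpecIso (CommRingCat.of K)).hom.hom (f.hom s)) this

/-- The sections over the image of an affine chart, as elements of the coordinate ring. -/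
noncomputable def chartSections {A : CommRingCat.{0}} (g : Spec A ⟶ X) [IsOpenImmersion g] :
    Γ(X, g.opensRange) →+* A :=
  (g.appLE g.opensRange ⊤ (fun x _ => ⟨x, rfl⟩) ≫ (Scheme.ΓSpecIso A).hom).hom

lemma chartSections_bijective {A : CommRingCat.{0}} (g : Spec A ⟶ X) [IsOpenImmersion g] :
    Function.Bijective (chartSections g) := by
  have e₁ : ⊤ ≤ g ⁻¹ᵁ g.opensRange := fun x _ => ⟨x, rfl⟩
  have hiso : IsIso (g.appLE g.opensRange ⊤ e₁) := by
    have h1 : g ⁻¹ᵁ g.opensRange = ⊤ := top_le_iff.1 e₁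
    have h2 : IsIso (g.app g.opensRange) := Scheme.Hom.isIso_app g _ le_rfl
    have h3 : IsIso (homOfLE e₁) := ⟨homOfLE h1.le, rfl, rfl⟩
    rw [Scheme.Hom.appLE]
    infer_instance
  exact ConcreteCategory.bijective_of_isIso
    (g.appLE g.opensRange ⊤ e₁ ≫ (Scheme.ΓSpecIso A).hom)

lemma mem_basicOpen_iff {A : CommRingCat.{0}} (g : Spec A ⟶ X) [IsOpenImmersion g]
    (t : Γ(X, g.opensRange)) (x : Spec A) :
    g x ∈ X.basicOpen t ↔ x ∈ PrimeSpectrum.basicOpen (chartSections g t) := by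
  have h1 := basicOpen_eq_of_affine' (g.appLE g.opensRange ⊤ (fun x _ => ⟨x, rfl⟩) t)
  replace h1 := (Scheme.basicOpen_appLE g ⊤ g.opensRange (fun x _ => ⟨x, rfl⟩) t).symm.trans h1
  exact ⟨fun h => (SetLike.ext_iff.1 h1 x).1 ⟨trivial, h⟩,
    fun h => ((SetLike.ext_iff.1 h1 x).2 h).2⟩

/-- For an affine chart `g` through which `j` factors, the value of a section over the chart is its
image in `K` as an element of the coordinate ring. -/
lemma sectionToField_chart {A : CommRingCat.{0}} (g : Spec A ⟶ X) [IsOpenImmersion g]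
    (φ : A →+* K) (hφ : Spec.map (CommRingCat.ofHom φ) ≫ g = j)
    (h : j (fieldPoint K) ∈ g.opensRange) :
    sectionToField j h = φ.comp (chartSections g) := by
  subst hφ
  have e₁ : ⊤ ≤ g ⁻¹ᵁ g.opensRange := fun x _ => ⟨x, rfl⟩
  have h1 := Scheme.Hom.appLE_comp_appLE (Spec.map (CommRingCat.ofHom φ)) g g.opensRange ⊤ ⊤ e₁
    le_top
  have h3 : (Spec.map (CommRingCat.ofHom φ) ≫ g).appLE g.opensRange ⊤ (top_le_preimage _ h) ≫
      (Scheme.ΓSpecIso (CommRingCat.of K)).hom =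
      (g.appLE g.opensRange ⊤ e₁ ≫ (Scheme.ΓSpecIso A).hom) ≫ CommRingCat.ofHom φ := by
    rw [← h1, Category.assoc, Category.assoc, ← Scheme.ΓSpecIso_naturality,
      Scheme.Hom.appTop, Scheme.Hom.app_eq_appLE]
    rfl
  exact congrArg CommRingCat.Hom.hom h3

lemma range_sectionToField {A : CommRingCat.{0}} (g : Spec A ⟶ X) [IsOpenImmersion g]
    (φ : A →+* K) (hφ : Spec.map (CommRingCat.ofHom φ) ≫ g = j)
    (h : j (fieldPoint K) ∈ g.opensRange) :
    (sectionToField j h).range = φ.range := by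
  rw [sectionToField_chart j g φ hφ h]
  ext x
  constructor
  · rintro ⟨s, rfl⟩
    exact ⟨_, rfl⟩
  · rintro ⟨a, rfl⟩
    obtain ⟨s, hs⟩ := (chartSections_bijective g).2 a
    exact ⟨s, by rw [RingHom.comp_apply, hs]⟩

/-- Functions on two affine charts whose values in `K` are inverse to each other have no zeros on
the intersection of the charts. -/
lemma mem_basicOpen_of_mul_eq_one (hgen : ∀ x, j (fieldPoint K) ⤳ x) {A B : CommRingCat.{0}}
    (g : Spec A ⟶ X) [IsOpenImmersion g] (φ : A →+* K)
    (hφ : Spec.map (CommRingCat.ofHom φ) ≫ g = j) (hinj : Function.Injective φ)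
    (g' : Spec B ⟶ X) [IsOpenImmersion g'] (φ' : B →+* K)
    (hφ' : Spec.map (CommRingCat.ofHom φ') ≫ g' = j) {a : A} {b : B} (hab : φ a * φ' b = 1)
    {x : Spec A} {y : Spec B} (hxy : g x = g' y) : x ∈ PrimeSpectrum.basicOpen a := by
  have hmem : ∀ {A : CommRingCat.{0}} (g : Spec A ⟶ X) [IsOpenImmersion g] (φ : A →+* K),
      Spec.map (CommRingCat.ofHom φ) ≫ g = j → j (fieldPoint K) ∈ g.opensRange := by
    intro A g _ φ h
    exact ⟨Spec.map (CommRingCat.ofHom φ) (fieldPoint K), by rw [← h]; rfl⟩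
  have hU := isAffineOpen_opensRange g
  obtain ⟨f, f', hff, hxf⟩ := exists_basicOpen_le_affine_inter hU
    (isAffineOpen_opensRange g') (g x) ⟨⟨x, rfl⟩, ⟨y, hxy.symm⟩⟩
  have hjW : j (fieldPoint K) ∈ X.basicOpen f := (hgen _).mem_open (X.basicOpen f).2 hxf
  let iU : X.basicOpen f ⟶ g.opensRange := homOfLE (X.basicOpen_le f)
  let iV : X.basicOpen f ⟶ g'.opensRange := homOfLE (hff.le.trans (X.basicOpen_le f'))
  obtain ⟨s, hs⟩ := (chartSections_bijective g).2 a
  obtain ⟨t, ht⟩ := (chartSections_bijective g').2 b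
  let _ : Algebra Γ(X, g.opensRange) Γ(X, X.basicOpen f) := (X.presheaf.map iU.op).hom.toAlgebra
  have hloc : IsLocalization.Away f Γ(X, X.basicOpen f) :=
    hU.isLocalization_of_eq_basicOpen f iU rfl
  have hresU : ∀ r, sectionToField j hjW (algebraMap Γ(X, g.opensRange) Γ(X, X.basicOpen f) r) =
      φ (chartSections g r) := fun r =>
    (sectionToField_res j (hmem g φ hφ) hjW iU r).trans
      (DFunLike.congr_fun (sectionToField_chart j g φ hφ (hmem g φ hφ)) r)
  have hresV : sectionToField j hjW (X.presheaf.map iV.op t) = φ' b := by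
    rw [sectionToField_res j (hmem g' φ' hφ') hjW iV, sectionToField_chart j g' φ' hφ',
      RingHom.comp_apply, ht]
  have hWinj : Function.Injective (sectionToField j hjW) := by
    refine (injective_iff_map_eq_zero _).2 fun w hw => ?_
    obtain ⟨n, r, hr⟩ := IsLocalization.Away.surj f w
    have h1 := congrArg (sectionToField j hjW) hr
    rw [map_mul, hw, zero_mul, hresU] at h1
    have h2 : r = 0 := (chartSections_bijective g).1 (hinj (by rw [← h1, map_zero, map_zero]))
    rw [h2, map_zero] at hr
    exact ((IsLocalization.Away.algebraMap_isUnit (S := Γ(X, X.basicOpen f)) f).pow n).mul_left_eq_zero.1 hr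
  have hunit : IsUnit (X.presheaf.map iU.op s) := by
    refine IsUnit.of_mul_eq_one (X.presheaf.map iV.op t) (hWinj ?_)
    rw [map_mul, hresV, map_one]
    have h3 : sectionToField j hjW (X.presheaf.map iU.op s) = φ (chartSections g s) := hresU s
    rw [h3, hs, hab]
  rw [← hs, ← mem_basicOpen_iff]
  have h4 := X.basicOpen_of_isUnit hunit
  rw [Scheme.basicOpen_res] at h4
  exact (h4.ge hxf).2

/-- Locally at a point `x`, preservation of the sections over an affine open `U` by a derivation is
inherited by any other affine open `V`, up to a denominator that does not vanish at `x`. -/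
lemma exists_denominator {k : Type*} [CommRing k] [Algebra k K] (D : Derivation k K K)
    (hgen : ∀ x, j (fieldPoint K) ⤳ x) {U V : X.Opens} (hU : IsAffineOpen U) (hV : IsAffineOpen V)
    (hjU : j (fieldPoint K) ∈ U) (hjV : j (fieldPoint K) ∈ V)
    (hD : ∀ a ∈ (sectionToField j hjU).range, D a ∈ (sectionToField j hjU).range)
    (x : X) (hx : x ∈ U ⊓ V) (s : Γ(X, V)) :
    ∃ g : Γ(X, V), x ∈ X.basicOpen g ∧
      sectionToField j hjV g * D (sectionToField j hjV s) ∈ (sectionToField j hjV).range := by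
  obtain ⟨f, g, hfg, hxf⟩ := exists_basicOpen_le_affine_inter hU hV x hx
  have hjW : j (fieldPoint K) ∈ X.basicOpen f := (hgen x).mem_open (X.basicOpen f).2 hxf
  let iU : X.basicOpen f ⟶ U := homOfLE (X.basicOpen_le f)
  let iV : X.basicOpen f ⟶ V := homOfLE (hfg.le.trans (X.basicOpen_le g))
  let _ : Algebra Γ(X, U) Γ(X, X.basicOpen f) := (X.presheaf.map iU.op).hom.toAlgebra
  let _ : Algebra Γ(X, V) Γ(X, X.basicOpen f) := (X.presheaf.map iV.op).hom.toAlgebra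
  have hlocU : IsLocalization.Away f Γ(X, X.basicOpen f) :=
    hU.isLocalization_of_eq_basicOpen f iU rfl
  have hlocV : IsLocalization.Away g Γ(X, X.basicOpen f) :=
    hV.isLocalization_of_eq_basicOpen g iV hfg
  have hresU : ∀ t, sectionToField j hjW (algebraMap Γ(X, U) Γ(X, X.basicOpen f) t) =
      sectionToField j hjU t := fun t => sectionToField_res j hjU hjW iU t
  have hresV : ∀ t, sectionToField j hjW (algebraMap Γ(X, V) Γ(X, X.basicOpen f) t) =
      sectionToField j hjV t := fun t => sectionToField_res j hjV hjW iV t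
  set φ := sectionToField j hjU
  set ψ := sectionToField j hjV
  set ω := sectionToField j hjW
  have hf0 : φ f ≠ 0 := by
    rw [← hresU]
    exact ((IsLocalization.Away.algebraMap_isUnit (S := Γ(X, X.basicOpen f)) f).map ω).ne_zero
  -- `s` is a fraction of sections over `U`
  obtain ⟨n, t, hst⟩ := IsLocalization.Away.surj f (algebraMap Γ(X, V) Γ(X, X.basicOpen f) s)
  have hst' : ψ s * φ f ^ n = φ t := by
    have := congrArg ω hst
    rwa [map_mul, map_pow, hresU, hresU, hresV] at this
  obtain ⟨t', ht'⟩ := hD (φ t) ⟨t, rfl⟩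
  obtain ⟨r, hr⟩ := hD (φ f ^ n) ⟨f ^ n, map_pow _ _ _⟩
  have hDs : D (ψ s) * φ f ^ (2 * n) = φ (t' * f ^ n - t * r) := by
    have h1 := congrArg D hst'
    rw [D.leibniz, smul_eq_mul, smul_eq_mul, ← hr, ← ht'] at h1
    have h2 : φ (t' * f ^ n - t * r) = φ t' * φ f ^ n - φ t * φ r := by
      rw [map_sub, map_mul, map_mul, map_pow]
    rw [h2, ← h1, ← hst']
    ring
  -- hence `D s` is a section over `X.basicOpen f`, that is, a fraction of sections over `V`
  let w : Γ(X, X.basicOpen f) := algebraMap _ _ (t' * f ^ n - t * r) *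
    IsLocalization.Away.invSelf f ^ (2 * n)
  have hw : ω w = D (ψ s) := by
    have h1 : ω (algebraMap _ _ f) * ω (IsLocalization.Away.invSelf f) = 1 := by
      rw [← map_mul, IsLocalization.Away.mul_invSelf, map_one]
    rw [hresU] at h1
    rw [map_mul, map_pow, hresU, ← hDs, mul_assoc, ← mul_pow, h1, one_pow, mul_one]
  obtain ⟨k, b, hb⟩ := IsLocalization.Away.surj g w
  refine ⟨g ^ (k + 1), ?_, b * g, ?_⟩
  · rw [Scheme.basicOpen_pow _ _ (Nat.succ_pos k), ← hfg]
    exact hxf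
  · have h1 := congrArg ω hb
    rw [map_mul, map_pow, hresV, hresV, hw] at h1
    rw [map_mul, map_pow, ← h1]
    ring

/-- A derivation that preserves the coordinate rings of the charts of an affine cover preserves the
coordinate ring of every affine chart. -/
theorem derivation_preserves_chart {k : Type*} [CommRing k] [Algebra k K] (D : Derivation k K K)
    (hgen : ∀ x, j (fieldPoint K) ⤳ x) {ι : Type*} {A : ι → CommRingCat.{0}}
    (g : ∀ i, Spec (A i) ⟶ X) [∀ i, IsOpenImmersion (g i)] (φ : ∀ i, A i →+* K)
    (hφ : ∀ i, Spec.map (CommRingCat.ofHom (φ i)) ≫ g i = j) (hcov : ∀ x, ∃ i y, g i y = x)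
    {B : CommRingCat.{0}} (gB : Spec B ⟶ X) [IsOpenImmersion gB] (ψ : B →+* K)
    (hψ : Spec.map (CommRingCat.ofHom ψ) ≫ gB = j)
    (hD : ∀ i, ∀ a ∈ (φ i).range, D a ∈ (φ i).range) : ∀ b ∈ ψ.range, D b ∈ ψ.range := by
  have hmem : ∀ {A : CommRingCat.{0}} (g : Spec A ⟶ X) [IsOpenImmersion g] (φ : A →+* K),
      Spec.map (CommRingCat.ofHom φ) ≫ g = j → j (fieldPoint K) ∈ g.opensRange := by
    intro A g _ φ h
    exact ⟨Spec.map (CommRingCat.ofHom φ) (fieldPoint K), by rw [← h]; rfl⟩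
  have hjV := hmem gB ψ hψ
  rw [← range_sectionToField j gB ψ hψ hjV]
  rintro _ ⟨s, rfl⟩
  have hV : IsAffineOpen gB.opensRange := isAffineOpen_opensRange gB
  let I : Set Γ(X, gB.opensRange) := {b | sectionToField j hjV b * D (sectionToField j hjV s) ∈
    (sectionToField j hjV).range}
  have hspan : Ideal.span I = ⊤ := by
    rw [← hV.iSup_basicOpen_eq_self_iff]
    refine le_antisymm (iSup_le fun b => X.basicOpen_le _) fun x hx => ?_
    obtain ⟨i, y, rfl⟩ := hcov x
    obtain ⟨b, hb, hbI⟩ := exists_denominator j D hgen (isAffineOpen_opensRange (g i)) hV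
      (hmem (g i) (φ i) (hφ i)) hjV
      (by rw [range_sectionToField j (g i) (φ i) (hφ i)]; exact hD i) (g i y) ⟨⟨y, rfl⟩, hx⟩ s
    exact TopologicalSpace.Opens.mem_iSup.2 ⟨⟨b, hbI⟩, hb⟩
  have hI : ∀ b, b ∈ I ↔ sectionToField j hjV b * D (sectionToField j hjV s) ∈
    (sectionToField j hjV).range := fun _ => Iff.rfl
  have hall : ∀ b ∈ Ideal.span I, b ∈ I := by
    intro b hb
    induction hb using Submodule.span_induction with
    | mem b hb => exact hb
    | zero => exact ⟨0, by simp⟩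
    | add b c _ _ hb hc =>
      rw [hI] at hb hc ⊢
      rw [map_add, add_mul]
      exact add_mem hb hc
    | smul a b _ hb =>
      rw [hI] at hb ⊢
      rw [smul_eq_mul, map_mul, mul_assoc]
      exact mul_mem ⟨a, rfl⟩ hb
  have h1 := (hI 1).1 (hall 1 (hspan ▸ Submodule.mem_top))
  rwa [map_one, one_mul] at h1

end Sections

section Atlas

/-- An atlas of a scheme `Y` over `ℂ` by affine toric charts `U_{σ i}` that share their torus
`U_0 = Spec ℂ[M]`. The lattice and the cones are not determined by `Y`. -/
structure ToricAtlas (Y : Over (Spec (CommRingCat.of ℂ))) {N : Type} [AddCommGroup N]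
    {ι : Type} (σ : ι → PointedCone ℝ (ℝ ⊗[ℤ] N)) where
  torus : affineChart (⊥ : PointedCone ℝ (ℝ ⊗[ℤ] N)) ⟶ Y.left
  chart : ∀ i, affineChart (σ i) ⟶ Y.left
  isOpenImmersion_torus : IsOpenImmersion torus
  isOpenImmersion_chart : ∀ i, IsOpenImmersion (chart i)
  torus_over : torus ≫ Y.hom = affineChartStr ⊥
  fac : ∀ i, affineChartMap (bot_le : ⊥ ≤ σ i) ≫ chart i = torus
  covers : ∀ y, ∃ i x, chart i x = y

namespace ToricAtlas

variable {Y : Over (Spec (CommRingCat.of ℂ))} {N : Type} [AddCommGroup N]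
  {ι : Type} {σ : ι → PointedCone ℝ (ℝ ⊗[ℤ] N)} (𝒜 : ToricAtlas Y σ)

/-- The generic point of a scheme with a toric atlas, as a morphism from the spectrum of the
function field. -/
noncomputable def generic : Spec (CommRingCat.of (CharField N)) ⟶ Y.left :=
  Spec.map (CommRingCat.ofHom (chartToField (N := N) ⊥).toRingHom) ≫ 𝒜.torus

lemma chart_generic (i : ι) :
    Spec.map (CommRingCat.ofHom (chartToField (σ i)).toRingHom) ≫ 𝒜.chart i = 𝒜.generic := by
  rw [generic, ← 𝒜.fac i, affineChartMap, ← Category.assoc, ← Spec.map_comp,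
    ← CommRingCat.ofHom_comp, ← chartToField_comp_coordMap (bot_le : ⊥ ≤ σ i)]
  rfl

lemma generic_over : 𝒜.generic ≫ Y.hom =
    Spec.map (CommRingCat.ofHom (algebraMap ℂ (CharField N))) := by
  rw [generic, Category.assoc, 𝒜.torus_over, affineChartStr, ← Spec.map_comp,
    ← CommRingCat.ofHom_comp]
  congr 2
  exact (chartToField (N := N) ⊥).comp_algebraMap

variable [Module.Free ℤ N]

/-- The generic point of the torus is the generic point of the scheme. -/
lemma generic_specializes (y : Y.left) : 𝒜.generic (fieldPoint _) ⤳ y := by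
  obtain ⟨i, x, rfl⟩ := 𝒜.covers y
  rw [← 𝒜.chart_generic i]
  have h : Spec.map (CommRingCat.ofHom (chartToField (σ i)).toRingHom) (fieldPoint _) ⤳ x := by
    refine (PrimeSpectrum.le_iff_specializes _ _).1 fun a ha => ?_
    have h0 : chartToField (σ i) a = 0 := ha
    rw [(map_eq_zero_iff _ (chartToField_injective (σ i))).1 h0]
    exact Ideal.zero_mem _
  exact h.map (𝒜.chart i).continuous

variable {Y' : Over (Spec (CommRingCat.of ℂ))} {N' : Type} [AddCommGroup N'] [Module.Free ℤ N']
  {ι' : Type} {σ' : ι' → PointedCone ℝ (ℝ ⊗[ℤ] N')} (𝒜' : ToricAtlas Y' σ')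

/-- An isomorphism matches the generic points, hence induces a map of the function fields. -/
lemma exists_charField_hom (e : Y ≅ Y') : ∃ θ : CharField N' →ₐ[ℂ] CharField N,
    Spec.map (CommRingCat.ofHom θ.toRingHom) ≫ 𝒜'.generic = 𝒜.generic ≫ e.hom.left := by
  have _ := 𝒜'.isOpenImmersion_torus
  have hpt : (𝒜.generic ≫ e.hom.left) (fieldPoint _) = 𝒜'.generic (fieldPoint _) := by
    refine (Specializes.antisymm ?_ (𝒜'.generic_specializes _)).eq
    have h1 := (𝒜.generic_specializes (e.inv.left (𝒜'.generic (fieldPoint _)))).map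
      e.hom.left.continuous
    have h2 : e.hom.left (e.inv.left (𝒜'.generic (fieldPoint _))) =
        𝒜'.generic (fieldPoint _) := by
      have : e.inv.left ≫ e.hom.left = 𝟙 _ := by rw [← Over.comp_left, e.inv_hom_id]; rfl
      rw [← Scheme.Hom.comp_apply, this]
      rfl
    rw [h2] at h1
    exact h1
  have hrange : Set.range (𝒜.generic ≫ e.hom.left) ⊆ Set.range 𝒜'.torus := by
    rintro _ ⟨x, rfl⟩
    rw [eq_fieldPoint x, hpt]
    exact ⟨_, rfl⟩
  let l := IsOpenImmersion.lift 𝒜'.torus (𝒜.generic ≫ e.hom.left) hrange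
  have hl : l ≫ 𝒜'.torus = 𝒜.generic ≫ e.hom.left := IsOpenImmersion.lift_fac _ _ _
  obtain ⟨b, hb⟩ : ∃ b : CommRingCat.of (coordRing (⊥ : PointedCone ℝ (ℝ ⊗[ℤ] N'))) ⟶
    CommRingCat.of (CharField N), Spec.map b = l := ⟨Spec.preimage l, Spec.map_preimage l⟩
  have halg : CommRingCat.ofHom (algebraMap ℂ (coordRing (⊥ : PointedCone ℝ (ℝ ⊗[ℤ] N')))) ≫ b =
      CommRingCat.ofHom (algebraMap ℂ (CharField N)) := by
    refine Spec.map_injective ?_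
    rw [Spec.map_comp, hb, ← 𝒜.generic_over, ← Over.w e.hom, ← Category.assoc, ← hl,
      Category.assoc, 𝒜'.torus_over]
    rfl
  let β : coordRing (⊥ : PointedCone ℝ (ℝ ⊗[ℤ] N')) →ₐ[ℂ] CharField N :=
    { b.hom with commutes' := fun c => congrArg (fun f => f.hom c) halg }
  have hβ : Function.Injective β := by
    refine (injective_iff_map_eq_zero β).2 fun a ha => ?_
    have h1 : l (fieldPoint _) =
        Spec.map (CommRingCat.ofHom (chartToField (N := N') ⊥).toRingHom) (fieldPoint _) := by
      apply 𝒜'.torus.isOpenEmbedding.injective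
      rw [← Scheme.Hom.comp_apply, hl, hpt]
      rfl
    rw [← hb] at h1
    have h2 : a ∈ (Spec.map b (fieldPoint _)).asIdeal := ha
    rw [h1] at h2
    have h3 : chartToField (N := N') ⊥ a = 0 := h2
    exact (map_eq_zero_iff _ (chartToField_injective _)).1 h3
  obtain ⟨θ, hθ⟩ := exists_lift_charField β hβ
  refine ⟨θ, ?_⟩
  rw [generic, ← Category.assoc, ← Spec.map_comp, ← CommRingCat.ofHom_comp, ← hl]
  congr 1
  rw [← hb]
  congr 1
  have : θ.toRingHom.comp (chartToField (N := N') ⊥).toRingHom = β.toRingHom :=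
    congrArg AlgHom.toRingHom hθ
  rw [this]
  rfl

lemma charField_hom_unique {θ : CharField N →ₐ[ℂ] CharField N}
    (h : Spec.map (CommRingCat.ofHom θ.toRingHom) ≫ 𝒜.generic = 𝒜.generic) :
    θ = AlgHom.id ℂ _ := by
  have _ := 𝒜.isOpenImmersion_torus
  refine charField_algHom_ext (AlgHom.ext fun a => ?_)
  rw [generic, ← Category.assoc, cancel_mono, ← Spec.map_comp, ← CommRingCat.ofHom_comp] at h
  have h1 := Spec.map_injective h
  exact congrArg (fun f => f.hom a) h1

lemma exists_charField_equiv (e : Y ≅ Y') : ∃ θ : CharField N' ≃ₐ[ℂ] CharField N,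
    Spec.map (CommRingCat.ofHom θ.toAlgHom.toRingHom) ≫ 𝒜'.generic = 𝒜.generic ≫ e.hom.left := by
  obtain ⟨θ, hθ⟩ := exists_charField_hom 𝒜 𝒜' e
  obtain ⟨θ', hθ'⟩ := exists_charField_hom 𝒜' 𝒜 e.symm
  have he : e.hom.left ≫ e.inv.left = 𝟙 _ := by rw [← Over.comp_left, e.hom_inv_id]; rfl
  have he' : e.inv.left ≫ e.hom.left = 𝟙 _ := by rw [← Over.comp_left, e.inv_hom_id]; rfl
  have h1 : θ.comp θ' = AlgHom.id ℂ _ := by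
    refine charField_hom_unique 𝒜 ?_
    have : CommRingCat.ofHom (θ.comp θ').toRingHom =
      CommRingCat.ofHom θ'.toRingHom ≫ CommRingCat.ofHom θ.toRingHom := rfl
    rw [this, Spec.map_comp, Category.assoc, hθ', ← Category.assoc, hθ, Category.assoc]
    exact (congrArg (𝒜.generic ≫ ·) he).trans (Category.comp_id _)
  have h2 : θ'.comp θ = AlgHom.id ℂ _ := by
    refine charField_hom_unique 𝒜' ?_
    have : CommRingCat.ofHom (θ'.comp θ).toRingHom =
      CommRingCat.ofHom θ.toRingHom ≫ CommRingCat.ofHom θ'.toRingHom := rfl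
    rw [this, Spec.map_comp, Category.assoc, hθ, ← Category.assoc, hθ', Category.assoc]
    exact (congrArg (𝒜'.generic ≫ ·) he').trans (Category.comp_id _)
  exact ⟨AlgEquiv.ofAlgHom θ θ' h1 h2, hθ⟩

/-- Vector fields are transported by isomorphisms. -/
lemma conjDerivation_mem (e : Y ≅ Y') (θ : CharField N' ≃ₐ[ℂ] CharField N)
    (hθ : Spec.map (CommRingCat.ofHom θ.toAlgHom.toRingHom) ≫ 𝒜'.generic =
      𝒜.generic ≫ e.hom.left)
    {D : Derivation ℂ (CharField N) (CharField N)} (hD : D ∈ vectorFields σ) :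
    conjDerivation θ.symm D ∈ vectorFields σ' := by
  have _ := 𝒜'.isOpenImmersion_torus
  have _ := 𝒜'.isOpenImmersion_chart
  have _ := 𝒜.isOpenImmersion_chart
  have _ : IsIso e.inv.left := inferInstanceAs (IsIso ((Over.forget _).map e.inv))
  have he : e.hom.left ≫ e.inv.left = 𝟙 _ := by rw [← Over.comp_left, e.hom_inv_id]; rfl
  have key : ∀ (τ : PointedCone ℝ (ℝ ⊗[ℤ] N')) (g : affineChart τ ⟶ Y'.left) [IsOpenImmersion g],
      Spec.map (CommRingCat.ofHom (chartToField τ).toRingHom) ≫ g = 𝒜'.generic →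
      ∀ a ∈ (chartToField τ).range, conjDerivation θ.symm D a ∈ (chartToField τ).range := by
    intro τ g _ hg
    have h1 := derivation_preserves_chart 𝒜.generic D 𝒜.generic_specializes 𝒜.chart
      (fun i => (chartToField (σ i)).toRingHom) 𝒜.chart_generic 𝒜.covers (g ≫ e.inv.left)
      (θ.toAlgHom.toRingHom.comp (chartToField τ).toRingHom) (by
        rw [CommRingCat.ofHom_comp, Spec.map_comp, Category.assoc, ← Category.assoc _ g, hg,
          ← Category.assoc, hθ, Category.assoc]
        exact (congrArg (𝒜.generic ≫ ·) he).trans (Category.comp_id _))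
      (fun i a ha => hD.2 i a ha)
    rintro _ ⟨a, rfl⟩
    obtain ⟨b, hb⟩ := h1 (θ (chartToField τ a)) ⟨a, rfl⟩
    refine ⟨b, ?_⟩
    have h2 : θ (chartToField τ b) = D (θ (chartToField τ a)) := hb
    have h3 : conjDerivation θ.symm D (chartToField τ a) =
      θ.symm (D (θ (chartToField τ a))) := rfl
    change chartToField τ b = conjDerivation θ.symm D (chartToField τ a)
    rw [h3, ← h2, θ.symm_apply_apply]
  exact ⟨key ⊥ 𝒜'.torus rfl, fun i => key (σ' i) (𝒜'.chart i) (𝒜'.chart_generic i)⟩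

/-- Isomorphic schemes with toric atlases have isomorphic Lie algebras of vector fields. -/
theorem exists_vectorFields_equiv (𝒜 : ToricAtlas Y σ) (𝒜' : ToricAtlas Y' σ') (e : Y ≅ Y') :
    ∃ Θ : Derivation ℂ (CharField N) (CharField N) ≃ₗ[ℂ]
        Derivation ℂ (CharField N') (CharField N'),
      (∀ D D', Θ ⁅D, D'⁆ = ⁅Θ D, Θ D'⁆) ∧
      (vectorFields σ).map Θ.toLinearMap = vectorFields σ' := by
  obtain ⟨θ, hθ⟩ := exists_charField_equiv 𝒜 𝒜' e
  refine ⟨conjDerivation θ.symm, conjDerivation_lie _, le_antisymm ?_ fun D hD => ?_⟩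
  · rintro _ ⟨D, hD, rfl⟩
    exact conjDerivation_mem 𝒜 𝒜' e θ hθ hD
  · have he : e.hom.left ≫ e.inv.left = 𝟙 _ := by rw [← Over.comp_left, e.hom_inv_id]; rfl
    refine ⟨conjDerivation θ D, conjDerivation_mem 𝒜' 𝒜 e.symm θ.symm ?_ hD, ?_⟩
    · have h1 : 𝒜'.generic ≫ e.inv.left =
          (Spec.map (CommRingCat.ofHom θ.symm.toAlgHom.toRingHom) ≫
            Spec.map (CommRingCat.ofHom θ.toAlgHom.toRingHom) ≫ 𝒜'.generic) ≫ e.inv.left := by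
        rw [← Category.assoc (Spec.map _) (Spec.map _), ← Spec.map_comp, ← CommRingCat.ofHom_comp]
        have h2 : θ.symm.toAlgHom.toRingHom.comp θ.toAlgHom.toRingHom = RingHom.id _ :=
          RingHom.ext fun a => θ.symm_apply_apply a
        rw [h2]
        have h3 : Spec.map (CommRingCat.ofHom (RingHom.id (CharField N'))) = 𝟙 _ := Spec.map_id _
        rw [h3, Category.id_comp]
      change _ = 𝒜'.generic ≫ e.inv.left
      rw [h1, hθ, Category.assoc, Category.assoc]
      refine congrArg (Spec.map _ ≫ ·) ?_
      exact ((congrArg (𝒜.generic ≫ ·) he).trans (Category.comp_id _)).symm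
    · exact (conjDerivation θ.symm).apply_symm_apply D

end ToricAtlas

end Atlas

/-! ### Homogeneous vector fields -/

section Extension

variable {k A K : Type*} [CommRing k] [CommRing A] [IsDomain A] [Field K] [Algebra k A] [Algebra k K]
  [Algebra A K] [IsScalarTower k A K] [IsFractionRing A K]

/-- A derivation of a domain into its fraction field, given as a homomorphism to the dual numbers,
extends to the fraction field. -/
lemma exists_derivation_fractionRing (F : A →ₐ[k] TrivSqZeroExt K K)
    (hfst : ∀ a, (F a).fst = algebraMap A K a) :
    ∃ D : Derivation k K K, ∀ a, D (algebraMap A K a) = (F a).snd := by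
  have hunit : ∀ y : nonZeroDivisors A, IsUnit (F.toRingHom y) := fun y => by
    refine TrivSqZeroExt.isUnit_iff_isUnit_fst.2 (IsUnit.mk0 _ ?_)
    intro h0
    have h0' : algebraMap A K y.1 = 0 := (hfst y.1).symm.trans h0
    exact nonZeroDivisors.ne_zero y.2
      (IsFractionRing.injective A K (h0'.trans (map_zero _).symm))
  let θ : K →+* TrivSqZeroExt K K := IsLocalization.lift hunit
  have hθ : ∀ a, θ (algebraMap A K a) = F a := fun a => IsLocalization.lift_eq hunit a
  have hθfst : ∀ x, (θ x).fst = x := fun x => by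
    have : (TrivSqZeroExt.fstHom k K K).toRingHom.comp θ = RingHom.id _ := by
      refine IsLocalization.ringHom_ext (nonZeroDivisors A) (RingHom.ext fun a => ?_)
      change (θ (algebraMap A K a)).fst = algebraMap A K a
      rw [hθ, hfst]
    exact DFunLike.congr_fun this x
  have hθC : ∀ c : k, θ (algebraMap k K c) = algebraMap k _ c := fun c => by
    rw [IsScalarTower.algebraMap_apply k A K, hθ, F.commutes]
  refine ⟨Derivation.mk'
    { toFun := fun x => (θ x).snd
      map_add' := fun x y => by rw [map_add, TrivSqZeroExt.snd_add]
      map_smul' := fun c x => by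
        rw [Algebra.smul_def, map_mul, hθC, ← Algebra.smul_def, TrivSqZeroExt.snd_smul]
        rfl } (fun x y => ?_), fun a => ?_⟩
  · change (θ (x * y)).snd = x • (θ y).snd + y • (θ x).snd
    rw [map_mul, TrivSqZeroExt.snd_mul, hθfst, hθfst, op_smul_eq_smul]
  · change (θ (algebraMap A K a)).snd = _
    rw [hθ]

end Extension

section EulerFields

variable {N : Type} [AddCommGroup N]

/-- The character `χ^w` as an element of the function field `ℂ(M)`. -/
noncomputable def chi (w : Module.Dual ℤ N) : CharField N :=
  torusToField (AddMonoidAlgebra.single w 1)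

lemma chi_add (w w' : Module.Dual ℤ N) : chi (w + w') = chi w * chi w' := by
  rw [chi, chi, chi, ← map_mul, AddMonoidAlgebra.single_mul_single, one_mul]

lemma chi_zero : chi (0 : Module.Dual ℤ N) = 1 := by
  rw [chi, ← AddMonoidAlgebra.one_def, map_one]

lemma torusToField_single (w : Module.Dual ℤ N) (c : ℂ) :
    torusToField (AddMonoidAlgebra.single w c) = c • chi w := by
  rw [chi, ← map_smul, AddMonoidAlgebra.smul_single, smul_eq_mul, mul_one]

lemma chi_ne_zero (w : Module.Dual ℤ N) : chi w ≠ 0 := by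
  intro h
  have := chi_add w (-w)
  rw [h, zero_mul, add_neg_cancel, chi_zero] at this
  exact one_ne_zero this

variable [Module.Free ℤ N]

/-- A derivation of `ℂ(M)` is determined by its values on characters. -/
lemma charField_derivation_ext {D D' : Derivation ℂ (CharField N) (CharField N)}
    (h : ∀ w : Module.Dual ℤ N, D (chi w) = D' (chi w)) : D = D' := by
  have h1 : ∀ a : AddMonoidAlgebra ℂ (Module.Dual ℤ N),
      (D - D') (torusToField a) = 0 := fun a => by
    induction a using AddMonoidAlgebra.induction_linear with
    | zero => simp
    | add f g hf hg => rw [map_add, map_add, hf, hg, add_zero]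
    | single w c =>
      rw [torusToField_single, Derivation.map_smul, Derivation.sub_apply, h, sub_self, smul_zero]
  rw [← sub_eq_zero]
  ext x
  obtain ⟨a, b, hb, rfl⟩ := IsFractionRing.div_surjective
    (A := AddMonoidAlgebra ℂ (Module.Dual ℤ N)) x
  have hb0 : torusToField b ≠ 0 := fun h0 => nonZeroDivisors.ne_zero hb
    (torusToField_injective (h0.trans (map_zero _).symm))
  have h2 := (D - D').leibniz (torusToField a / torusToField b) (torusToField b)
  rw [div_mul_cancel₀ _ hb0, h1, h1, smul_zero, zero_add, smul_eq_mul] at h2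
  exact (mul_eq_zero.1 h2.symm).resolve_left hb0

/-- The derivation with `χ^w ↦ n(w) χ^w` extends to the function field. -/
lemma exists_euler (n : Module.Dual ℤ N →ₗ[ℤ] ℂ) :
    ∃ D : Derivation ℂ (CharField N) (CharField N), ∀ w, D (chi w) = n w • chi w := by
  let f : Multiplicative (Module.Dual ℤ N) →* TrivSqZeroExt (CharField N) (CharField N) :=
    { toFun := fun w => TrivSqZeroExt.inl (chi w.toAdd) +
        TrivSqZeroExt.inr (n w.toAdd • chi w.toAdd)
      map_one' := by
        ext <;> simp [chi_zero]
      map_mul' := fun w w' => by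
        refine TrivSqZeroExt.ext ?_ ?_
        · simp [chi_add]
        · rw [TrivSqZeroExt.snd_mul]
          simp only [TrivSqZeroExt.snd_add, TrivSqZeroExt.snd_inl, TrivSqZeroExt.snd_inr,
            TrivSqZeroExt.fst_add, TrivSqZeroExt.fst_inl, TrivSqZeroExt.fst_inr, zero_add,
            add_zero, toAdd_mul, chi_add, map_add, op_smul_eq_smul, smul_eq_mul, add_smul,
            mul_smul_comm]
          rw [add_comm, mul_comm (chi (Multiplicative.toAdd w'))] }
  let F : AddMonoidAlgebra ℂ (Module.Dual ℤ N) →ₐ[ℂ] TrivSqZeroExt (CharField N) (CharField N) :=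
    AddMonoidAlgebra.lift ℂ _ (Module.Dual ℤ N) f
  have hF : ∀ w c, F (AddMonoidAlgebra.single w c) = c • f (Multiplicative.ofAdd w) :=
    fun w c => AddMonoidAlgebra.lift_single _ _ _
  have hfst : ∀ a, (F a).fst = torusToField a := fun a => by
    induction a using AddMonoidAlgebra.induction_linear with
    | zero => simp
    | add f g hf hg => rw [map_add, map_add, TrivSqZeroExt.fst_add, hf, hg]
    | single w c =>
      rw [hF, torusToField_single, TrivSqZeroExt.fst_smul]
      simp [f]
  obtain ⟨D, hD⟩ := exists_derivation_fractionRing (K := CharField N) F hfst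
  refine ⟨D, fun w => (hD _).trans ?_⟩
  rw [hF, TrivSqZeroExt.snd_smul]
  simp [f]

/-- The vector field `χ^w ↦ n(w) χ^w`. -/
noncomputable def euler : (Module.Dual ℤ N →ₗ[ℤ] ℂ) →ₗ[ℂ]
    Derivation ℂ (CharField N) (CharField N) where
  toFun n := (exists_euler n).choose
  map_add' n n' := charField_derivation_ext fun w => by
    rw [(exists_euler (n + n')).choose_spec, Derivation.add_apply, (exists_euler n).choose_spec,
      (exists_euler n').choose_spec, LinearMap.add_apply, add_smul]
  map_smul' c n := charField_derivation_ext fun w => by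
    rw [(exists_euler (c • n)).choose_spec, RingHom.id_apply, Derivation.smul_apply,
      (exists_euler n).choose_spec, LinearMap.smul_apply, smul_smul, smul_eq_mul]

lemma euler_chi (n : Module.Dual ℤ N →ₗ[ℤ] ℂ) (w : Module.Dual ℤ N) :
    euler n (chi w) = n w • chi w := (exists_euler n).choose_spec w

/-- The homogeneous vector fields `χ^m θ_n`, where `θ_n χ^w = n(w) χ^w`. -/
noncomputable def gradedField (m : Module.Dual ℤ N) : (Module.Dual ℤ N →ₗ[ℤ] ℂ) →ₗ[ℂ]
    Derivation ℂ (CharField N) (CharField N) where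
  toFun n := chi m • euler n
  map_add' n n' := by rw [map_add, smul_add]
  map_smul' c n := by rw [map_smul, smul_comm]; rfl

lemma gradedField_chi (m : Module.Dual ℤ N) (n : Module.Dual ℤ N →ₗ[ℤ] ℂ)
    (w : Module.Dual ℤ N) : gradedField m n (chi w) = n w • chi (m + w) := by
  change chi m • euler n (chi w) = _
  rw [euler_chi, smul_comm, smul_eq_mul, chi_add]

lemma gradedField_lie (m m' : Module.Dual ℤ N) (n n' : Module.Dual ℤ N →ₗ[ℤ] ℂ) :
    ⁅gradedField m n, gradedField m' n'⁆ = gradedField (m + m') (n m' • n' - n' m • n) := by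
  refine charField_derivation_ext fun w => ?_
  rw [Derivation.commutator_apply, gradedField_chi, gradedField_chi, Derivation.map_smul, Derivation.map_smul,
    gradedField_chi, gradedField_chi, gradedField_chi, smul_smul, smul_smul, ← add_assoc,
    ← add_assoc, add_comm m' m, ← sub_smul]
  congr 1
  simp only [map_add, LinearMap.sub_apply, LinearMap.smul_apply, smul_eq_mul]
  ring

/-- The sum of the homogeneous fields with the given components. -/
noncomputable def fieldSum : (Module.Dual ℤ N →₀ (Module.Dual ℤ N →ₗ[ℤ] ℂ)) →ₗ[ℂ]
    Derivation ℂ (CharField N) (CharField N) :=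
  Finsupp.lsum ℂ gradedField

lemma fieldSum_single (m : Module.Dual ℤ N) (n : Module.Dual ℤ N →ₗ[ℤ] ℂ) :
    fieldSum (Finsupp.single m n) = gradedField m n := by simp [fieldSum]

/-- The value of a sum of homogeneous fields on `χ^w`, as a Laurent polynomial. -/
lemma exists_fieldSum_chi (f : Module.Dual ℤ N →₀ (Module.Dual ℤ N →ₗ[ℤ] ℂ))
    (w : Module.Dual ℤ N) : ∃ a : AddMonoidAlgebra ℂ (Module.Dual ℤ N),
      fieldSum f (chi w) = torusToField a ∧ ∀ m, a.coeff (m + w) = f m w := by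
  classical
  induction f using Finsupp.induction_linear with
  | zero => exact ⟨0, by simp, fun m => by simp⟩
  | add f g hf hg =>
    obtain ⟨a, ha, ha'⟩ := hf
    obtain ⟨b, hb, hb'⟩ := hg
    exact ⟨a + b, by rw [map_add, Derivation.add_apply, ha, hb, map_add], fun m => by
      rw [AddMonoidAlgebra.coeff_add, Finsupp.add_apply, ha', hb']; rfl⟩
  | single k n =>
    refine ⟨AddMonoidAlgebra.single (k + w) (n w), ?_, fun m => ?_⟩
    · rw [fieldSum_single, gradedField_chi, torusToField_single]
    · rw [AddMonoidAlgebra.coeff_single, Finsupp.single_apply, Finsupp.single_apply]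
      by_cases h : k = m
      · rw [if_pos h, if_pos (by rw [h])]
      · rw [if_neg h, if_neg (fun h' => h (add_right_cancel h'))]
        rfl

/-- Homogeneous vector fields of different degrees are linearly independent. -/
lemma fieldSum_injective : Function.Injective (fieldSum (N := N)) := by
  refine (injective_iff_map_eq_zero _).2 fun f hf => ?_
  ext m w
  obtain ⟨a, ha, ha'⟩ := exists_fieldSum_chi f w
  rw [hf, Derivation.zero_apply] at ha
  rw [← ha', torusToField_injective (ha.symm.trans (map_zero _).symm)]
  simp

end EulerFields

/-! ### The grading of the Lie algebra of vector fields -/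

section VectorFields

variable {N : Type} [AddCommGroup N]

lemma mem_range_chartToField {σ : PointedCone ℝ (ℝ ⊗[ℤ] N)}
    {a : AddMonoidAlgebra ℂ (Module.Dual ℤ N)} :
    torusToField a ∈ (chartToField σ).range ↔ ∀ m, a.coeff m ≠ 0 → m ∈ dualMonoid σ := by
  rw [← mem_range_coordToTorus]
  constructor
  · rintro ⟨b, hb⟩
    exact ⟨b, torusToField_injective hb⟩
  · rintro ⟨b, rfl⟩
    exact ⟨b, rfl⟩

lemma chi_mem_range_chartToField {σ : PointedCone ℝ (ℝ ⊗[ℤ] N)} {w : Module.Dual ℤ N}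
    (hw : w ∈ dualMonoid σ) : chi w ∈ (chartToField σ).range := by
  refine mem_range_chartToField.2 fun m hm => ?_
  rw [AddMonoidAlgebra.coeff_single] at hm
  rwa [← (Finsupp.single_apply_ne_zero.1 hm).1] at hw

variable [Module.Free ℤ N]

/-- The components in degree `m` of the vector fields. -/
def vectorFieldComponents {ι : Type*} (σ : ι → PointedCone ℝ (ℝ ⊗[ℤ] N)) (m : Module.Dual ℤ N) :
    Submodule ℂ (Module.Dual ℤ N →ₗ[ℤ] ℂ) where
  carrier := {n | ∀ i, ∀ w ∈ dualMonoid (σ i), n w ≠ 0 → m + w ∈ dualMonoid (σ i)}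
  zero_mem' := fun _ _ _ h => absurd rfl h
  add_mem' := fun {n n'} hn hn' i w hw h => by
    by_cases h0 : n w = 0
    · exact hn' i w hw (fun h1 => h (by rw [LinearMap.add_apply, h0, h1, add_zero]))
    · exact hn i w hw h0
  smul_mem' := fun c n hn i w hw h => hn i w hw (fun h1 => h (by
    rw [LinearMap.smul_apply, h1, smul_zero]))

/-- Whether a sum of homogeneous fields preserves `ℂ[S_σ]` can be checked degree by degree. -/
lemma fieldSum_preserves_iff (f : Module.Dual ℤ N →₀ (Module.Dual ℤ N →ₗ[ℤ] ℂ))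
    (σ : PointedCone ℝ (ℝ ⊗[ℤ] N)) :
    (∀ a ∈ (chartToField σ).range, fieldSum f a ∈ (chartToField σ).range) ↔
      ∀ m, ∀ w ∈ dualMonoid σ, f m w ≠ 0 → m + w ∈ dualMonoid σ := by
  constructor
  · intro h m w hw hne
    have h1 := h (chi w) (chi_mem_range_chartToField hw)
    obtain ⟨a, ha, ha'⟩ := exists_fieldSum_chi f w
    rw [ha, mem_range_chartToField] at h1
    exact h1 _ (by rwa [ha'])
  · rintro h _ ⟨a, rfl⟩
    change fieldSum f (chartToField σ a) ∈ _
    induction a using AddMonoidAlgebra.induction_linear with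
    | zero => simp
    | add a b ha hb =>
      rw [map_add, map_add]
      exact Subalgebra.add_mem _ ha hb
    | single w c =>
      obtain ⟨a, ha, ha'⟩ := exists_fieldSum_chi f w.1
      have h1 : chartToField σ (AddMonoidAlgebra.single w c) = c • chi w.1 := by
        rw [← torusToField_single, ← coordToTorus_single]
        rfl
      rw [h1, Derivation.map_smul, ha]
      refine Subalgebra.smul_mem _ (mem_range_chartToField.2 fun m hm => ?_) c
      have := h (m - w.1) w.1 w.2 (by rwa [← ha', sub_add_cancel])
      rwa [sub_add_cancel] at this

/-- Every derivation that preserves `ℂ[M]` is a finite sum of homogeneous ones. -/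
lemma exists_fieldSum_eq [Module.Finite ℤ N] {D : Derivation ℂ (CharField N) (CharField N)}
    (hD : ∀ a ∈ (chartToField (N := N) ⊥).range, D a ∈ (chartToField (N := N) ⊥).range) :
    ∃ f, fieldSum f = D := by
  classical
  have hchi : ∀ w, ∃ a, torusToField a = D (chi w) := fun w => by
    obtain ⟨b, hb⟩ := hD (chi w) (chi_mem_range_chartToField (mem_dualMonoid_bot w))
    exact ⟨_, hb⟩
  choose a ha using hchi
  let b := Module.Free.chooseBasis ℤ (Module.Dual ℤ N)
  -- the logarithmic derivative is additive in the exponent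
  let L : Module.Dual ℤ N →+ CharField N := AddMonoidHom.mk' (fun w => D (chi w) / chi w)
    fun w w' => by
      have h1 := chi_ne_zero w
      have h2 := chi_ne_zero w'
      rw [chi_add, D.leibniz, smul_eq_mul, smul_eq_mul]
      field_simp
      ring
  have hL : ∀ w, D (chi w) = L w * chi w := fun w => (div_mul_cancel₀ _ (chi_ne_zero w)).symm
  have hLa : ∀ w, L w = torusToField (a w * AddMonoidAlgebra.single (-w) 1) := fun w => by
    change D (chi w) / chi w = _
    rw [div_eq_iff (chi_ne_zero w), map_mul, ha, mul_assoc]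
    change _ = D (chi w) * (chi (-w) * chi w)
    rw [← chi_add, neg_add_cancel, chi_zero, mul_one]
  let co : Module.Free.ChooseBasisIndex ℤ (Module.Dual ℤ N) → (Module.Dual ℤ N →ₗ[ℤ] ℂ) :=
    fun i => (Algebra.linearMap ℤ ℂ).comp (b.coord i)
  have hmem : ∀ (a : AddMonoidAlgebra ℂ (Module.Dual ℤ N)) (n : Module.Dual ℤ N →ₗ[ℤ] ℂ),
      torusToField a • euler n ∈ LinearMap.range (fieldSum (N := N)) := fun a n => by
    induction a using AddMonoidAlgebra.induction_linear with
    | zero => rw [map_zero, zero_smul]; exact Submodule.zero_mem _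
    | add a b ha hb => rw [map_add, add_smul]; exact Submodule.add_mem _ ha hb
    | single m c =>
      refine ⟨Finsupp.single m (c • n), ?_⟩
      rw [fieldSum_single, map_smul, torusToField_single, smul_assoc]
      rfl
  have hsum : D = ∑ i, L (b i) • euler (co i) := charField_derivation_ext fun w => by
    have h1 : L w = ∑ i, (b.repr w i) • L (b i) := by
      conv_lhs => rw [← b.sum_repr w]
      rw [map_sum]
      exact Finset.sum_congr rfl fun i _ => map_zsmul L _ _
    have h2 : (∑ i, L (b i) • euler (co i)) (chi w) = ∑ i, L (b i) • euler (co i) (chi w) := by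
      let ev : Derivation ℂ (CharField N) (CharField N) →+ CharField N :=
        { toFun := fun D => D (chi w)
          map_zero' := rfl
          map_add' := fun _ _ => rfl }
      exact map_sum ev _ _
    rw [hL, h2, h1, Finset.sum_mul]
    refine Finset.sum_congr rfl fun i _ => ?_
    rw [euler_chi, smul_eq_mul, mul_smul_comm, zsmul_eq_mul, mul_assoc, Algebra.smul_def]
    congr 1
    simp [co]
  change D ∈ LinearMap.range fieldSum
  rw [hsum]
  refine Submodule.sum_mem _ fun i _ => ?_
  rw [hLa]
  exact hmem _ _

/-- Vector fields are the finite sums of homogeneous fields with admissible components. -/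
lemma mem_vectorFields_iff [Module.Finite ℤ N] {ι : Type*} (σ : ι → PointedCone ℝ (ℝ ⊗[ℤ] N))
    {D : Derivation ℂ (CharField N) (CharField N)} :
    D ∈ vectorFields σ ↔ ∃ f, fieldSum f = D ∧ ∀ m, f m ∈ vectorFieldComponents σ m := by
  constructor
  · intro hD
    obtain ⟨f, rfl⟩ := exists_fieldSum_eq hD.1
    exact ⟨f, rfl, fun m i => (fieldSum_preserves_iff f (σ i)).1 (hD.2 i) m⟩
  · rintro ⟨f, rfl, hf⟩
    exact ⟨(fieldSum_preserves_iff f ⊥).2 fun m w _ _ => mem_dualMonoid_bot _,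
      fun i => (fieldSum_preserves_iff f (σ i)).2 fun m => hf m i⟩

lemma gradedField_mem_vectorFields [Module.Finite ℤ N] {ι : Type*}
    {σ : ι → PointedCone ℝ (ℝ ⊗[ℤ] N)} {m : Module.Dual ℤ N} {n : Module.Dual ℤ N →ₗ[ℤ] ℂ}
    (h : n ∈ vectorFieldComponents σ m) : gradedField m n ∈ vectorFields σ := by
  classical
  refine (mem_vectorFields_iff σ).2 ⟨_, fieldSum_single m n, fun m' => ?_⟩
  rw [Finsupp.single_apply]
  split_ifs with hm
  · rwa [← hm]
  · exact Submodule.zero_mem _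

lemma vectorFields_eq_span [Module.Finite ℤ N] {ι : Type*} (σ : ι → PointedCone ℝ (ℝ ⊗[ℤ] N)) :
    vectorFields σ = Submodule.span ℂ {D | ∃ m, ∃ n ∈ vectorFieldComponents σ m,
      gradedField m n = D} := by
  refine le_antisymm (fun D hD => ?_) (Submodule.span_le.2 ?_)
  · obtain ⟨f, rfl, hf⟩ := (mem_vectorFields_iff σ).1 hD
    rw [fieldSum, Finsupp.lsum_apply]
    exact Submodule.sum_mem _ fun m _ => Submodule.subset_span ⟨m, _, hf m, rfl⟩
  · rintro _ ⟨m, n, hn, rfl⟩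
    exact gradedField_mem_vectorFields hn

end VectorFields

/-! ### Root fields, dimension and perfectness -/

section RootFields

variable {N : Type} [AddCommGroup N]

/-- Evaluation at a lattice vector, as a complex linear form on `M`. -/
noncomputable def evalComplex : N →+ (Module.Dual ℤ N →ₗ[ℤ] ℂ) where
  toFun x := (Algebra.linearMap ℤ ℂ).comp (Module.Dual.eval ℤ N x)
  map_zero' := by ext; simp
  map_add' x y := by ext; simp

@[simp] lemma evalComplex_apply (x : N) (m : Module.Dual ℤ N) : evalComplex x m = (m x : ℂ) := rfl

/-- The rays of the charts `U_{σ i}` lie in `P`, and every `v ∈ P` is a ray of some chart whose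
facet orthogonal to `v` spans `v^⊥`. -/
structure IsRaySet {ι : Type*} (P : Set N) (σ : ι → PointedCone ℝ (ℝ ⊗[ℤ] N)) : Prop where
  hull : ∀ i, ∃ s ⊆ P, σ i = PointedCone.hull ℝ (toReal '' s)
  facet : ∀ v ∈ P, ∃ i, toReal v ∈ σ i ∧ (∃ w ∈ dualMonoid (σ i), w v = 1) ∧
    ∀ n : Module.Dual ℤ N →ₗ[ℤ] ℂ, (∀ w ∈ dualMonoid (σ i), w v = 0 → n w = 0) →
      ∃ c : ℂ, n = c • evalComplex v

variable {ι : Type*} {σ : ι → PointedCone ℝ (ℝ ⊗[ℤ] N)} {P : Set N}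

lemma vectorFieldComponents_zero : vectorFieldComponents σ 0 = ⊤ :=
  eq_top_iff.2 fun n _ i w hw _ => by rwa [zero_add]

lemma nonneg_of_mem_dualMonoid {τ : PointedCone ℝ (ℝ ⊗[ℤ] N)} {v : N} (hv : toReal v ∈ τ)
    {w : Module.Dual ℤ N} (hw : w ∈ dualMonoid τ) : 0 ≤ w v := by
  have := hw _ hv
  rw [pairing_toReal] at this
  exact_mod_cast this

/-- A root `m` with `η_m = v` gives the vector field `χ^m θ_v`. -/
lemma IsRaySet.evalComplex_mem (h : IsRaySet P σ) {m : Module.Dual ℤ N} {v : N}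
    (hm : m v = -1) (hm' : ∀ v' ∈ P, v' ≠ v → 0 ≤ m v') :
    evalComplex v ∈ vectorFieldComponents σ m := by
  intro i w hw hne
  obtain ⟨s, hs, hσ⟩ := h.hull i
  rw [hσ, mem_dualMonoid_hull] at hw ⊢
  intro x hx
  rw [LinearMap.add_apply]
  by_cases hxv : x = v
  · subst hxv
    have h1 := hw x hx
    have h2 : w x ≠ 0 := fun h0 => hne (by rw [evalComplex_apply, h0, Int.cast_zero])
    omega
  · have := hm' x (hs hx) hxv
    have := hw x hx
    omega

/-- A homogeneous vector field `χ^m θ_n` with `⟨v, m⟩ < 0` at a ray `v` satisfies `⟨v, m⟩ = -1`, and `n`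
is a multiple of `v`: it vanishes at every `w` in the facet orthogonal to `v`, since `χ^{m + w}` has a
pole along the divisor of `v`. -/
lemma IsRaySet.exists_of_neg (h : IsRaySet P σ) {m : Module.Dual ℤ N}
    {n : Module.Dual ℤ N →ₗ[ℤ] ℂ} (hn : n ∈ vectorFieldComponents σ m) (hn0 : n ≠ 0) {v : N}
    (hv : v ∈ P) (hmv : m v < 0) : m v = -1 ∧ ∃ c : ℂ, c ≠ 0 ∧ n = c • evalComplex v := by
  obtain ⟨i, hvi, ⟨w₁, hw₁, hw₁v⟩, hi⟩ := h.facet v hv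
  obtain ⟨c, rfl⟩ := hi n fun w hw hwv => by
    by_contra hne
    have := nonneg_of_mem_dualMonoid hvi (hn i w hw hne)
    rw [LinearMap.add_apply] at this
    omega
  have hc : c ≠ 0 := fun h0 => hn0 (by rw [h0, zero_smul])
  refine ⟨?_, c, hc, rfl⟩
  have := nonneg_of_mem_dualMonoid hvi (hn i w₁ hw₁ (by
    rw [LinearMap.smul_apply, evalComplex_apply, hw₁v]; simpa using hc))
  rw [LinearMap.add_apply] at this
  omega

variable [Module.Free ℤ N]

/-- The nonzero homogeneous vector fields of nonzero degree are the root fields. -/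
lemma IsRaySet.exists_root (h : IsRaySet P σ) (hP : PositivelySpans P) {m : Module.Dual ℤ N}
    {n : Module.Dual ℤ N →ₗ[ℤ] ℂ} (hn : n ∈ vectorFieldComponents σ m) (hn0 : n ≠ 0)
    (hm : m ≠ 0) : ∃ v ∈ P, m v = -1 ∧ (∀ v' ∈ P, v' ≠ v → 0 ≤ m v') ∧
      ∃ c : ℂ, n = c • evalComplex v := by
  obtain ⟨v, hv, hmv⟩ := hP m hm
  obtain ⟨h1, c, hc, rfl⟩ := h.exists_of_neg hn hn0 hv hmv
  refine ⟨v, hv, h1, fun v' hv' hne => ?_, c, rfl⟩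
  by_contra hneg
  obtain ⟨h1', c', hc', heq⟩ := h.exists_of_neg hn hn0 hv' (not_le.1 hneg)
  have h2 := DFunLike.congr_fun heq m
  rw [LinearMap.smul_apply, LinearMap.smul_apply, evalComplex_apply, evalComplex_apply, h1, h1',
    smul_eq_mul, smul_eq_mul] at h2
  have hcc : c = c' := mul_right_cancel₀ (by norm_num) h2
  subst hcc
  have h3 := smul_right_injective _ hc heq
  refine hne (eq_of_dual_eq fun w => ?_)
  have h4 := DFunLike.congr_fun h3 w
  rw [evalComplex_apply, evalComplex_apply] at h4
  exact_mod_cast h4.symm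

/-- The coroots `v' - v` of the semisimple roots span `Hom(M, ℂ)`. -/
def CorootsSpan (P : Set N) : Prop :=
  Submodule.span ℂ {x | ∃ s v v', IsRootPair P s v v' ∧ x = evalComplex v' - evalComplex v} = ⊤

variable [Module.Finite ℤ N]

/-- The components of degree `0` of brackets of vector fields are combinations of coroots, since
`[χ^s θ_v, χ^{-s} θ_{v'}] = θ_{v'} - θ_v`. -/
lemma bracketSpan_le_of_coroots (h : IsRaySet P σ) (hP : PositivelySpans P) {D}
    (hD : D ∈ bracketSpan (vectorFields σ)) : ∃ f, fieldSum f = D ∧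
      f 0 ∈ Submodule.span ℂ {x | ∃ s v v', IsRootPair P s v v' ∧
        x = evalComplex v' - evalComplex v} := by
  classical
  set C := Submodule.span ℂ {x | ∃ s v v', IsRootPair P s v v' ∧
        x = evalComplex v' - evalComplex v} with hC
  let Z := Submodule.map (fieldSum (N := N)) (Submodule.comap (Finsupp.lapply 0) C)
  suffices hZ : bracketSpan (vectorFields σ) ≤ Z by
    obtain ⟨f, hf, rfl⟩ := hZ hD
    exact ⟨f, rfl, hf⟩
  refine Submodule.span_le.2 ?_
  rintro _ ⟨a, ha, b, hb, rfl⟩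
  rw [vectorFields_eq_span] at ha hb
  induction ha, hb using Submodule.span_induction₂ with
  | mem_mem a b ha hb =>
    obtain ⟨m, n, hn, rfl⟩ := ha
    obtain ⟨m', n', hn', rfl⟩ := hb
    rw [gradedField_lie]
    refine ⟨_, ?_, fieldSum_single _ _⟩
    change Finsupp.single (m + m') (n m' • n' - n' m • n) 0 ∈ C
    rw [Finsupp.single_apply]
    split_ifs with h0
    swap
    · exact Submodule.zero_mem _
    by_cases hm : m = 0
    · have hm' : m' = 0 := by rwa [hm, zero_add] at h0
      rw [hm, hm', map_zero, map_zero, zero_smul, zero_smul, sub_zero]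
      exact Submodule.zero_mem _
    by_cases hn0 : n = 0
    · rw [hn0]; simp
    by_cases hn0' : n' = 0
    · rw [hn0']; simp
    obtain rfl : m' = -m := (neg_eq_of_add_eq_zero_right h0).symm
    obtain ⟨v, hv, hmv, hmv', c, rfl⟩ := h.exists_root hP hn hn0 hm
    obtain ⟨w, hw, hmw, hmw', c', rfl⟩ := h.exists_root hP hn' hn0' (neg_ne_zero.2 hm)
    rw [LinearMap.neg_apply] at hmw
    have hvw : v ≠ w := by rintro rfl; omega
    have hpair : IsRootPair P m v w := by
      refine ⟨hv, hw, hvw, hmv, by omega, fun x hx hxv hxw => ?_⟩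
      have h1 := hmv' x hx hxv
      have h2 := hmw' x hx hxw
      rw [LinearMap.neg_apply] at h2
      omega
    have hw1 : m w = 1 := by omega
    have : (c • evalComplex v) (-m) • c' • evalComplex w - (c' • evalComplex w) m • c • evalComplex v
        = (c * c') • (evalComplex w - evalComplex v) := by
      ext x
      simp [hmv, hw1]
      ring
    rw [this]
    exact Submodule.smul_mem _ _ (Submodule.subset_span ⟨m, v, w, hpair, rfl⟩)
  | zero_left b hb => rw [zero_lie]; exact Submodule.zero_mem _
  | zero_right a ha => rw [lie_zero]; exact Submodule.zero_mem _
  | add_left x y z _ _ _ h1 h2 => rw [add_lie]; exact Submodule.add_mem _ h1 h2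
  | add_right x y z _ _ _ h1 h2 => rw [lie_add]; exact Submodule.add_mem _ h1 h2
  | smul_left c x y _ _ h1 => rw [smul_lie]; exact Submodule.smul_mem _ _ h1
  | smul_right c x y _ _ h1 => rw [lie_smul]; exact Submodule.smul_mem _ _ h1

/-- The Lie algebra of vector fields is perfect if and only if the coroots span. -/
theorem IsRaySet.perfect_iff (h : IsRaySet P σ) (hP : PositivelySpans P) :
    vectorFields σ ≤ bracketSpan (vectorFields σ) ↔ CorootsSpan P := by
  constructor
  · intro hle
    refine eq_top_iff.2 fun n _ => ?_
    obtain ⟨f, hf, hf0⟩ := bracketSpan_le_of_coroots h hP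
      (hle (gradedField_mem_vectorFields (m := 0) (n := n)
        (by rw [vectorFieldComponents_zero]; trivial)))
    rw [← fieldSum_single] at hf
    rw [fieldSum_injective hf, Finsupp.single_eq_same] at hf0
    exact hf0
  · intro hspan
    rw [vectorFields_eq_span, Submodule.span_le]
    rintro _ ⟨m, n, hn, rfl⟩
    rw [← vectorFields_eq_span]
    by_cases hm : m = 0
    · subst hm
      have hn' : n ∈ Submodule.span ℂ {x | ∃ s v v', IsRootPair P s v v' ∧
        x = evalComplex v' - evalComplex v} := by
        rw [show _ = ⊤ from hspan]; trivial
      clear hn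
      induction hn' using Submodule.span_induction with
      | mem x hx =>
        obtain ⟨s, v, w, hs, rfl⟩ := hx
        refine Submodule.subset_span ⟨gradedField s (evalComplex v),
          gradedField_mem_vectorFields (h.evalComplex_mem hs.left fun x hx hxv => ?_),
          gradedField (-s) (evalComplex w),
          gradedField_mem_vectorFields (h.evalComplex_mem ?_ fun x hx hxw => ?_), ?_⟩
        · by_cases hxw : x = w
          · rw [hxw, hs.right]; norm_num
          · rw [hs.other x hx hxv hxw]
        · rw [LinearMap.neg_apply, hs.right]
        · rw [LinearMap.neg_apply]
          by_cases hxv : x = v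
          · rw [hxv, hs.left]; norm_num
          · rw [hs.other x hx hxv hxw]; norm_num
        · rw [gradedField_lie, add_neg_cancel]
          congr 1
          ext x
          simp [hs.left, hs.right]
      | zero => rw [map_zero]; exact Submodule.zero_mem _
      | add x y _ _ h1 h2 => rw [map_add]; exact Submodule.add_mem _ h1 h2
      | smul c x _ h1 => rw [map_smul]; exact Submodule.smul_mem _ _ h1
    · obtain ⟨x, hx⟩ : ∃ x, m x ≠ 0 := by
        by_contra hall
        push Not at hall
        exact hm (LinearMap.ext hall)
      have hx' : (m x : ℂ) ≠ 0 := by exact_mod_cast hx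
      refine Submodule.subset_span ⟨gradedField 0 ((m x : ℂ)⁻¹ • evalComplex x),
        gradedField_mem_vectorFields (by rw [vectorFieldComponents_zero]; trivial),
        gradedField m n, gradedField_mem_vectorFields hn, ?_⟩
      rw [gradedField_lie, zero_add, LinearMap.smul_apply, evalComplex_apply, smul_eq_mul,
        inv_mul_cancel₀ hx', one_smul, map_zero, zero_smul, sub_zero]

/-- The dimension of the Lie algebra of vector fields: a torus and one dimension for each root. -/
theorem IsRaySet.rank_vectorFields (h : IsRaySet P σ) (hP : PositivelySpans P) :
    Module.rank ℂ (vectorFields σ) =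
      (Module.finrank ℤ N : Cardinal) + Cardinal.mk (rootsOf P) := by
  classical
  let Λ : ((Module.Dual ℤ N →ₗ[ℤ] ℂ) × (rootsOf P →₀ ℂ)) →ₗ[ℂ]
      (Module.Dual ℤ N →₀ (Module.Dual ℤ N →ₗ[ℤ] ℂ)) :=
    LinearMap.coprod (Finsupp.lsingle 0) (Finsupp.lsum ℂ fun r =>
      (Finsupp.lsingle r.1).comp (LinearMap.toSpanSingleton ℂ _ (evalComplex r.2.choose)))
  have hroot0 : ∀ r : rootsOf P, r.1 ≠ 0 := by
    rintro ⟨r, v, hv, h1, _⟩ (rfl : r = 0)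
    simp at h1
  have hΛz : Λ (0, 0) = 0 := map_zero Λ
  have hΛ0 : ∀ n, Λ (n, 0) = Finsupp.single 0 n := fun n => by simp [Λ]
  have hΛr : ∀ r c, Λ (0, Finsupp.single r c) =
      Finsupp.single r.1 (c • evalComplex r.2.choose) := fun r c => by simp [Λ]
  have hval0 : ∀ g, Λ (0, g) 0 = 0 := fun g => by
    induction g using Finsupp.induction_linear with
    | zero => rw [hΛz]; rfl
    | add f g hf hg =>
      have : ((0, f + g) : (Module.Dual ℤ N →ₗ[ℤ] ℂ) × (rootsOf P →₀ ℂ)) = (0, f) + (0, g) := by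
        simp
      rw [this, map_add, Finsupp.add_apply, hf, hg, add_zero]
    | single r c => rw [hΛr, Finsupp.single_apply, if_neg (hroot0 r)]
  have hvalr : ∀ g (r : rootsOf P), Λ (0, g) r.1 = g r • evalComplex r.2.choose := fun g r => by
    induction g using Finsupp.induction_linear with
    | zero => rw [hΛz]; simp
    | add f g hf hg =>
      have : ((0, f + g) : (Module.Dual ℤ N →ₗ[ℤ] ℂ) × (rootsOf P →₀ ℂ)) = (0, f) + (0, g) := by
        simp
      rw [this, map_add, Finsupp.add_apply, hf, hg, Finsupp.add_apply, add_smul]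
    | single r' c =>
      rw [hΛr, Finsupp.single_apply, Finsupp.single_apply]
      by_cases hr : r' = r
      · rw [hr, if_pos rfl, if_pos rfl]
      · rw [if_neg (fun h' => hr (Subtype.ext h')), if_neg hr, zero_smul]
  have hsplit : ∀ p, Λ p = Finsupp.single 0 p.1 + Λ (0, p.2) := fun p => by
    rw [← hΛ0, ← map_add]
    simp
  have hinj : Function.Injective Λ := by
    refine (injective_iff_map_eq_zero Λ).2 fun p hp => ?_
    rw [hsplit] at hp
    refine Prod.ext ?_ (Finsupp.ext fun r => ?_)
    · have h1 := DFunLike.congr_fun hp 0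
      rw [Finsupp.add_apply, hval0, Finsupp.single_eq_same, add_zero] at h1
      exact h1
    · have h1 := DFunLike.congr_fun hp r.1
      rw [Finsupp.add_apply, hvalr, Finsupp.single_apply, if_neg (hroot0 r).symm, zero_add] at h1
      have h2 := DFunLike.congr_fun h1 r.1
      rw [LinearMap.smul_apply, evalComplex_apply, r.2.choose_spec.2.1] at h2
      simpa using h2
  have hrange : LinearMap.range (fieldSum ∘ₗ Λ) = vectorFields σ := by
    refine le_antisymm ?_ ?_
    · rintro _ ⟨p, rfl⟩
      rw [LinearMap.comp_apply, hsplit, map_add, fieldSum_single]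
      refine Submodule.add_mem _ (gradedField_mem_vectorFields
        (by rw [vectorFieldComponents_zero]; trivial)) ?_
      generalize p.2 = g
      induction g using Finsupp.induction_linear with
      | zero => rw [hΛz, map_zero]; exact Submodule.zero_mem _
      | add f g hf hg =>
        have : ((0, f + g) : (Module.Dual ℤ N →ₗ[ℤ] ℂ) × (rootsOf P →₀ ℂ)) = (0, f) + (0, g) := by
          simp
        rw [this, map_add, map_add]
        exact Submodule.add_mem _ hf hg
      | single r c =>
        rw [hΛr, fieldSum_single]
        exact gradedField_mem_vectorFields (Submodule.smul_mem _ _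
          (h.evalComplex_mem r.2.choose_spec.2.1 r.2.choose_spec.2.2))
    · rw [vectorFields_eq_span, Submodule.span_le]
      rintro _ ⟨m, n, hn, rfl⟩
      by_cases hm : m = 0
      · subst hm
        exact ⟨(n, 0), by rw [LinearMap.comp_apply, hΛ0, fieldSum_single]⟩
      by_cases hn0 : n = 0
      · subst hn0
        exact ⟨0, by rw [map_zero, map_zero]⟩
      obtain ⟨v, hv, hmv, hmv', c, rfl⟩ := h.exists_root hP hn hn0 hm
      let r : rootsOf P := ⟨m, v, hv, hmv, hmv'⟩
      have hrv : r.2.choose = v := by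
        by_contra hne
        have h1 := hmv' _ r.2.choose_spec.1 hne
        have h2 : m r.2.choose = -1 := r.2.choose_spec.2.1
        omega
      exact ⟨(0, Finsupp.single r c), by
        rw [LinearMap.comp_apply, hΛr, fieldSum_single, hrv]⟩
  have hrank : Module.rank ℂ (Module.Dual ℤ N →ₗ[ℤ] ℂ) = Module.finrank ℤ N := by
    let b := (Module.finBasis ℤ N).dualBasis
    rw [← (b.constr ℂ (M' := ℂ)).rank_eq, rank_fun']
    simp
  rw [← hrange, ← (LinearEquiv.ofInjective (fieldSum ∘ₗ Λ)
    (fieldSum_injective.comp hinj)).rank_eq, rank_prod', hrank, rank_finsupp_self']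

/-- Isomorphic varieties with toric atlases of the same rank have the same number of roots, by
comparison of the dimensions of their Lie algebras of vector fields. -/
theorem ToricAtlas.encard_rootsOf_eq {Y Y' : Over (Spec (CommRingCat.of ℂ))} {N' : Type}
    [AddCommGroup N'] [Module.Free ℤ N'] [Module.Finite ℤ N'] {ι ι' : Type}
    {σ : ι → PointedCone ℝ (ℝ ⊗[ℤ] N)} {σ' : ι' → PointedCone ℝ (ℝ ⊗[ℤ] N')} {P' : Set N'}
    (𝒜 : ToricAtlas Y σ) (𝒜' : ToricAtlas Y' σ') (h : IsRaySet P σ) (h' : IsRaySet P' σ')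
    (hP : PositivelySpans P) (hP' : PositivelySpans P')
    (hrank : Module.finrank ℤ N = Module.finrank ℤ N') (e : Y ≅ Y') :
    (rootsOf P).encard = (rootsOf P').encard := by
  obtain ⟨Θ, -, hΘ⟩ := 𝒜.exists_vectorFields_equiv 𝒜' e
  have h1 := (Θ.submoduleMap (vectorFields σ)).rank_eq
  have h2 : Module.rank ℂ ((vectorFields σ).map Θ.toLinearMap) =
    Module.rank ℂ (vectorFields σ') := by rw [hΘ]
  rw [show Module.rank ℂ _ = _ from h2] at h1
  rw [h.rank_vectorFields hP, h'.rank_vectorFields hP', hrank] at h1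
  have h3 := Cardinal.eq_of_add_eq_add_left h1 (Cardinal.natCast_lt_aleph0)
  rw [Set.encard, Set.encard, ENat.card, ENat.card, h3]

/-- Isomorphic varieties with toric atlases have simultaneously spanning coroots. -/
theorem ToricAtlas.corootsSpan {Y Y' : Over (Spec (CommRingCat.of ℂ))} {N' : Type}
    [AddCommGroup N'] [Module.Free ℤ N'] [Module.Finite ℤ N'] {ι ι' : Type}
    {σ : ι → PointedCone ℝ (ℝ ⊗[ℤ] N)} {σ' : ι' → PointedCone ℝ (ℝ ⊗[ℤ] N')} {P' : Set N'}
    (𝒜 : ToricAtlas Y σ) (𝒜' : ToricAtlas Y' σ') (h : IsRaySet P σ) (h' : IsRaySet P' σ')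
    (hP : PositivelySpans P) (hP' : PositivelySpans P') (e : Y ≅ Y') (hspan : CorootsSpan P') :
    CorootsSpan P := by
  obtain ⟨Θ, hlie, hΘ⟩ := 𝒜.exists_vectorFields_equiv 𝒜' e
  rw [← h.perfect_iff hP]
  rw [← h'.perfect_iff hP'] at hspan
  intro D hD
  have h1 : Θ D ∈ bracketSpan (vectorFields σ') := hspan (hΘ ▸ ⟨D, hD, rfl⟩)
  have h2 : bracketSpan (vectorFields σ') ≤
      (bracketSpan (vectorFields σ)).map Θ.toLinearMap := by
    refine Submodule.span_le.2 ?_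
    rintro _ ⟨a, ha, b, hb, rfl⟩
    rw [← hΘ] at ha hb
    obtain ⟨a, ha, rfl⟩ := ha
    obtain ⟨b, hb, rfl⟩ := hb
    exact ⟨⁅a, b⁆, Submodule.subset_span ⟨a, ha, b, hb, rfl⟩, hlie a b⟩
  obtain ⟨E, hE, hED⟩ := h2 h1
  rwa [← Θ.injective hED]

end RootFields

/-! ### Roots of the fans of `ℙᵈ` and `(ℙ¹)ᵈ` -/

section FrameRays

variable {N : Type} [AddCommGroup N]

/-- The rays of a fan are a ray set of its atlas: the chart of the ray `v` itself has the facet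
property. -/
lemma Fan.isRaySet [Module.Free ℤ N] [Module.Finite ℤ N] (Δ : Fan N) :
    IsRaySet Δ.rayGenerators (fun σ : Δ.cones => σ.1) where
  hull σ := Δ.exists_cone_eq_hull σ.2
  facet v hv := by
    obtain ⟨hmem, w₀, hw₀⟩ := Δ.rayGenerators_primitive hv
    have hdual : ∀ m : Module.Dual ℤ N,
        m ∈ dualMonoid (PointedCone.hull ℝ (toReal '' {v})) ↔ 0 ≤ m v := fun m => by
      rw [mem_dualMonoid_hull]
      simp
    refine ⟨⟨_, hmem⟩, toReal_mem_hull rfl, ⟨w₀, (hdual _).2 (by rw [hw₀]; norm_num), hw₀⟩,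
      fun n hn => ⟨n w₀, LinearMap.ext fun m => ?_⟩⟩
    have h1 := hn (m - m v • w₀) ((hdual _).2 (by simp [hw₀])) (by simp [hw₀])
    rw [map_sub, map_smul, sub_eq_zero] at h1
    rw [h1, LinearMap.smul_apply, evalComplex_apply, zsmul_eq_mul, smul_eq_mul, mul_comm]

lemma Fan.IsComplete.positivelySpans [Module.Free ℤ N] [Module.Finite ℤ N] {Δ : Fan N}
    (hΔ : Δ.IsComplete) : PositivelySpans Δ.rayGenerators := fun _ hm => hΔ.exists_neg hm

section Simplex

variable {d : ℕ} {v : Fin (d + 1) → N} {u : Fin (d + 1) → Module.Dual ℤ N}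

lemma SimplexFrame.injective (h : SimplexFrame v u) : Function.Injective v := by
  intro k l hkl
  by_contra hne
  have h1 := h.dual_sub l k k
  have h2 := h.dual_sub l k l
  rw [hkl, h2] at h1
  simp [hne, Ne.symm hne] at h1

lemma SimplexFrame.positivelySpans (h : SimplexFrame v u) : PositivelySpans (Set.range v) := by
  intro m hm
  by_contra hall
  push Not at hall
  refine hm (h.ext m fun k => ?_)
  have h0 : ∑ k, m (v k) = 0 := by rw [← map_sum, h.sum_eq, map_zero]
  exact (Finset.sum_eq_zero_iff_of_nonneg fun k _ => hall _ ⟨k, rfl⟩).1 h0 k (Finset.mem_univ k)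

lemma mem_dualMonoid_simplexCone {i : Fin (d + 1)} {m : Module.Dual ℤ N} :
    m ∈ dualMonoid (simplexCone v i) ↔ ∀ k, k ≠ i → 0 ≤ m (v k) := by
  rw [simplexCone, mem_dualMonoid_hull]
  exact Set.forall_mem_image

lemma SimplexFrame.sub_mem_dualMonoid (h : SimplexFrame v u) (i j : Fin (d + 1)) :
    u j - u i ∈ dualMonoid (simplexCone v i) := by
  refine mem_dualMonoid_simplexCone.2 fun k hk => ?_
  rw [h.dual_sub, if_neg hk.symm]
  split_ifs <;> norm_num

/-- The rank `0` is excluded: there the frame consists of the vector `0`, which is not a ray. -/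
lemma SimplexFrame.isRaySet (h : SimplexFrame v u) (hd : d ≠ 0) :
    IsRaySet (Set.range v) (simplexCone v) where
  hull i := ⟨_, Set.image_subset_range _ _, rfl⟩
  facet := by
    rintro _ ⟨k, rfl⟩
    obtain ⟨i, hi⟩ : ∃ i, i ≠ k := by
      have : Nontrivial (Fin (d + 1)) := Fin.nontrivial_iff_two_le.2 (by omega)
      exact exists_ne k
    refine ⟨i, toReal_mem_hull ⟨k, hi.symm, rfl⟩,
      ⟨u k - u i, h.sub_mem_dualMonoid i k, by rw [h.dual_sub]; simp [hi]⟩,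
      fun n hn => ⟨n (u k - u i), LinearMap.ext fun m => ?_⟩⟩
    conv_lhs => rw [← h.expand i m]
    rw [map_sum, Finset.sum_eq_single k]
    · rw [map_smul, LinearMap.smul_apply, evalComplex_apply, zsmul_eq_mul, smul_eq_mul, mul_comm]
    · intro j _ hj
      rw [map_smul, hn _ (h.sub_mem_dualMonoid i j) (by rw [h.dual_sub]; simp [hj, hi]), smul_zero]
    · simp

lemma SimplexFrame.isRootPair (h : SimplexFrame v u) {i j : Fin (d + 1)} (hij : i ≠ j) :
    IsRootPair (Set.range v) (u j - u i) (v i) (v j) := by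
  refine ⟨⟨i, rfl⟩, ⟨j, rfl⟩, h.injective.ne hij, by simp [h.dual_sub, hij.symm],
    by simp [h.dual_sub, hij], ?_⟩
  rintro _ ⟨k, rfl⟩ hki hkj
  rw [h.dual_sub, if_neg (fun h' => hkj (by rw [h'])), if_neg (fun h' => hki (by rw [h'])), sub_zero]

/-- The roots of the fan of `ℙᵈ` are the differences of the coordinates. -/
lemma SimplexFrame.rootsOf_eq (h : SimplexFrame v u) : rootsOf (Set.range v) =
    (fun p : Fin (d + 1) × Fin (d + 1) => u p.2 - u p.1) ''
      ((Finset.univ : Finset (Fin (d + 1))).offDiag : Set (Fin (d + 1) × Fin (d + 1))) := by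
  classical
  ext m
  constructor
  · rintro ⟨_, ⟨i, rfl⟩, hi, hk⟩
    have h0 : ∑ k, m (v k) = 0 := by rw [← map_sum, h.sum_eq, map_zero]
    have hpos : ∀ k ∈ Finset.univ.erase i, 0 ≤ m (v k) := fun k hki =>
      hk _ ⟨k, rfl⟩ (h.injective.ne (Finset.ne_of_mem_erase hki))
    rw [← Finset.add_sum_erase _ _ (Finset.mem_univ i), hi] at h0
    have h1 : ∑ k ∈ Finset.univ.erase i, m (v k) = 1 := by omega
    obtain ⟨j, hj, hj0⟩ : ∃ j ∈ Finset.univ.erase i, m (v j) ≠ 0 := by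
      by_contra hall
      push Not at hall
      rw [Finset.sum_eq_zero hall] at h1
      exact zero_ne_one h1
    rw [← Finset.add_sum_erase _ _ hj] at h1
    have h2 := hpos j hj
    have h3 : ∀ k ∈ (Finset.univ.erase i).erase j, 0 ≤ m (v k) := fun k hk' =>
      hpos k (Finset.mem_of_mem_erase hk')
    have h4 := Finset.sum_nonneg h3
    have h5 := (Finset.sum_eq_zero_iff_of_nonneg h3).1 (by omega)
    have hij := Finset.ne_of_mem_erase hj
    refine ⟨(i, j), by simpa using hij.symm, (sub_eq_zero.1 (h.ext _ fun k => ?_))⟩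
    rw [LinearMap.sub_apply, h.dual_sub]
    by_cases hki : k = i
    · subst hki
      simp [hi, hij]
    by_cases hkj : k = j
    · subst hkj
      rw [if_pos rfl, if_neg (Ne.symm hki)]
      omega
    · rw [if_neg (Ne.symm hki), if_neg (Ne.symm hkj), h5 k (by simp [hki, hkj])]
      norm_num
  · rintro ⟨⟨i, j⟩, hij, rfl⟩
    exact (h.isRootPair (by simpa using hij)).mem_rootsOf

lemma SimplexFrame.encard_rootsOf (h : SimplexFrame v u) :
    (rootsOf (Set.range v)).encard = ((d ^ 2 + d : ℕ) : ℕ∞) := by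
  classical
  rw [h.rootsOf_eq, Set.InjOn.encard_image, Set.encard_coe_eq_coe_finsetCard,
    Finset.offDiag_card]
  · congr 1
    simp only [Finset.card_univ, Fintype.card_fin]
    have : (d + 1) * (d + 1) = d ^ 2 + d + (d + 1) := by ring
    omega
  · rintro ⟨i, j⟩ hij ⟨i', j'⟩ hij' heq
    have hij : i ≠ j := by simpa using hij
    have hij' : i' ≠ j' := by simpa using hij'
    have heq : u j - u i = u j' - u i' := heq
    have h1 := (h.isRootPair hij)
    have h2 := (h.isRootPair hij')
    rw [← heq] at h2
    have h3 := h.injective (h1.left_unique h2)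
    subst h3
    have h4 := h.dual_sub i j j
    rw [heq, h.dual_sub, if_pos rfl, if_neg hij] at h4
    by_cases hjj : j' = j
    · rw [hjj]
    · rw [if_neg hjj] at h4
      norm_num at h4

lemma SimplexFrame.corootsSpan (h : SimplexFrame v u) : CorootsSpan (Set.range v) := by
  rw [CorootsSpan]
  set C := Submodule.span ℂ {x | ∃ s w w', IsRootPair (Set.range v) s w w' ∧
    x = evalComplex w' - evalComplex w} with hC
  have h1 : ∀ i j, evalComplex (v j) - evalComplex (v i) ∈ C := fun i j => by
    by_cases hij : i = j
    · rw [hij, sub_self]; exact Submodule.zero_mem _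
    · exact Submodule.subset_span ⟨_, _, _, h.isRootPair hij, rfl⟩
  have h2 : ∀ i, evalComplex (v i) ∈ C := fun i => by
    have h3 : ∑ j, (evalComplex (v j) - evalComplex (v i)) ∈ C :=
      Submodule.sum_mem _ fun j _ => h1 i j
    rw [Finset.sum_sub_distrib, ← map_sum, h.sum_eq, map_zero, zero_sub, Finset.sum_const,
      Finset.card_univ, Fintype.card_fin] at h3
    have h4 : evalComplex (v i) = (-((d + 1 : ℕ) : ℂ)⁻¹) •
        -((d + 1) • evalComplex (v i)) := by
      rw [smul_neg, neg_smul, neg_neg, ← Nat.cast_smul_eq_nsmul ℂ, smul_smul, inv_mul_cancel₀,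
        one_smul]
      exact_mod_cast Nat.succ_ne_zero d
    rw [h4]
    exact Submodule.smul_mem _ _ h3
  refine eq_top_iff.2 fun n _ => ?_
  have h5 : n = ∑ k, n (u k - u 0) • evalComplex (v k) := LinearMap.ext fun m => by
    conv_lhs => rw [← h.expand 0 m]
    rw [map_sum, LinearMap.sum_apply]
    refine Finset.sum_congr rfl fun k _ => ?_
    rw [map_smul, LinearMap.smul_apply, evalComplex_apply, zsmul_eq_mul, smul_eq_mul, mul_comm]
  rw [h5]
  exact Submodule.sum_mem _ fun k _ => Submodule.smul_mem _ _ (h2 k)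

end Simplex

section Orthant

variable {d : ℕ} {e : Fin d → N} {f : Fin d → Module.Dual ℤ N}

lemma chartSign_eq_or (a : Fin 2) : chartSign a = 1 ∨ chartSign a = -1 := by
  fin_cases a <;> simp [chartSign]

/-- The set of the vectors `± e i`. -/
def orthantRays (e : Fin d → N) : Set N := {x | ∃ i, ∃ a : Fin 2, x = chartSign a • e i}

lemma mem_dualMonoid_orthantCone {ε : Fin d → Fin 2} {m : Module.Dual ℤ N} :
    m ∈ dualMonoid (orthantCone e ε) ↔ ∀ i, 0 ≤ chartSign (ε i) * m (e i) := by
  rw [orthantCone, mem_dualMonoid_hull]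
  simp

lemma OrthantFrame.smul_mem_dualMonoid (h : OrthantFrame e f) (ε : Fin d → Fin 2) (i : Fin d) :
    chartSign (ε i) • f i ∈ dualMonoid (orthantCone e ε) := by
  refine mem_dualMonoid_orthantCone.2 fun j => ?_
  rw [LinearMap.smul_apply, h.dual, smul_eq_mul]
  split_ifs with hij
  · rw [hij, mul_one, chartSign_mul_self]; norm_num
  · simp

lemma OrthantFrame.positivelySpans (h : OrthantFrame e f) : PositivelySpans (orthantRays e) := by
  intro m hm
  obtain ⟨i, hi⟩ : ∃ i, m (e i) ≠ 0 := by
    by_contra hall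
    push Not at hall
    exact hm (h.ext m hall)
  rcases lt_or_gt_of_ne hi with hi | hi
  · exact ⟨_, ⟨i, 0, rfl⟩, by simpa [chartSign] using hi⟩
  · exact ⟨_, ⟨i, 1, rfl⟩, by simpa [chartSign] using hi⟩

lemma OrthantFrame.isRaySet (h : OrthantFrame e f) :
    IsRaySet (orthantRays e) (orthantCone e) where
  hull ε := ⟨_, by rintro _ ⟨i, rfl⟩; exact ⟨i, ε i, rfl⟩, rfl⟩
  facet := by
    rintro _ ⟨i, a, rfl⟩
    refine ⟨fun _ => a, toReal_mem_hull ⟨i, rfl⟩,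
      ⟨chartSign a • f i, h.smul_mem_dualMonoid (fun _ => a) i, by
        simp [h.dual, chartSign_mul_self]⟩,
      fun n hn => ⟨chartSign a * n (f i), LinearMap.ext fun m => ?_⟩⟩
    have hz : ∀ j ≠ i, n (f j) = 0 := fun j hj => by
      have h1 := hn _ (h.smul_mem_dualMonoid (fun _ => a) j) (by simp [h.dual, hj])
      rw [map_smul] at h1
      rcases chartSign_eq_or a with ha | ha <;> rw [ha] at h1 <;> simpa using h1
    conv_lhs => rw [← h.expand m]
    rw [map_sum, Finset.sum_eq_single i]
    · rw [map_smul, LinearMap.smul_apply, evalComplex_apply, zsmul_eq_mul, smul_eq_mul, map_smul,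
        smul_eq_mul]
      have h2 : (chartSign a : ℂ) * chartSign a = 1 := by exact_mod_cast chartSign_mul_self a
      push_cast
      linear_combination (-(m (e i) : ℂ) * n (f i)) * h2
    · intro j _ hj
      rw [map_smul, hz j hj, smul_zero]
    · simp

lemma OrthantFrame.smul_injective (h : OrthantFrame e f) :
    Function.Injective fun p : Fin d × Fin 2 => chartSign p.2 • f p.1 := by
  rintro ⟨i, a⟩ ⟨j, b⟩ hij
  have h1 := LinearMap.congr_fun hij (e i)
  simp only [LinearMap.smul_apply, h.dual, if_true, smul_eq_mul, mul_one] at h1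
  by_cases hji : j = i
  · subst hji
    rw [if_pos rfl, mul_one] at h1
    fin_cases a <;> fin_cases b <;> simp [chartSign] at h1 ⊢
  · rw [if_neg hji, mul_zero] at h1
    rcases chartSign_eq_or a with ha | ha <;> rw [ha] at h1 <;> norm_num at h1

lemma OrthantFrame.isRootPair (h : OrthantFrame e f) (i : Fin d) (a : Fin 2) :
    IsRootPair (orthantRays e) (chartSign a • f i) (-(chartSign a • e i)) (chartSign a • e i) := by
  have hneg : ∀ a : Fin 2, ∃ b : Fin 2, chartSign b = -chartSign a := fun a => by
    fin_cases a
    · exact ⟨1, by simp [chartSign]⟩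
    · exact ⟨0, by simp [chartSign]⟩
  have hval : (chartSign a • f i) (chartSign a • e i) = 1 := by
    simp [h.dual, chartSign_mul_self]
  obtain ⟨b, hb⟩ := hneg a
  refine ⟨⟨i, b, by rw [hb, neg_smul]⟩, ⟨i, a, rfl⟩, fun heq => ?_, by rw [map_neg, hval], hval, ?_⟩
  · have h1 := congrArg (chartSign a • f i) heq
    rw [map_neg, hval] at h1
    norm_num at h1
  · rintro _ ⟨j, c, rfl⟩ h1 h2
    by_cases hij : i = j
    · subst hij
      exfalso
      fin_cases a <;> fin_cases c <;> simp [chartSign] at h1 h2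
    · simp [h.dual, hij]

/-- The roots of the fan of `(ℙ¹)ᵈ` are the coordinates and their negatives. -/
lemma OrthantFrame.rootsOf_eq (h : OrthantFrame e f) :
    rootsOf (orthantRays e) = Set.range fun p : Fin d × Fin 2 => chartSign p.2 • f p.1 := by
  ext m
  constructor
  · rintro ⟨_, ⟨i, a, rfl⟩, hm, hm'⟩
    have hz : ∀ j ≠ i, m (e j) = 0 := fun j hj => by
      have hne : ∀ c : Fin 2, chartSign c • e j ≠ chartSign a • e i := fun c heq => by
        have h1 := congrArg (f i) heq
        rw [map_smul, map_smul, h.dual, h.dual, if_neg hj.symm, if_pos rfl] at h1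
        rcases chartSign_eq_or a with ha | ha <;> rw [ha] at h1 <;> simp at h1
      have h1 := hm' _ ⟨j, 0, rfl⟩ (hne 0)
      have h2 := hm' _ ⟨j, 1, rfl⟩ (hne 1)
      simp [chartSign] at h1 h2
      omega
    have hneg : ∃ b : Fin 2, chartSign b = -chartSign a := by
      fin_cases a
      · exact ⟨1, by simp [chartSign]⟩
      · exact ⟨0, by simp [chartSign]⟩
    obtain ⟨b, hb⟩ := hneg
    refine ⟨(i, b), ?_⟩
    change chartSign b • f i = m
    rw [← h.expand m, Finset.sum_eq_single i]
    · congr 1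
      rw [map_smul, smul_eq_mul] at hm
      rcases chartSign_eq_or a with ha | ha <;> rw [ha] at hm hb <;> omega
    · intro j _ hj
      rw [hz j hj, zero_smul]
    · simp
  · rintro ⟨⟨i, a⟩, rfl⟩
    exact (h.isRootPair i a).mem_rootsOf

lemma OrthantFrame.encard_rootsOf (h : OrthantFrame e f) :
    (rootsOf (orthantRays e)).encard = ((2 * d : ℕ) : ℕ∞) := by
  rw [h.rootsOf_eq, ← Set.image_univ, h.smul_injective.encard_image, Set.encard_univ]
  simp [mul_comm]

lemma OrthantFrame.corootsSpan (h : OrthantFrame e f) : CorootsSpan (orthantRays e) := by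
  refine eq_top_iff.2 fun n _ => ?_
  have h5 : n = ∑ k, (n (f k) / 2) • (evalComplex (chartSign 0 • e k) -
      evalComplex (-(chartSign 0 • e k))) := LinearMap.ext fun m => by
    conv_lhs => rw [← h.expand m]
    rw [map_sum, LinearMap.sum_apply]
    refine Finset.sum_congr rfl fun k _ => ?_
    simp only [map_smul, LinearMap.smul_apply, evalComplex_apply, zsmul_eq_mul, smul_eq_mul,
      LinearMap.sub_apply, LinearMap.neg_apply, map_neg, chartSign, if_true, one_smul]
    ring
  rw [h5]
  exact Submodule.sum_mem _ fun k _ => Submodule.smul_mem _ _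
    (Submodule.subset_span ⟨_, _, _, h.isRootPair k 0, rfl⟩)

end Orthant

end FrameRays

/-! ### Recognition of a toric variety by an atlas -/

section Gluing

variable {N : Type} [AddCommGroup N]

/-- The open immersion of the chart `U_τ` into the toric variety. -/
noncomputable def Fan.chart (Δ : Fan N) (τ : Δ.cones) : affineChart τ.1 ⟶ Δ.toricVariety :=
  colimit.ι Δ.chartFunctor τ

instance (Δ : Fan N) (τ : Δ.cones) : IsOpenImmersion (Δ.chart τ) :=
  inferInstanceAs (IsOpenImmersion (colimit.ι Δ.chartFunctor τ))

lemma Fan.chartMap_chart (Δ : Fan N) {τ ρ : Δ.cones} (h : τ.1 ≤ ρ.1) :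
    affineChartMap h ≫ Δ.chart ρ = Δ.chart τ :=
  colimit.w Δ.chartFunctor (homOfLE (show τ ≤ ρ from h))

lemma Fan.chart_str (Δ : Fan N) (τ : Δ.cones) :
    Δ.chart τ ≫ Δ.toricVarietyStr = affineChartStr τ.1 :=
  colimit.ι_desc _ _

lemma Fan.exists_chart_eq (Δ : Fan N) (x : Δ.toricVariety) : ∃ τ y, Δ.chart τ y = x :=
  Scheme.IsLocallyDirected.ι_jointly_surjective Δ.chartFunctor x

lemma Fan.toricVariety_hom_ext (Δ : Fan N) {Z : Scheme.{0}} {f g : Δ.toricVariety ⟶ Z}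
    (h : ∀ τ, Δ.chart τ ≫ f = Δ.chart τ ≫ g) : f = g := colimit.hom_ext h

/-- Compatible morphisms from the charts glue to a morphism from the toric variety. -/
lemma Fan.exists_desc (Δ : Fan N) {Z : Scheme.{0}} (g : ∀ τ : Δ.cones, affineChart τ.1 ⟶ Z)
    (h : ∀ (τ ρ : Δ.cones) (h : τ.1 ≤ ρ.1), affineChartMap h ≫ g ρ = g τ) :
    ∃ f : Δ.toricVariety ⟶ Z, ∀ τ, Δ.chart τ ≫ f = g τ :=
  ⟨colimit.desc Δ.chartFunctor
    { pt := Z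
      ι :=
        { app := g
          naturality := fun τ ρ a => (h τ ρ (leOfHom a)).trans (Category.comp_id _).symm } },
    fun _ => colimit.ι_desc _ _⟩

/-- The toric variety of a fan has the atlas of all the charts of the cones of the fan. -/
noncomputable def Fan.toricAtlas (Δ : Fan N) (h : ⊥ ∈ Δ.cones) :
    ToricAtlas Δ.toricVarietyOver (fun σ : Δ.cones => σ.1) where
  torus := Δ.chart ⟨⊥, h⟩
  chart := Δ.chart
  isOpenImmersion_torus := inferInstanceAs (IsOpenImmersion (Δ.chart ⟨⊥, h⟩))
  isOpenImmersion_chart τ := inferInstanceAs (IsOpenImmersion (Δ.chart τ))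
  torus_over := Δ.chart_str _
  fac _ := Δ.chartMap_chart (τ := ⟨⊥, h⟩) bot_le
  covers := Δ.exists_chart_eq

variable {Y : Over (Spec (CommRingCat.of ℂ))} {ι : Type} {σ : ι → PointedCone ℝ (ℝ ⊗[ℤ] N)}

/-- The charts of a toric atlas are morphisms over `ℂ`, since they are so on the torus. -/
lemma ToricAtlas.chart_over (𝒜 : ToricAtlas Y σ) (i : ι) :
    𝒜.chart i ≫ Y.hom = affineChartStr (σ i) := by
  obtain ⟨b, hb⟩ : ∃ b : CommRingCat.of ℂ ⟶ CommRingCat.of (coordRing (σ i)),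
    Spec.map b = 𝒜.chart i ≫ Y.hom := ⟨Spec.preimage _, Spec.map_preimage _⟩
  have h1 : affineChartMap (bot_le : ⊥ ≤ σ i) ≫ Spec.map b =
      affineChartMap bot_le ≫ affineChartStr (σ i) := by
    rw [hb, ← Category.assoc, 𝒜.fac, 𝒜.torus_over, affineChartMap_str]
  rw [affineChartMap, affineChartStr, ← Spec.map_comp, ← Spec.map_comp] at h1
  have h2 := Spec.map_injective h1
  rw [← hb, affineChartStr]
  congr 1
  refine CommRingCat.hom_ext (RingHom.ext fun c => ?_)
  exact coordMap_injective (bot_le : ⊥ ≤ σ i) (congrArg (fun f => f.hom c) h2)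

/-- A variety with an atlas by the maximal cones of a fan is the toric variety of the fan. The
inverse images of the charts are right because `χ^m` and `χ^{-m}` are regular on the two charts
when `m` separates the two cones. -/
theorem Fan.nonempty_iso_of_atlas [Module.Free ℤ N] (Δ : Fan N) (𝒜 : ToricAtlas Y σ)
    (hσ : ∀ i, σ i ∈ Δ.cones) (hmax : ∀ τ ∈ Δ.cones, ∃ i, τ ≤ σ i)
    (hsep : ∀ i j, ∃ m ∈ dualMonoid (σ i), -m ∈ dualMonoid (σ j) ∧
      ∀ x ∈ σ i, pairing m x = 0 → x ∈ σ j)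
    (hext : ∀ (τ : PointedCone ℝ (ℝ ⊗[ℤ] N)) (g g' : affineChart τ ⟶ Y.left),
      g ≫ Y.hom = affineChartStr τ → g' ≫ Y.hom = affineChartStr τ →
      affineChartMap (bot_le : ⊥ ≤ τ) ≫ g = affineChartMap bot_le ≫ g' → g = g') :
    Nonempty (Δ.toricVarietyOver ≅ Y) := by
  have _ := 𝒜.isOpenImmersion_chart
  choose c hc using fun τ : Δ.cones => hmax τ.1 τ.2
  let g : ∀ τ : Δ.cones, affineChart τ.1 ⟶ Y.left := fun τ =>
    affineChartMap (hc τ) ≫ 𝒜.chart (c τ)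
  have hg : ∀ τ, g τ ≫ Y.hom = affineChartStr τ.1 := fun τ => by
    rw [Category.assoc, 𝒜.chart_over, affineChartMap_str]
  have hg' : ∀ τ : Δ.cones, affineChartMap (bot_le : ⊥ ≤ τ.1) ≫ g τ = 𝒜.torus := fun τ => by
    rw [← Category.assoc, affineChartMap_comp, 𝒜.fac]
  obtain ⟨f, hf⟩ := Δ.exists_desc g fun τ ρ h => hext τ.1 _ _
    (by rw [Category.assoc, hg, affineChartMap_str]) (hg τ)
    (by rw [← Category.assoc, affineChartMap_comp, hg', hg'])
  have hfσ : ∀ i, Δ.chart ⟨σ i, hσ i⟩ ≫ f = 𝒜.chart i := fun i => by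
    rw [hf]
    exact hext _ _ _ (hg _) (𝒜.chart_over i) (by rw [hg', 𝒜.fac])
  have hw : f ≫ Y.hom = Δ.toricVarietyStr := Δ.toricVariety_hom_ext fun τ => by
    rw [← Category.assoc, hf, hg, Δ.chart_str]
  have hpre : ∀ i, Set.range (Δ.chart ⟨σ i, hσ i⟩) =
      Set.range (f ⁻¹ᵁ (𝒜.chart i).opensRange).ι := fun i => by
    rw [Scheme.Opens.range_ι]
    ext x
    constructor
    · rintro ⟨y, rfl⟩
      exact ⟨y, by rw [← hfσ i]; rfl⟩
    · rintro ⟨y, hy⟩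
      obtain ⟨τ, z, rfl⟩ := Δ.exists_chart_eq x
      obtain ⟨j, hj⟩ := hmax τ.1 τ.2
      let x' : affineChart (σ j) := affineChartMap hj z
      have hx' : Δ.chart ⟨σ j, hσ j⟩ x' = Δ.chart τ z := by
        rw [← Δ.chartMap_chart (ρ := ⟨σ j, hσ j⟩) hj]
        rfl
      rw [← hx'] at hy ⊢
      have hy' : 𝒜.chart j x' = 𝒜.chart i y := by
        rw [hy, ← hfσ j]
        rfl
      obtain ⟨m, hm, hm', hmx⟩ := hsep j i
      have hface : ∀ x, x ∈ σ j ⊓ σ i ↔ x ∈ σ j ∧ pairing m x = 0 := fun x => by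
        refine ⟨fun hx => ⟨hx.1, le_antisymm ?_ (hm x hx.1)⟩, fun hx => ⟨hx.1, hmx x hx.1 hx.2⟩⟩
        have h1 := hm' x hx.2
        have h2 : pairing (-m) x + pairing m x = 0 := by rw [← pairing_add]; simp [pairing_zero]
        linarith
      have hbasic := mem_basicOpen_of_mul_eq_one 𝒜.generic 𝒜.generic_specializes (𝒜.chart j)
        (chartToField (σ j)).toRingHom (𝒜.chart_generic j) (chartToField_injective _) (𝒜.chart i)
        (chartToField (σ i)).toRingHom (𝒜.chart_generic i)
        (a := AddMonoidAlgebra.single (⟨m, hm⟩ : dualMonoid (σ j)) 1)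
        (b := AddMonoidAlgebra.single (⟨-m, hm'⟩ : dualMonoid (σ i)) 1) (by
          change torusToField (coordToTorus _ _) * torusToField (coordToTorus _ _) = 1
          rw [coordToTorus_single, coordToTorus_single]
          change chi m * chi (-m) = 1
          rw [← chi_add, add_neg_cancel, chi_zero]) hy'
      have hrange := range_affineChartMap (Δ.rational _ (hσ j)) (inf_le_left : σ j ⊓ σ i ≤ σ j) hm
        hface
      obtain ⟨w, hw⟩ : x' ∈ Set.range (affineChartMap (inf_le_left : σ j ⊓ σ i ≤ σ j)) := by
        rw [hrange]
        exact hbasic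
      let ρ : Δ.cones := ⟨σ j ⊓ σ i, Δ.face_mem _ (hσ j) _ (Δ.inter_face _ (hσ j) _ (hσ i)).1⟩
      refine ⟨affineChartMap (inf_le_right : σ j ⊓ σ i ≤ σ i) w, ?_⟩
      have h1 := Δ.chartMap_chart (τ := ρ) (ρ := ⟨σ i, hσ i⟩) inf_le_right
      have h2 := Δ.chartMap_chart (τ := ρ) (ρ := ⟨σ j, hσ j⟩) inf_le_left
      rw [← hw]
      exact congrArg (fun a : affineChart ρ.1 ⟶ Δ.toricVariety => a w) (h1.trans h2.symm)
  have hiso : IsIso f := by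
    refine IsZariskiLocalAtTarget.of_iSup_eq_top (P := MorphismProperty.isomorphisms Scheme)
      (fun i => (𝒜.chart i).opensRange) ?_ fun i => ?_
    · refine top_le_iff.1 fun y _ => ?_
      obtain ⟨i, x, rfl⟩ := 𝒜.covers y
      exact TopologicalSpace.Opens.mem_iSup.2 ⟨i, x, rfl⟩
    · let a := IsOpenImmersion.isoOfRangeEq (Δ.chart ⟨σ i, hσ i⟩)
        (f ⁻¹ᵁ (𝒜.chart i).opensRange).ι (hpre i)
      let b := IsOpenImmersion.isoOfRangeEq (𝒜.chart i) (𝒜.chart i).opensRange.ι (by simp)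
      have hab : f ∣_ (𝒜.chart i).opensRange = a.inv ≫ b.hom := by
        rw [← cancel_mono (𝒜.chart i).opensRange.ι, morphismRestrict_ι, Category.assoc,
          IsOpenImmersion.isoOfRangeEq_hom_fac]
        have h1 : a.inv ≫ Δ.chart ⟨σ i, hσ i⟩ = (f ⁻¹ᵁ (𝒜.chart i).opensRange).ι :=
          IsOpenImmersion.isoOfRangeEq_inv_fac _ _ _
        refine (congrArg (· ≫ f) h1).symm.trans ?_
        exact (Category.assoc _ _ _).trans (congrArg (a.inv ≫ ·) (hfσ i))
      rw [MorphismProperty.isomorphisms.iff, hab]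
      infer_instance
  exact ⟨Over.isoMk (@asIso _ _ _ _ f hiso) hw⟩

end Gluing

/-! ### Coordinate rings of the charts of `ℙᵈ` -/

section ProjectiveSpace

open HomogeneousLocalization

variable {N : Type} [AddCommGroup N] {d : ℕ}

attribute [local instance] MvPolynomial.gradedAlgebra

/-- The standard grading of the homogeneous coordinate ring of `ℙᵈ`. -/
noncomputable abbrev polyGrading (d : ℕ) : ℕ → Submodule ℂ (MvPolynomial (Fin (d + 1)) ℂ) :=
  MvPolynomial.homogeneousSubmodule (Fin (d + 1)) ℂ

lemma X_mem_polyGrading (k : Fin (d + 1)) :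
    (MvPolynomial.X k : MvPolynomial (Fin (d + 1)) ℂ) ∈ polyGrading d 1 :=
  MvPolynomial.isHomogeneous_X ℂ k

/-- The monomial `χ^m` as a function on the torus. -/
noncomputable def torusMonomial (m : Module.Dual ℤ N) :
    coordRing (⊥ : PointedCone ℝ (ℝ ⊗[ℤ] N)) :=
  AddMonoidAlgebra.single ⟨m, mem_dualMonoid_bot m⟩ 1

lemma torusMonomial_add (m m' : Module.Dual ℤ N) :
    torusMonomial (m + m') = torusMonomial m * torusMonomial m' := by
  rw [torusMonomial, torusMonomial, torusMonomial, AddMonoidAlgebra.single_mul_single, one_mul]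
  rfl

lemma torusMonomial_zero : torusMonomial (0 : Module.Dual ℤ N) = 1 := rfl

lemma torusMonomial_nsmul (n : ℕ) (m : Module.Dual ℤ N) :
    torusMonomial (n • m) = torusMonomial m ^ n := by
  induction n with
  | zero => rw [zero_smul, pow_zero, torusMonomial_zero]
  | succ n ih => rw [succ_nsmul, torusMonomial_add, ih, pow_succ]

lemma torusMonomial_sum {ι : Type*} (s : Finset ι) (m : ι → Module.Dual ℤ N) :
    torusMonomial (∑ i ∈ s, m i) = ∏ i ∈ s, torusMonomial (m i) := by
  classical
  induction s using Finset.induction_on with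
  | empty => simp [torusMonomial_zero]
  | insert a s ha ih => rw [Finset.sum_insert ha, Finset.prod_insert ha, torusMonomial_add, ih]

lemma isUnit_torusMonomial (m : Module.Dual ℤ N) : IsUnit (torusMonomial m) :=
  IsUnit.of_mul_eq_one (torusMonomial (-m)) (by
    rw [← torusMonomial_add, add_neg_cancel, torusMonomial_zero])

variable (u : Fin (d + 1) → Module.Dual ℤ N)

/-- The homomorphism `x_k ↦ χ^{u_k}` from the homogeneous coordinate ring of `ℙᵈ` to the coordinate
ring of the torus. -/
noncomputable def polyToTorus :
    MvPolynomial (Fin (d + 1)) ℂ →ₐ[ℂ] coordRing (⊥ : PointedCone ℝ (ℝ ⊗[ℤ] N)) :=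
  MvPolynomial.aeval fun k => torusMonomial (u k)

lemma polyToTorus_X (k : Fin (d + 1)) : polyToTorus u (MvPolynomial.X k) = torusMonomial (u k) :=
  MvPolynomial.aeval_X _ _

/-- The homomorphism from the degree zero part of a localization of the homogeneous coordinate ring
to the coordinate ring of the torus. -/
noncomputable def awayToTorus (f : MvPolynomial (Fin (d + 1)) ℂ)
    (hf : IsUnit ((polyToTorus u).toRingHom f)) :
    Away (polyGrading d) f →+* coordRing (⊥ : PointedCone ℝ (ℝ ⊗[ℤ] N)) :=
  (IsLocalization.Away.lift (S := Localization.Away f) f hf).comp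
    (algebraMap (Away (polyGrading d) f) (Localization.Away f))

/-- The values of `awayToTorus` at a fraction `z = b / a`. -/
lemma awayToTorus_mul {f : MvPolynomial (Fin (d + 1)) ℂ}
    (hf : IsUnit ((polyToTorus u).toRingHom f)) {z : Away (polyGrading d) f}
    {a b : MvPolynomial (Fin (d + 1)) ℂ}
    (h : z.val * algebraMap _ (Localization.Away f) a = algebraMap _ _ b) :
    awayToTorus u f hf z * polyToTorus u a = polyToTorus u b := by
  have h1 := congrArg (IsLocalization.Away.lift (S := Localization.Away f) f hf) h
  rw [map_mul, IsLocalization.Away.lift_eq, IsLocalization.Away.lift_eq] at h1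
  exact h1

lemma awayToTorus_awayMap {f g : MvPolynomial (Fin (d + 1)) ℂ} {e : ℕ} (hg : g ∈ polyGrading d e)
    {x : MvPolynomial (Fin (d + 1)) ℂ} (hx : x = f * g)
    (hf : IsUnit ((polyToTorus u).toRingHom f)) (hxu : IsUnit ((polyToTorus u).toRingHom x)) :
    (awayToTorus u x hxu).comp (awayMap (polyGrading d) hg hx) = awayToTorus u f hf := by
  refine RingHom.ext fun a => ?_
  change IsLocalization.Away.lift x hxu (awayMap (polyGrading d) hg hx a).val =
    IsLocalization.Away.lift f hf a.val
  rw [val_awayMap]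
  generalize a.val = b
  refine DFunLike.congr_fun (f := (IsLocalization.Away.lift x hxu).comp
    (Localization.awayLift (algebraMap _ (Localization (Submonoid.powers x))) f _)) ?_ b
  refine IsLocalization.ringHom_ext (Submonoid.powers f) (RingHom.ext fun c => ?_)
  rw [RingHom.comp_apply, RingHom.comp_apply, RingHom.comp_apply, IsLocalization.Away.lift_eq,
    IsLocalization.Away.lift_eq]
  exact (IsLocalization.Away.lift_eq (S := Localization.Away f) f hf c).symm

/-- The localization map at `f`. -/
noncomputable abbrev toAway (f : MvPolynomial (Fin (d + 1)) ℂ) :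
    MvPolynomial (Fin (d + 1)) ℂ →+* Localization.Away f := algebraMap _ _

/-- The constants in the degree zero part of a localization. -/
noncomputable def awayConst (f : MvPolynomial (Fin (d + 1)) ℂ) : ℂ →+* Away (polyGrading d) f :=
  (fromZeroRingHom (polyGrading d) (Submonoid.powers f)).comp (algebraMap ℂ (polyGrading d 0))

lemma val_awayConst (f : MvPolynomial (Fin (d + 1)) ℂ) (c : ℂ) :
    (awayConst f c).val = toAway f (MvPolynomial.C c) := by
  rw [← Localization.mk_one_eq_algebraMap]
  rfl

lemma awayToTorus_awayConst {f : MvPolynomial (Fin (d + 1)) ℂ}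
    (hf : IsUnit ((polyToTorus u).toRingHom f)) (c : ℂ) :
    awayToTorus u f hf (awayConst f c) = algebraMap ℂ _ c := by
  have h := awayToTorus_mul u hf (z := awayConst f c) (a := 1) (b := MvPolynomial.C c)
    (by rw [val_awayConst, map_one, mul_one])
  rw [map_one, mul_one] at h
  rw [h]
  exact (polyToTorus u).commutes c

/-- The affine coordinates `x_k / x_i`. -/
noncomputable def awayCoord (i k : Fin (d + 1)) :
    Away (polyGrading d) (MvPolynomial.X i : MvPolynomial (Fin (d + 1)) ℂ) :=
  Away.mk (polyGrading d) (X_mem_polyGrading i) 1 (MvPolynomial.X k)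
    (by rw [one_smul]; exact X_mem_polyGrading k)

lemma val_awayCoord_mul (i k : Fin (d + 1)) :
    (awayCoord i k).val * toAway (MvPolynomial.X i) (MvPolynomial.X i) = toAway (MvPolynomial.X i) (MvPolynomial.X k) := by
  rw [awayCoord, Away.val_mk, ← Localization.mk_one_eq_algebraMap, Localization.mk_mul,
    ← Localization.mk_one_eq_algebraMap, Localization.mk_eq_mk_iff, Localization.r_iff_exists]
  exact ⟨1, by simp [mul_comm]⟩

lemma awayCoord_self (i : Fin (d + 1)) : awayCoord i i = 1 := by
  refine val_injective _ ?_
  have h := val_awayCoord_mul i i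
  have hu : IsUnit (toAway (MvPolynomial.X i) (MvPolynomial.X i)) :=
    IsLocalization.Away.algebraMap_isUnit _
  rw [val_one]
  exact hu.mul_left_injective (h.trans (one_mul _).symm)

lemma isUnit_polyToTorus_X (i : Fin (d + 1)) :
    IsUnit ((polyToTorus u).toRingHom (MvPolynomial.X i)) := by
  change IsUnit (polyToTorus u (MvPolynomial.X i))
  rw [polyToTorus_X]
  exact isUnit_torusMonomial _

lemma awayToTorus_awayCoord (i k : Fin (d + 1)) :
    awayToTorus u _ (isUnit_polyToTorus_X u i) (awayCoord i k) = torusMonomial (u k - u i) := by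
  have h := awayToTorus_mul u (isUnit_polyToTorus_X u i) (val_awayCoord_mul i k)
  rw [polyToTorus_X, polyToTorus_X] at h
  refine (isUnit_torusMonomial (u i)).mul_left_injective ?_
  change _ * torusMonomial (u i) = torusMonomial (u k - u i) * torusMonomial (u i)
  rw [h, ← torusMonomial_add, sub_add_cancel]

variable {u} {v : Fin (d + 1) → N}

variable (v) in
/-- The homomorphism `χ^m ↦ ∏ (x_k / x_i)^{⟨v_k, m⟩}` from the coordinate ring of the chart of the
`i`-th maximal cone to the coordinate ring of the `i`-th standard chart of `ℙᵈ`. -/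
noncomputable def coordToAway (i : Fin (d + 1)) :
    coordRing (simplexCone v i) →+* Away (polyGrading d) (MvPolynomial.X i) :=
  AddMonoidAlgebra.liftNCRingHom (awayConst _)
    { toFun := fun m => ∏ k, awayCoord i k ^ (m.toAdd.1 (v k)).toNat
      map_one' := by
        refine Finset.prod_eq_one fun k _ => ?_
        change awayCoord i k ^ ((0 : Module.Dual ℤ N) (v k)).toNat = 1
        simp
      map_mul' := fun m m' => by
        rw [← Finset.prod_mul_distrib]
        refine Finset.prod_congr rfl fun k _ => ?_
        by_cases hk : k = i
        · rw [hk, awayCoord_self, one_pow, one_pow, one_pow, one_mul]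
        · rw [← pow_add, ← Int.toNat_add (mem_dualMonoid_simplexCone.1 m.toAdd.2 k hk)
            (mem_dualMonoid_simplexCone.1 m'.toAdd.2 k hk)]
          rfl } fun _ _ => Commute.all _ _

lemma coordToAway_single (i : Fin (d + 1)) (m : dualMonoid (simplexCone v i)) (c : ℂ) :
    coordToAway v i (AddMonoidAlgebra.single m c) =
      awayConst _ c * ∏ k, awayCoord i k ^ (m.1 (v k)).toNat :=
  AddMonoidAlgebra.liftNC_single _ _ _ _

/-- The chart homomorphisms are compatible with the embeddings into the coordinate ring of the torus. -/
lemma SimplexFrame.awayToTorus_coordToAway (h : SimplexFrame v u) (i : Fin (d + 1)) :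
    (awayToTorus u _ (isUnit_polyToTorus_X u i)).comp (coordToAway v i) =
      (coordMap (bot_le : ⊥ ≤ simplexCone v i)).toRingHom := by
  refine RingHom.ext fun a => ?_
  induction a using AddMonoidAlgebra.induction_linear with
  | zero => rw [map_zero, map_zero]
  | add a b ha hb => rw [map_add, map_add, ha, hb]
  | single m c =>
    rw [RingHom.comp_apply, coordToAway_single, map_mul, awayToTorus_awayConst, map_prod]
    have h1 : ∏ k, awayToTorus u _ (isUnit_polyToTorus_X u i)
        (awayCoord i k ^ (m.1 (v k)).toNat) = torusMonomial m.1 := by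
      rw [← h.expand i m.1, torusMonomial_sum]
      refine Finset.prod_congr rfl fun k _ => ?_
      rw [h.expand i m.1, map_pow, awayToTorus_awayCoord, ← torusMonomial_nsmul]
      by_cases hk : k = i
      · rw [hk, sub_self, smul_zero, smul_zero]
      · rw [← natCast_zsmul, Int.toNat_of_nonneg (mem_dualMonoid_simplexCone.1 m.2 k hk)]
    rw [h1]
    change _ = coordMap _ _
    rw [coordMap_single, ← Algebra.smul_def, torusMonomial, AddMonoidAlgebra.smul_single,
      smul_eq_mul, mul_one]
    rfl

/-- A fraction of degree `0` is a combination of monomials in the affine coordinates. -/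
lemma SimplexFrame.coordToAway_surjective (h : SimplexFrame v u) (i : Fin (d + 1)) :
    Function.Surjective (coordToAway v i) := by
  intro z
  obtain ⟨n, x, hx, rfl⟩ := Away.mk_surjective (polyGrading d) (X_mem_polyGrading i) z
  have hu : IsUnit (toAway (MvPolynomial.X i) (MvPolynomial.X i)) :=
    IsLocalization.Away.algebraMap_isUnit _
  have hmon : ∀ a : Fin (d + 1) →₀ ℕ, a.degree = n → ∀ c : ℂ, ∃ y, (coordToAway v i y).val *
      toAway (MvPolynomial.X i)
        (MvPolynomial.X i) ^ n = toAway (MvPolynomial.X i) (MvPolynomial.monomial a c) := by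
    intro a ha c
    have hval : ∀ k ≠ i, (∑ l, a l • (u l - u i)) (v k) = a k := fun k hk => by
      rw [LinearMap.sum_apply, Finset.sum_eq_single k]
      · rw [LinearMap.smul_apply, h.dual_sub, if_pos rfl, if_neg hk.symm]
        simp
      · intro l _ hl
        rw [LinearMap.smul_apply, h.dual_sub, if_neg hl, if_neg hk.symm]
        simp
      · simp
    refine ⟨AddMonoidAlgebra.single ⟨∑ l, a l • (u l - u i),
      mem_dualMonoid_simplexCone.2 fun k hk => by rw [hval k hk]; positivity⟩ c, ?_⟩
    have h1 : ∏ k, awayCoord i k ^ ((∑ l, a l • (u l - u i)) (v k)).toNat =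
        ∏ k, awayCoord i k ^ a k := Finset.prod_congr rfl fun k _ => by
      by_cases hk : k = i
      · rw [hk, awayCoord_self, one_pow, one_pow]
      · rw [hval k hk, Int.toNat_natCast]
    rw [coordToAway_single, h1, val_mul, val_awayConst]
    have h2 : (∏ k, awayCoord i k ^ a k).val = ∏ k, (awayCoord i k).val ^ a k := by
      rw [← HomogeneousLocalization.algebraMap_apply, map_prod]
      exact Finset.prod_congr rfl fun k _ => by
        rw [map_pow, HomogeneousLocalization.algebraMap_apply]
    have hn : n = ∑ k, a k := by rw [← ha, Finsupp.degree_eq_sum]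
    rw [h2, hn, ← Finset.prod_pow_eq_pow_sum, mul_assoc, ← Finset.prod_mul_distrib,
      MvPolynomial.monomial_eq, map_mul, Finsupp.prod_fintype _ _ (fun _ => pow_zero _), map_prod]
    congr 1
    refine Finset.prod_congr rfl fun k _ => ?_
    rw [← mul_pow, val_awayCoord_mul, map_pow]
  have hx' : MvPolynomial.IsHomogeneous x n := by
    have : x ∈ polyGrading d (n • 1) := hx
    rwa [smul_eq_mul, mul_one] at this
  have hsum : ∀ s : Finset (Fin (d + 1) →₀ ℕ), s ⊆ x.support → ∃ y, (coordToAway v i y).val *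
      toAway (MvPolynomial.X i)
        (MvPolynomial.X i) ^ n =
      toAway (MvPolynomial.X i) (∑ a ∈ s, MvPolynomial.monomial a (x.coeff a)) := by
    classical
    intro s
    induction s using Finset.induction_on with
    | empty => exact fun _ => ⟨0, by simp⟩
    | insert a s ha ih =>
      intro hs
      obtain ⟨y, hy⟩ := ih fun b hb => hs (Finset.mem_insert_of_mem hb)
      obtain ⟨z, hz⟩ := hmon a (by
        rw [Finsupp.degree_eq_weight_one]
        exact hx' (MvPolynomial.mem_support_iff.1 (hs (Finset.mem_insert_self _ _)))) (x.coeff a)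
      exact ⟨z + y, by
        rw [map_add, val_add, add_mul, hy, hz, Finset.sum_insert ha, map_add]⟩
  obtain ⟨y, hy⟩ := hsum x.support subset_rfl
  rw [MvPolynomial.support_sum_monomial_coeff] at hy
  refine ⟨y, val_injective _ ((hu.pow n).mul_left_injective ?_)⟩
  change (coordToAway v i y).val * _ = (Away.mk (polyGrading d) (X_mem_polyGrading i) n x hx).val * _
  rw [hy, Away.val_mk, ← map_pow, ← Localization.mk_one_eq_algebraMap,
    ← Localization.mk_one_eq_algebraMap, Localization.mk_mul, Localization.mk_eq_mk_iff,
    Localization.r_iff_exists]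
  exact ⟨1, by simp [mul_comm]⟩

lemma SimplexFrame.coordToAway_bijective (h : SimplexFrame v u) (i : Fin (d + 1)) :
    Function.Bijective (coordToAway v i) := by
  refine ⟨?_, h.coordToAway_surjective i⟩
  have h1 : Function.Injective ((awayToTorus u _ (isUnit_polyToTorus_X u i)).comp
      (coordToAway v i)) := by
    rw [h.awayToTorus_coordToAway i]
    exact coordMap_injective _
  exact Function.Injective.of_comp (f := awayToTorus u _ (isUnit_polyToTorus_X u i)) h1

end ProjectiveSpace

/-! ### The toric atlas of `ℙᵈ` -/

section ProjectiveAtlas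

open HomogeneousLocalization

variable {N : Type} [AddCommGroup N] {d : ℕ} {v : Fin (d + 1) → N}
  {u : Fin (d + 1) → Module.Dual ℤ N}

attribute [local instance] MvPolynomial.gradedAlgebra

lemma isRationalPolyhedral_simplexCone (v : Fin (d + 1) → N) (i : Fin (d + 1)) :
    IsRationalPolyhedral (simplexCone v i) := by
  classical
  exact ⟨(Finset.univ.erase i).image v, by rw [simplexCone]; congr 2; ext x; simp⟩

lemma pairing_finset_sum {ι : Type*} (s : Finset ι) (m : ι → Module.Dual ℤ N) (x : ℝ ⊗[ℤ] N) :
    pairing (∑ k ∈ s, m k) x = ∑ k ∈ s, pairing (m k) x := by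
  classical
  induction s using Finset.induction_on with
  | empty => simp [pairing_zero]
  | insert b s hb ih => rw [Finset.sum_insert hb, Finset.sum_insert hb, pairing_add, ih]

/-- The torus is an open subset of each chart of `ℙᵈ`. -/
lemma SimplexFrame.isFace_bot (h : SimplexFrame v u) (i : Fin (d + 1)) :
    IsFace ⊥ (simplexCone v i) := by
  refine ⟨∑ k, (u k - u i), sum_mem fun k _ => h.sub_mem_dualMonoid i k, fun x => ⟨?_, ?_⟩⟩
  · intro hx
    rw [(Submodule.mem_bot _).1 hx]
    exact ⟨Submodule.zero_mem _, map_zero _⟩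
  · rintro ⟨hx, hx0⟩
    obtain ⟨a, ha, ha', rfl⟩ := (mem_hull_image_iff v _ x).1 hx
    have hai : a i = 0 := ha' i (by simp)
    rw [pairing_finset_sum] at hx0
    simp only [h.pairing_sum, hai, sub_zero] at hx0
    have h0 := (Finset.sum_eq_zero_iff_of_nonneg fun k _ => ha k).1 hx0
    rw [Submodule.mem_bot]
    exact Finset.sum_eq_zero fun k hk => by rw [h0 k hk, zero_smul]

/-- The separation of two maximal cones of the fan of `ℙᵈ`. -/
lemma SimplexFrame.exists_separating (h : SimplexFrame v u) (i j : Fin (d + 1)) :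
    ∃ m ∈ dualMonoid (simplexCone v i), -m ∈ dualMonoid (simplexCone v j) ∧
      ∀ x ∈ simplexCone v i, pairing m x = 0 → x ∈ simplexCone v j := by
  refine ⟨u j - u i, h.sub_mem_dualMonoid i j, by
    rw [neg_sub]; exact h.sub_mem_dualMonoid j i, fun x hx hx0 => ?_⟩
  obtain ⟨a, ha, ha', rfl⟩ := (mem_hull_image_iff v _ x).1 hx
  rw [h.pairing_sum, ha' i (by simp), sub_zero] at hx0
  refine (mem_hull_image_iff v _ _).2 ⟨a, ha, fun k hk => ?_, rfl⟩
  have : k = j := by simpa using hk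
  rw [this, hx0]

/-- The `i`-th standard open immersion of `Spec` of the coordinate ring into `ℙᵈ`. -/
noncomputable def projChart (i : Fin (d + 1)) :
    Spec (CommRingCat.of (Away (polyGrading d) (MvPolynomial.X i))) ⟶ (projectiveSpace d).left :=
  Proj.awayι (polyGrading d) (MvPolynomial.X i) (X_mem_polyGrading i) one_pos

instance (i : Fin (d + 1)) : IsOpenImmersion (projChart (d := d) i) :=
  inferInstanceAs (IsOpenImmersion (Proj.awayι (polyGrading d) _ (X_mem_polyGrading i) one_pos))

lemma projChart_over (i : Fin (d + 1)) : projChart (d := d) i ≫ (projectiveSpace d).hom =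
    Spec.map (CommRingCat.ofHom (awayConst (MvPolynomial.X i))) := by
  have h := Proj.awayι_toSpecZero_assoc (polyGrading d) (MvPolynomial.X i) (X_mem_polyGrading i)
    one_pos (Spec.map (CommRingCat.ofHom (algebraMap ℂ (polyGrading d 0))))
  rw [← Spec.map_comp, ← CommRingCat.ofHom_comp] at h
  exact h

lemma projChart_covers (x : (projectiveSpace d).left) : ∃ i y, projChart (d := d) i y = x := by
  have h := Proj.iSup_basicOpen_eq_top' (polyGrading d)
    (fun i : Fin (d + 1) => (MvPolynomial.X i : MvPolynomial (Fin (d + 1)) ℂ))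
    (fun i => ⟨1, X_mem_polyGrading i⟩) (by
      refine top_le_iff.1 fun p _ => ?_
      have hp : p ∈ Algebra.adjoin ℂ (Set.range (MvPolynomial.X (R := ℂ) (σ := Fin (d + 1)))) := by
        rw [MvPolynomial.adjoin_range_X]; trivial
      induction hp using Algebra.adjoin_induction with
      | mem x hx => exact Algebra.subset_adjoin hx
      | algebraMap r =>
        exact Subalgebra.algebraMap_mem _ (algebraMap ℂ (polyGrading d 0) r)
      | add x y _ _ hx hy => exact add_mem (hx trivial) (hy trivial)
      | mul x y _ _ hx hy => exact mul_mem (hx trivial) (hy trivial))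
  obtain ⟨i, hi⟩ := TopologicalSpace.Opens.mem_iSup.1 (h.ge (TopologicalSpace.Opens.mem_top x))
  rw [← Proj.opensRange_awayι (polyGrading d) _ (X_mem_polyGrading i) one_pos] at hi
  obtain ⟨y, hy⟩ := hi
  exact ⟨i, y, hy⟩

variable (u) in
/-- The embedding of the torus into `ℙᵈ` in the `i`-th chart. -/
noncomputable def projTorus (i : Fin (d + 1)) :
    affineChart (⊥ : PointedCone ℝ (ℝ ⊗[ℤ] N)) ⟶ (projectiveSpace d).left :=
  Spec.map (CommRingCat.ofHom (awayToTorus u _ (isUnit_polyToTorus_X u i))) ≫ projChart i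

/-- The embedding of the torus does not depend on the chart: on the intersection of two charts it is
given by the homogeneous localization at `x_i x_j`. -/
lemma projTorus_eq (i j : Fin (d + 1)) : projTorus u i = projTorus u j := by
  have hunit : IsUnit ((polyToTorus u).toRingHom (MvPolynomial.X i * MvPolynomial.X j)) := by
    rw [map_mul]
    exact (isUnit_polyToTorus_X u i).mul (isUnit_polyToTorus_X u j)
  have hi := Proj.SpecMap_awayMap_awayι (polyGrading d) (X_mem_polyGrading i) one_pos
    (X_mem_polyGrading j) (x := MvPolynomial.X i * MvPolynomial.X j) rfl
  have hj := Proj.SpecMap_awayMap_awayι (polyGrading d) (X_mem_polyGrading j) one_pos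
    (X_mem_polyGrading i) (x := MvPolynomial.X i * MvPolynomial.X j) (mul_comm _ _)
  have h1 := awayToTorus_awayMap u (X_mem_polyGrading j) rfl (isUnit_polyToTorus_X u i) hunit
  have h2 := awayToTorus_awayMap u (X_mem_polyGrading i) (mul_comm _ _)
    (isUnit_polyToTorus_X u j) hunit
  rw [projTorus, projTorus, ← h1, ← h2, CommRingCat.ofHom_comp, CommRingCat.ofHom_comp,
    Spec.map_comp, Spec.map_comp, Category.assoc, Category.assoc]
  exact congrArg (Spec.map _ ≫ ·) (hi.trans hj.symm)

/-- The coordinate ring of the chart of the `i`-th maximal cone is that of the `i`-th standard chart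
of `ℙᵈ`. -/
noncomputable def SimplexFrame.coordEquivAway (h : SimplexFrame v u) (i : Fin (d + 1)) :
    coordRing (simplexCone v i) ≃+* Away (polyGrading d) (MvPolynomial.X i) :=
  RingEquiv.ofBijective _ (h.coordToAway_bijective i)

/-- The `i`-th standard chart of `ℙᵈ`, as an affine toric chart. -/
noncomputable def SimplexFrame.projectiveChart (h : SimplexFrame v u) (i : Fin (d + 1)) :
    affineChart (simplexCone v i) ⟶ (projectiveSpace d).left :=
  Spec.map (CommRingCat.ofHom (h.coordEquivAway i).symm.toRingHom) ≫ projChart i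

lemma SimplexFrame.isOpenImmersion_projectiveChart (h : SimplexFrame v u) (i : Fin (d + 1)) :
    IsOpenImmersion (h.projectiveChart i) := by
  have : IsIso (Spec.map (CommRingCat.ofHom (h.coordEquivAway i).symm.toRingHom)) :=
    inferInstanceAs (IsIso (Scheme.Spec.map (h.coordEquivAway i).symm.toCommRingCatIso.hom.op))
  rw [SimplexFrame.projectiveChart]
  infer_instance

lemma SimplexFrame.projectiveChart_fac (h : SimplexFrame v u) (i : Fin (d + 1)) :
    affineChartMap (bot_le : ⊥ ≤ simplexCone v i) ≫ h.projectiveChart i = projTorus u 0 := by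
  rw [projTorus_eq 0 i, projTorus, affineChartMap, SimplexFrame.projectiveChart, ← Category.assoc,
    ← Spec.map_comp, ← CommRingCat.ofHom_comp, ← h.awayToTorus_coordToAway i, RingHom.comp_assoc]
  have h1 : (coordToAway v i).comp (h.coordEquivAway i).symm.toRingHom = RingHom.id _ :=
    RingHom.ext fun a => (h.coordEquivAway i).apply_symm_apply a
  rw [h1, RingHom.comp_id]

lemma SimplexFrame.projectiveChart_covers (h : SimplexFrame v u) (y : (projectiveSpace d).left) :
    ∃ i x, h.projectiveChart i x = y := by
  obtain ⟨i, z, rfl⟩ := projChart_covers y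
  refine ⟨i, Spec.map (CommRingCat.ofHom (h.coordEquivAway i).toRingHom) z, ?_⟩
  have h1 : (h.coordEquivAway i).toRingHom.comp (h.coordEquivAway i).symm.toRingHom =
      RingHom.id _ := RingHom.ext fun a => (h.coordEquivAway i).apply_symm_apply a
  have h2 : Spec.map (CommRingCat.ofHom (h.coordEquivAway i).toRingHom) ≫ h.projectiveChart i =
      projChart i := by
    rw [SimplexFrame.projectiveChart, ← Category.assoc, ← Spec.map_comp, ← CommRingCat.ofHom_comp,
      h1]
    exact (congrArg (· ≫ projChart i) (Spec.map_id _)).trans (Category.id_comp _)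
  rw [← h2]
  rfl

lemma projTorus_over : projTorus u 0 ≫ (projectiveSpace d).hom = affineChartStr ⊥ := by
  rw [projTorus, Category.assoc, projChart_over, ← Spec.map_comp, ← CommRingCat.ofHom_comp]
  have h1 : (awayToTorus u _ (isUnit_polyToTorus_X u 0)).comp (awayConst (MvPolynomial.X 0)) =
      algebraMap ℂ _ := RingHom.ext fun c => awayToTorus_awayConst u (isUnit_polyToTorus_X u 0) c
  rw [h1]
  rfl

/-- The atlas of `ℙᵈ` by its standard charts, as charts of the cones of a simplex. -/
noncomputable def SimplexFrame.projectiveAtlas (h : SimplexFrame v u) :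
    ToricAtlas (projectiveSpace d) (simplexCone v) where
  torus := projTorus u 0
  chart := h.projectiveChart
  isOpenImmersion_torus := by
    have _ := h.isOpenImmersion_projectiveChart 0
    have _ := isOpenImmersion_affineChartMap (isRationalPolyhedral_simplexCone v 0)
      (h.isFace_bot 0)
    rw [← h.projectiveChart_fac 0]
    infer_instance
  isOpenImmersion_chart := h.isOpenImmersion_projectiveChart
  torus_over := projTorus_over
  fac := h.projectiveChart_fac
  covers := h.projectiveChart_covers

instance (d : ℕ) : IsSeparated (projectiveSpace d).hom := by
  dsimp [projectiveSpace]
  infer_instance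

/-- Morphisms from affine toric charts to a separated scheme over `ℂ` are determined on the torus. -/
lemma affineChart_hom_ext [Module.Free ℤ N] {Y : Over (Spec (CommRingCat.of ℂ))}
    [IsSeparated Y.hom] (τ : PointedCone ℝ (ℝ ⊗[ℤ] N)) (g g' : affineChart τ ⟶ Y.left)
    (hg : g ≫ Y.hom = affineChartStr τ) (hg' : g' ≫ Y.hom = affineChartStr τ)
    (h : affineChartMap (bot_le : ⊥ ≤ τ) ≫ g = affineChartMap bot_le ≫ g') : g = g' := by
  have hdom : IsDominant (affineChartMap (bot_le : ⊥ ≤ τ)) := by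
    refine ⟨(PrimeSpectrum.denseRange_comap_iff_ker_le_nilRadical _).2 ?_⟩
    have h0 : RingHom.ker (coordMap (bot_le : ⊥ ≤ τ)).toRingHom = ⊥ :=
      (RingHom.injective_iff_ker_eq_bot _).1 (coordMap_injective (bot_le : ⊥ ≤ τ))
    exact h0.le.trans bot_le
  exact ext_of_isDominant_of_isSeparated Y.hom (hg.trans hg'.symm)
    (affineChartMap (bot_le : ⊥ ≤ τ)) h

end ProjectiveAtlas

/-! ### Products of open subschemes -/

section ProductCharts

variable {S : Scheme.{0}} {ι : Type} [Finite ι] {Z A : ι → Over S} [HasProduct Z]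
  (g : ∀ i, A i ⟶ Z i) [∀ i, IsOpenImmersion (g i).left] {U : Over S} (p : ∀ i, U ⟶ A i)

/-- A product of open subschemes is an open subscheme of the product: the intersection of the inverse
images of the factors also has the universal property of the product of the factors. -/
theorem isOpenImmersion_piLift (hlim : Nonempty (IsLimit (CategoryTheory.Limits.Fan.mk U p))) :
    IsOpenImmersion (Pi.lift fun i => p i ≫ g i).left ∧
      ∀ y : (∏ᶜ Z).left, (∀ i, ∃ x, (g i).left x = (Pi.π Z i).left y) →
        ∃ x, (Pi.lift fun i => p i ≫ g i).left x = y := by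
  obtain ⟨hlim⟩ := hlim
  let F : U ⟶ ∏ᶜ Z := Pi.lift fun i => p i ≫ g i
  have hF : ∀ i, F ≫ Pi.π Z i = p i ≫ g i := fun i => Pi.lift_π _ _
  let V : (∏ᶜ Z).left.Opens := ⟨⋂ i, (Pi.π Z i).left ⁻¹' Set.range (g i).left,
    isOpen_iInter_of_finite fun i =>
      (g i).left.opensRange.2.preimage (Pi.π Z i).left.continuous⟩
  let TV : Over S := Over.mk (V.ι ≫ (∏ᶜ Z).hom)
  let j : TV ⟶ ∏ᶜ Z := Over.homMk V.ι rfl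
  have hrange : ∀ i, Set.range (j ≫ Pi.π Z i).left ⊆ Set.range (g i).left := by
    rintro i _ ⟨x, rfl⟩
    exact Set.mem_iInter.1 x.2 i
  let q : ∀ i, TV ⟶ A i := fun i => Over.homMk
    (IsOpenImmersion.lift (g i).left (j ≫ Pi.π Z i).left (hrange i)) (by
      rw [← Over.w (g i), ← Category.assoc, IsOpenImmersion.lift_fac, Over.w])
  have hq : ∀ i, q i ≫ g i = j ≫ Pi.π Z i := fun i =>
    Over.OverMorphism.ext (IsOpenImmersion.lift_fac _ _ _)
  let G : TV ⟶ U := hlim.lift (CategoryTheory.Limits.Fan.mk TV q)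
  have hG : ∀ i, G ≫ p i = q i := fun i => hlim.fac (CategoryTheory.Limits.Fan.mk TV q) ⟨i⟩
  have hGF : G ≫ F = j := Pi.hom_ext _ _ fun i => by
    rw [Category.assoc, hF, ← Category.assoc, hG, hq]
  have hFV : Set.range F.left ⊆ Set.range V.ι := by
    rw [Scheme.Opens.range_ι]
    rintro _ ⟨x, rfl⟩
    refine Set.mem_iInter.2 fun i => ⟨(p i).left x, ?_⟩
    have h1 := congrArg (fun f : U ⟶ Z i => f.left x) (hF i)
    exact h1.symm
  let F' : U ⟶ TV := Over.homMk (IsOpenImmersion.lift V.ι F.left hFV) (by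
    change _ ≫ V.ι ≫ _ = _
    rw [← Category.assoc, IsOpenImmersion.lift_fac, Over.w])
  have hF' : F' ≫ j = F := Over.OverMorphism.ext (IsOpenImmersion.lift_fac _ _ _)
  have hmono : ∀ {T : Over S} (i) {a b : T ⟶ A i}, a ≫ g i = b ≫ g i → a = b :=
    fun i a b h => Over.OverMorphism.ext
      ((cancel_mono (g i).left).1 (congrArg (fun f => f.left) h))
  have hFG : F' ≫ G = 𝟙 U := hlim.hom_ext fun ⟨i⟩ => by
    change (F' ≫ G) ≫ p i = 𝟙 U ≫ p i
    refine hmono i ?_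
    have h1 : (F' ≫ G) ≫ p i = F' ≫ q i := by rw [Category.assoc, hG]
    rw [h1, Category.assoc, hq, ← Category.assoc, hF', hF, Category.id_comp]
  have hGF' : G ≫ F' = 𝟙 TV := by
    refine Over.OverMorphism.ext ((cancel_mono V.ι).1 ?_)
    have h1 : (G ≫ F') ≫ j = 𝟙 TV ≫ j := by rw [Category.assoc, hF', hGF, Category.id_comp]
    exact congrArg (fun f => f.left) h1
  have hiso : IsIso F'.left := ⟨G.left, congrArg (fun f => f.left) hFG,
    congrArg (fun f => f.left) hGF'⟩
  refine ⟨?_, fun y hy => ?_⟩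
  · change IsOpenImmersion F.left
    rw [← hF']
    exact IsOpenImmersion.comp F'.left V.ι
  · let y' : V := ⟨y, Set.mem_iInter.2 hy⟩
    refine ⟨G.left y', ?_⟩
    exact congrArg (fun f : TV ⟶ ∏ᶜ Z => f.left y') hGF

end ProductCharts

section SpecHom

variable {T : Scheme.{0}} {R : CommRingCat.{0}}

/-- The homomorphism from `R` to the functions on `T` given by a morphism `T ⟶ Spec R`. -/
noncomputable def specPullback (q : T ⟶ Spec R) : R ⟶ Γ(T, ⊤) :=
  (Scheme.ΓSpecIso R).inv ≫ q.appTop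

lemma toSpecΓ_specPullback (q : T ⟶ Spec R) :
    T.toSpecΓ ≫ Spec.map (specPullback q) = q := by
  rw [specPullback, Spec.map_comp, ← Scheme.toSpecΓ_naturality_assoc]
  simp

lemma specPullback_comp {R' : CommRingCat.{0}} (q : T ⟶ Spec R) (φ : R' ⟶ R) :
    specPullback (q ≫ Spec.map φ) = φ ≫ specPullback q := by
  rw [specPullback, specPullback, Scheme.Hom.comp_appTop, ← Category.assoc, ← Category.assoc,
    Scheme.ΓSpecIso_inv_naturality]

end SpecHom

/-! ### Products of affine toric charts -/

section ToricMap

variable {N N' : Type} [AddCommGroup N] [AddCommGroup N']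

/-- The homomorphism `χ^w ↦ χ^{w ∘ L}` of coordinate rings given by a homomorphism of lattices
`L : N → N'` that maps a cone `τ` into a cone `ρ`; this condition is stated on the dual cones. -/
noncomputable def coordComp {τ : PointedCone ℝ (ℝ ⊗[ℤ] N)} {ρ : PointedCone ℝ (ℝ ⊗[ℤ] N')}
    (L : N →ₗ[ℤ] N') (h : ∀ w ∈ dualMonoid ρ, w.comp L ∈ dualMonoid τ) :
    coordRing ρ →ₐ[ℂ] coordRing τ :=
  AddMonoidAlgebra.mapDomainAlgHom ℂ ℂ
    { toFun := fun w : dualMonoid ρ => (⟨w.1.comp L, h w.1 w.2⟩ : dualMonoid τ)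
      map_zero' := Subtype.ext (LinearMap.zero_comp L)
      map_add' := fun a b => Subtype.ext (LinearMap.add_comp L b.1 a.1) }

lemma coordComp_single {τ : PointedCone ℝ (ℝ ⊗[ℤ] N)} {ρ : PointedCone ℝ (ℝ ⊗[ℤ] N')}
    (L : N →ₗ[ℤ] N') (h : ∀ w ∈ dualMonoid ρ, w.comp L ∈ dualMonoid τ) (w : dualMonoid ρ) (c : ℂ) :
    coordComp L h (AddMonoidAlgebra.single w c) =
      AddMonoidAlgebra.single ⟨w.1.comp L, h w.1 w.2⟩ c := by
  simp [coordComp]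

/-- The toric morphism of affine toric varieties given by a homomorphism of lattices. -/
noncomputable def toricMap {τ : PointedCone ℝ (ℝ ⊗[ℤ] N)} {ρ : PointedCone ℝ (ℝ ⊗[ℤ] N')}
    (L : N →ₗ[ℤ] N') (h : ∀ w ∈ dualMonoid ρ, w.comp L ∈ dualMonoid τ) :
    affineChart τ ⟶ affineChart ρ :=
  Spec.map (CommRingCat.ofHom (coordComp L h).toRingHom)

lemma toricMap_str {τ : PointedCone ℝ (ℝ ⊗[ℤ] N)} {ρ : PointedCone ℝ (ℝ ⊗[ℤ] N')}
    (L : N →ₗ[ℤ] N') (h : ∀ w ∈ dualMonoid ρ, w.comp L ∈ dualMonoid τ) :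
    toricMap L h ≫ affineChartStr ρ = affineChartStr τ := by
  rw [toricMap, affineChartStr, affineChartStr, ← Spec.map_comp, ← CommRingCat.ofHom_comp]
  congr 2
  exact (coordComp L h).comp_algebraMap

lemma affineChartMap_toricMap {τ : PointedCone ℝ (ℝ ⊗[ℤ] N)} {ρ : PointedCone ℝ (ℝ ⊗[ℤ] N')}
    (L : N →ₗ[ℤ] N') (h : ∀ w ∈ dualMonoid ρ, w.comp L ∈ dualMonoid τ) :
    affineChartMap (bot_le : ⊥ ≤ τ) ≫ toricMap L h =
      toricMap (τ := ⊥) (ρ := ⊥) L (fun _ _ => mem_dualMonoid_bot _) ≫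
        affineChartMap bot_le := by
  rw [toricMap, toricMap, affineChartMap, affineChartMap, ← Spec.map_comp, ← Spec.map_comp,
    ← CommRingCat.ofHom_comp, ← CommRingCat.ofHom_comp]
  congr 2
  refine RingHom.ext fun a => ?_
  induction a using AddMonoidAlgebra.induction_linear with
  | zero => rw [map_zero, map_zero]
  | add a b ha hb => rw [map_add, map_add, ha, hb]
  | single w c =>
    change coordMap (bot_le : ⊥ ≤ τ) (coordComp L h (AddMonoidAlgebra.single w c)) =
      coordComp (τ := ⊥) (ρ := ⊥) L (fun w _ => mem_dualMonoid_bot _)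
        (coordMap bot_le (AddMonoidAlgebra.single w c))
    rw [coordComp_single, coordMap_single, coordMap_single, coordComp_single]
    rfl

end ToricMap

section ProductChart

variable {N : Type} [AddCommGroup N] {d : ℕ} {e : Fin d → N} {f : Fin d → Module.Dual ℤ N}

/-- The ray generators of the fan of `ℙ¹`, numbered as in a simplex frame: the ray of the `i`-th chart
is the one with the other number, so that the `i`-th chart has the ray `chartSign i`. -/
def lineRays : Fin (1 + 1) → ℤ := ![-1, 1]

/-- The coordinates of the fan of `ℙ¹`. -/
noncomputable def lineCoords : Fin (1 + 1) → Module.Dual ℤ ℤ := ![0, LinearMap.id]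

lemma simplexFrame_line : SimplexFrame lineRays lineCoords where
  sum_eq := by simp [lineRays]
  dual j k := by fin_cases j <;> fin_cases k <;> simp [lineRays, lineCoords]
  ext m h := LinearMap.ext_ring (by simpa [lineRays] using h 1)

lemma mem_dualMonoid_line {a : Fin (1 + 1)} {w : Module.Dual ℤ ℤ} :
    w ∈ dualMonoid (simplexCone lineRays a) ↔ 0 ≤ chartSign a * w 1 := by
  rw [mem_dualMonoid_simplexCone]
  fin_cases a <;> simp [Fin.forall_fin_two, lineRays, chartSign]

/-- The `i`-th coordinate maps the orthant with signs `ε` to the half line with sign `ε i`. -/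
lemma OrthantFrame.comp_mem_dualMonoid (h : OrthantFrame e f) (ε : Fin d → Fin 2) (i : Fin d)
    (w : Module.Dual ℤ ℤ) (hw : w ∈ dualMonoid (simplexCone lineRays (ε i))) :
    w.comp (f i) ∈ dualMonoid (orthantCone e ε) := by
  refine mem_dualMonoid_orthantCone.2 fun j => ?_
  rw [LinearMap.comp_apply, h.dual]
  split_ifs with hij
  · rw [← hij]; exact mem_dualMonoid_line.1 hw
  · simp

/-- The homomorphism of lattices `ℤ → N` with value `n` at `1`. -/
noncomputable abbrev cochar (n : N) : ℤ →ₗ[ℤ] N := LinearMap.toSpanSingleton ℤ N n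

lemma comp_cochar_mem_dualMonoid (ε : Fin d → Fin 2) (i : Fin d)
    (m : Module.Dual ℤ N) (hm : m ∈ dualMonoid (orthantCone e ε)) :
    m.comp (cochar (e i)) ∈ dualMonoid (simplexCone lineRays (ε i)) := by
  rw [mem_dualMonoid_line, LinearMap.comp_apply, LinearMap.toSpanSingleton_apply, one_smul]
  exact mem_dualMonoid_orthantCone.1 hm i

/-- The `i`-th coordinate map on the coordinate rings of the charts of `(ℙ¹)ᵈ`. -/
noncomputable def OrthantFrame.coordFactor (h : OrthantFrame e f) (ε : Fin d → Fin 2) (i : Fin d) :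
    coordRing (simplexCone lineRays (ε i)) →ₐ[ℂ] coordRing (orthantCone e ε) :=
  coordComp (f i) (h.comp_mem_dualMonoid ε i)

/-- A regular function on a chart of `(ℙ¹)ᵈ` is a combination of products of functions of the
coordinates. -/
lemma OrthantFrame.single_eq (h : OrthantFrame e f) (ε : Fin d → Fin 2)
    (m : dualMonoid (orthantCone e ε)) (c : ℂ) :
    AddMonoidAlgebra.single m c = algebraMap ℂ (coordRing (orthantCone e ε)) c *
      ∏ i, h.coordFactor ε i (AddMonoidAlgebra.single
        ⟨_, comp_cochar_mem_dualMonoid ε i m.1 m.2⟩ 1) := by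
  refine coordMap_injective (bot_le : ⊥ ≤ orthantCone e ε) ?_
  rw [map_mul, AlgHom.commutes, map_prod]
  have h1 : ∀ i, coordMap (bot_le : ⊥ ≤ orthantCone e ε) (h.coordFactor ε i
      (AddMonoidAlgebra.single ⟨_, comp_cochar_mem_dualMonoid ε i m.1 m.2⟩ 1)) =
      torusMonomial (m.1 (e i) • f i) := fun i => by
    rw [OrthantFrame.coordFactor, coordComp_single, coordMap_single, torusMonomial]
    congr 1
    refine Subtype.ext (LinearMap.ext fun n => ?_)
    change m.1 (f i n • e i) = m.1 (e i) • f i n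
    rw [map_smul, smul_eq_mul, smul_eq_mul, mul_comm]
  rw [Finset.prod_congr rfl fun i _ => h1 i, ← torusMonomial_sum, h.expand, coordMap_single,
    ← Algebra.smul_def, torusMonomial, AddMonoidAlgebra.smul_single, smul_eq_mul, mul_one]
  rfl

variable {R : Type} [CommRing R]

lemma OrthantFrame.coordRing_hom_ext (h : OrthantFrame e f) (ε : Fin d → Fin 2)
    {Ψ Ψ' : coordRing (orthantCone e ε) →+* R}
    (hc : Ψ.comp (algebraMap ℂ _) = Ψ'.comp (algebraMap ℂ _))
    (hi : ∀ i, Ψ.comp (h.coordFactor ε i).toRingHom = Ψ'.comp (h.coordFactor ε i).toRingHom) :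
    Ψ = Ψ' := by
  refine RingHom.ext fun a => ?_
  induction a using AddMonoidAlgebra.induction_linear with
  | zero => rw [map_zero, map_zero]
  | add a b ha hb => rw [map_add, map_add, ha, hb]
  | single m c =>
    rw [h.single_eq, map_mul, map_mul, map_prod, map_prod]
    congr 1
    · exact DFunLike.congr_fun hc c
    · exact Finset.prod_congr rfl fun i _ => DFunLike.congr_fun (hi i) _

/-- With `coordRing_hom_ext`: the coordinate ring of a chart of `(ℙ¹)ᵈ` is the tensor product of the coordinate rings of the
charts of the factors. -/
lemma OrthantFrame.exists_coordRing_hom (h : OrthantFrame e f) (ε : Fin d → Fin 2) (ψ : ℂ →+* R)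
    (φ : ∀ i, coordRing (simplexCone lineRays (ε i)) →+* R)
    (hφ : ∀ i, (φ i).comp (algebraMap ℂ _) = ψ) :
    ∃ Ψ : coordRing (orthantCone e ε) →+* R, Ψ.comp (algebraMap ℂ _) = ψ ∧
      ∀ i, Ψ.comp (h.coordFactor ε i).toRingHom = φ i := by
  let g : ∀ i, coordRing (orthantCone e ε) →ₐ[ℂ] coordRing (simplexCone lineRays (ε i)) := fun i =>
    coordComp (cochar (e i)) (comp_cochar_mem_dualMonoid ε i)
  let Ψ : coordRing (orthantCone e ε) →+* R := AddMonoidAlgebra.liftNCRingHom ψ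
    { toFun := fun m => ∏ i, φ i (g i (AddMonoidAlgebra.single m.toAdd 1))
      map_one' := Finset.prod_eq_one fun i _ => by
        change φ i (g i 1) = 1
        rw [map_one, map_one]
      map_mul' := fun m m' => by
        rw [← Finset.prod_mul_distrib]
        refine Finset.prod_congr rfl fun i _ => ?_
        rw [← map_mul, ← map_mul, AddMonoidAlgebra.single_mul_single, one_mul]
        rfl } fun _ _ => Commute.all _ _
  have hΨ : ∀ m c, Ψ (AddMonoidAlgebra.single m c) =
      ψ c * ∏ i, φ i (g i (AddMonoidAlgebra.single m 1)) := fun m c =>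
    AddMonoidAlgebra.liftNC_single _ _ _ _
  refine ⟨Ψ, RingHom.ext fun c => ?_, fun j => RingHom.ext fun a => ?_⟩
  · have h1 := hΨ 0 c
    have h2 : ∏ i, φ i (g i (AddMonoidAlgebra.single 0 1)) = 1 :=
      Finset.prod_eq_one fun i _ => by
        change φ i (g i 1) = 1
        rw [map_one, map_one]
    rw [h2, mul_one] at h1
    exact h1
  · induction a using AddMonoidAlgebra.induction_linear with
    | zero => rw [map_zero, map_zero]
    | add a b ha hb => rw [map_add, map_add, ha, hb]
    | single w c =>
      change Ψ (h.coordFactor ε j (AddMonoidAlgebra.single w c)) = _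
      rw [OrthantFrame.coordFactor, coordComp_single, hΨ]
      have hw : ∀ i, w.1.comp (f j) (e i) = if i = j then w.1 1 else 0 := fun i => by
        rw [LinearMap.comp_apply, h.dual]
        by_cases hij : i = j
        · simp [hij]
        · simp [hij, Ne.symm hij]
      rw [Finset.prod_eq_single j]
      · have h1 : (g j (AddMonoidAlgebra.single ⟨w.1.comp (f j),
            h.comp_mem_dualMonoid ε j w.1 w.2⟩ 1)) = AddMonoidAlgebra.single w 1 := by
          rw [coordComp_single]
          congr 1
          refine Subtype.ext (LinearMap.ext_ring ?_)
          rw [LinearMap.comp_apply, LinearMap.toSpanSingleton_apply, one_smul, hw, if_pos rfl]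
        rw [h1, ← hφ j, RingHom.comp_apply, ← map_mul, ← Algebra.smul_def,
          AddMonoidAlgebra.smul_single, smul_eq_mul, mul_one]
      · intro i _ hij
        have h1 : (g i (AddMonoidAlgebra.single ⟨w.1.comp (f j),
            h.comp_mem_dualMonoid ε j w.1 w.2⟩ 1)) = 1 := by
          rw [coordComp_single, AddMonoidAlgebra.one_def]
          congr 1
          refine Subtype.ext (LinearMap.ext_ring ?_)
          rw [LinearMap.comp_apply, LinearMap.toSpanSingleton_apply, one_smul, hw, if_neg hij]
          rfl
        rw [h1, map_one]
      · simp

/-- The projection of a chart of `(ℙ¹)ᵈ` to a chart of the `i`-th factor. -/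
noncomputable def OrthantFrame.factorMap (h : OrthantFrame e f) (ε : Fin d → Fin 2) (i : Fin d) :
    Over.mk (affineChartStr (orthantCone e ε)) ⟶
      Over.mk (affineChartStr (simplexCone lineRays (ε i))) :=
  Over.homMk (toricMap (f i) (h.comp_mem_dualMonoid ε i)) (toricMap_str _ _)

lemma specPullback_comp_affineChartStr {T : Scheme.{0}} {τ : PointedCone ℝ (ℝ ⊗[ℤ] N)}
    (q : T ⟶ affineChart τ) : (specPullback (q ≫ affineChartStr τ)).hom =
      (specPullback q).hom.comp (algebraMap ℂ (coordRing τ)) := by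
  rw [affineChartStr, specPullback_comp]
  rfl

/-- A chart of `(ℙ¹)ᵈ` is the product of charts of the factors. -/
lemma OrthantFrame.isLimit_factorMap (h : OrthantFrame e f) (ε : Fin d → Fin 2) :
    Nonempty (IsLimit (CategoryTheory.Limits.Fan.mk
      (Over.mk (affineChartStr (orthantCone e ε))) (h.factorMap ε))) := by
  have hex : ∀ (T : Over (Spec (CommRingCat.of ℂ)))
      (q : ∀ i, T ⟶ Over.mk (affineChartStr (simplexCone lineRays (ε i)))),
      ∃ G : T ⟶ Over.mk (affineChartStr (orthantCone e ε)), ∀ i, G ≫ h.factorMap ε i = q i := by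
    intro T q
    have hq : ∀ i, (specPullback (q i).left).hom.comp (algebraMap ℂ _) =
        (specPullback T.hom).hom := fun i => by
      have h1 : (q i).left ≫ affineChartStr _ = T.hom := Over.w (q i)
      rw [← h1]
      exact (specPullback_comp_affineChartStr _).symm
    obtain ⟨Ψ, hΨ, hΨi⟩ := h.exists_coordRing_hom ε _ (fun i => (specPullback (q i).left).hom) hq
    refine ⟨Over.homMk (T.left.toSpecΓ ≫ Spec.map (CommRingCat.ofHom Ψ)) ?_, fun i =>
      Over.OverMorphism.ext ?_⟩
    · change (_ ≫ _) ≫ affineChartStr _ = _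
      rw [affineChartStr, Category.assoc, ← Spec.map_comp, ← CommRingCat.ofHom_comp, hΨ]
      exact toSpecΓ_specPullback T.hom
    · change (_ ≫ _) ≫ toricMap _ _ = _
      rw [toricMap, Category.assoc, ← Spec.map_comp, ← CommRingCat.ofHom_comp]
      have h1 := hΨi i
      rw [OrthantFrame.coordFactor] at h1
      rw [h1]
      exact toSpecΓ_specPullback (q i).left
  have huniq : ∀ (T : Over (Spec (CommRingCat.of ℂ)))
      (G G' : T ⟶ Over.mk (affineChartStr (orthantCone e ε))),
      (∀ i, G ≫ h.factorMap ε i = G' ≫ h.factorMap ε i) → G = G' := by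
    intro T G G' hG
    have h1 : specPullback (R := CommRingCat.of (coordRing (orthantCone e ε))) G.left =
        specPullback (R := CommRingCat.of (coordRing (orthantCone e ε))) G'.left := by
      refine CommRingCat.hom_ext (h.coordRing_hom_ext ε ?_ fun i => ?_)
      · have h2 : G.left ≫ affineChartStr _ = G'.left ≫ affineChartStr _ :=
          (Over.w G).trans (Over.w G').symm
        have h3 := congrArg (fun a => (specPullback a).hom) h2
        exact (specPullback_comp_affineChartStr _).symm.trans
          (h3.trans (specPullback_comp_affineChartStr _))
      · have h2 : G.left ≫ toricMap _ _ = G'.left ≫ toricMap _ _ :=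
          congrArg (fun a => a.left) (hG i)
        have h3 := congrArg specPullback h2
        rw [toricMap, specPullback_comp, specPullback_comp] at h3
        exact congrArg CommRingCat.Hom.hom h3
    refine Over.OverMorphism.ext ?_
    rw [← toSpecΓ_specPullback (R := CommRingCat.of (coordRing (orthantCone e ε))) G.left, h1]
    exact toSpecΓ_specPullback _
  choose G hG using hex
  exact ⟨CategoryTheory.Limits.Fan.IsLimit.mk _ (fun s => G s.pt s.proj) (fun s j => hG s.pt s.proj j) fun s m hm =>
    huniq _ _ _ fun i => (hm i).trans (hG s.pt s.proj i).symm⟩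

end ProductChart

/-! ### The toric atlas of `(ℙ¹)ᵈ` -/

section LinePower

variable {N : Type} [AddCommGroup N] {d : ℕ} {e : Fin d → N} {f : Fin d → Module.Dual ℤ N}

/-- The variety `(ℙ¹)ᵈ`. -/
noncomputable abbrev linePower (d : ℕ) : Over (Spec (CommRingCat.of ℂ)) :=
  ∏ᶜ fun _ : Fin d => projectiveSpace 1

/-- The standard charts of `ℙ¹`, over `ℂ`. -/
noncomputable def lineChart (a : Fin (1 + 1)) :
    Over.mk (affineChartStr (simplexCone lineRays a)) ⟶ projectiveSpace 1 :=
  Over.homMk (simplexFrame_line.projectiveChart a)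
    (simplexFrame_line.projectiveAtlas.chart_over a)

instance (a : Fin (1 + 1)) : IsOpenImmersion (lineChart a).left :=
  simplexFrame_line.isOpenImmersion_projectiveChart a

/-- The standard charts of `(ℙ¹)ᵈ`. -/
noncomputable def OrthantFrame.linePowerChart (h : OrthantFrame e f) (ε : Fin d → Fin 2) :
    Over.mk (affineChartStr (orthantCone e ε)) ⟶ linePower d :=
  Pi.lift fun i => h.factorMap ε i ≫ lineChart (ε i)

lemma OrthantFrame.linePowerChart_proj (h : OrthantFrame e f) (ε : Fin d → Fin 2) (i : Fin d) :
    (h.linePowerChart ε).left ≫ (Pi.π (fun _ : Fin d => projectiveSpace 1) i).left =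
      toricMap (f i) (h.comp_mem_dualMonoid ε i) ≫ simplexFrame_line.projectiveChart (ε i) :=
  congrArg (fun a => a.left)
    (Pi.lift_π (fun i => h.factorMap ε i ≫ lineChart (ε i)) i)

lemma linePower_hom_ext {T : Scheme.{0}} {g g' : T ⟶ (linePower d).left}
    (h0 : g ≫ (linePower d).hom = g' ≫ (linePower d).hom)
    (h : ∀ i, g ≫ (Pi.π (fun _ : Fin d => projectiveSpace 1) i).left =
      g' ≫ (Pi.π (fun _ : Fin d => projectiveSpace 1) i).left) : g = g' := by
  let G : Over.mk (g ≫ (linePower d).hom) ⟶ linePower d := Over.homMk g rfl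
  let G' : Over.mk (g ≫ (linePower d).hom) ⟶ linePower d := Over.homMk g' h0.symm
  have hG : G = G' := Pi.hom_ext _ _ fun i => Over.OverMorphism.ext (h i)
  exact congrArg (fun a => a.left) hG

lemma isRationalPolyhedral_orthantCone (e : Fin d → N) (ε : Fin d → Fin 2) :
    IsRationalPolyhedral (orthantCone e ε) := by
  classical
  exact ⟨Finset.univ.image fun i => chartSign (ε i) • e i, by rw [orthantCone]; congr 2; simp⟩

lemma pairing_smul (c : ℤ) (m : Module.Dual ℤ N) (x : ℝ ⊗[ℤ] N) :
    pairing (c • m) x = c * pairing m x := by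
  induction x using TensorProduct.induction_on with
  | zero => simp
  | add x y hx hy => rw [map_add, map_add, hx, hy, mul_add]
  | tmul r n => simp [pairing]; ring

lemma mem_orthantCone_iff {ε : Fin d → Fin 2} {x : ℝ ⊗[ℤ] N} :
    x ∈ orthantCone e ε ↔ ∃ a : Fin d → ℝ, (∀ i, 0 ≤ a i) ∧
      ∑ i, a i • toReal (chartSign (ε i) • e i) = x := by
  have h : Set.range (fun i => chartSign (ε i) • e i) =
      (fun i => chartSign (ε i) • e i) '' Set.univ := Set.image_univ.symm
  rw [orthantCone, h, mem_hull_image_iff]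
  simp [eq_comm]

lemma OrthantFrame.chartSign_mul_pairing_sum (h : OrthantFrame e f) (ε : Fin d → Fin 2)
    (a : Fin d → ℝ) (i : Fin d) : (chartSign (ε i) : ℝ) *
      pairing (f i) (∑ k, a k • toReal (chartSign (ε k) • e k)) = a i := by
  have h1 : (chartSign (ε i) : ℝ) * chartSign (ε i) = 1 := by
    exact_mod_cast chartSign_mul_self (ε i)
  rw [map_sum, Finset.sum_eq_single i]
  · rw [map_smul, pairing_toReal, map_smul, h.dual, if_pos rfl, smul_eq_mul, smul_eq_mul, mul_one]
    linear_combination a i * h1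
  · intro k _ hk
    rw [map_smul, pairing_toReal, map_smul, h.dual, if_neg hk.symm]; simp
  · simp

/-- The separation of two maximal cones of the fan of `(ℙ¹)ᵈ`, by the sum of the coordinates in
which their signs differ. -/
lemma OrthantFrame.exists_separating (h : OrthantFrame e f) (ε δ : Fin d → Fin 2) :
    ∃ m ∈ dualMonoid (orthantCone e ε), -m ∈ dualMonoid (orthantCone e δ) ∧
      ∀ x ∈ orthantCone e ε, pairing m x = 0 → x ∈ orthantCone e δ := by
  classical
  let s : Finset (Fin d) := Finset.univ.filter fun i => ε i ≠ δ i
  have hs : ∀ i, i ∈ s ↔ ε i ≠ δ i := fun i => by simp [s]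
  have hneg : ∀ a b : Fin 2, a ≠ b → chartSign b = -chartSign a := fun a b hab => by
    fin_cases a <;> fin_cases b <;> simp [chartSign] at hab ⊢
  refine ⟨∑ i ∈ s, chartSign (ε i) • f i, sum_mem fun i _ => h.smul_mem_dualMonoid ε i, ?_, ?_⟩
  · rw [← Finset.sum_neg_distrib]
    refine sum_mem fun i hi => ?_
    rw [← neg_smul, ← hneg _ _ ((hs i).1 hi)]
    exact h.smul_mem_dualMonoid δ i
  · intro x hx hx0
    obtain ⟨a, ha, rfl⟩ := mem_orthantCone_iff.1 hx
    simp only [pairing_finset_sum, pairing_smul, h.chartSign_mul_pairing_sum] at hx0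
    have h0 := (Finset.sum_eq_zero_iff_of_nonneg fun k _ => ha k).1 hx0
    refine mem_orthantCone_iff.2 ⟨a, ha, Finset.sum_congr rfl fun k _ => ?_⟩
    by_cases hk : k ∈ s
    · rw [h0 k hk, zero_smul, zero_smul]
    · rw [not_not.1 (mt (hs k).2 hk)]

/-- The torus is an open subset of each chart of `(ℙ¹)ᵈ`. -/
lemma OrthantFrame.isFace_bot (h : OrthantFrame e f) (ε : Fin d → Fin 2) :
    IsFace ⊥ (orthantCone e ε) := by
  refine ⟨∑ i, chartSign (ε i) • f i, sum_mem fun i _ => h.smul_mem_dualMonoid ε i, fun x =>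
    ⟨fun hx => ?_, ?_⟩⟩
  · rw [(Submodule.mem_bot _).1 hx]
    exact ⟨Submodule.zero_mem _, map_zero _⟩
  · rintro ⟨hx, hx0⟩
    obtain ⟨a, ha, rfl⟩ := mem_orthantCone_iff.1 hx
    simp only [pairing_finset_sum, pairing_smul, h.chartSign_mul_pairing_sum] at hx0
    have h0 := (Finset.sum_eq_zero_iff_of_nonneg fun k _ => ha k).1 hx0
    rw [Submodule.mem_bot]
    exact Finset.sum_eq_zero fun k hk => by rw [h0 k hk, zero_smul]

lemma OrthantFrame.isOpenImmersion_linePowerChart (h : OrthantFrame e f) (ε : Fin d → Fin 2) :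
    IsOpenImmersion (h.linePowerChart ε).left :=
  (isOpenImmersion_piLift (fun i => lineChart (ε i)) (h.factorMap ε) (h.isLimit_factorMap ε)).1

/-- On the torus, all charts of `(ℙ¹)ᵈ` agree. -/
lemma OrthantFrame.linePowerChart_fac (h : OrthantFrame e f) (ε δ : Fin d → Fin 2) :
    affineChartMap (bot_le : ⊥ ≤ orthantCone e ε) ≫ (h.linePowerChart ε).left =
      affineChartMap (bot_le : ⊥ ≤ orthantCone e δ) ≫ (h.linePowerChart δ).left := by
  have h0 : ∀ ε, (affineChartMap (bot_le : ⊥ ≤ orthantCone e ε) ≫ (h.linePowerChart ε).left) ≫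
      (linePower d).hom = affineChartStr ⊥ := fun ε => by
    have h1 : (h.linePowerChart ε).left ≫ (linePower d).hom = affineChartStr _ :=
      Over.w (h.linePowerChart ε)
    rw [Category.assoc, h1, affineChartMap_str]
  have h1 : ∀ ε i, (affineChartMap (bot_le : ⊥ ≤ orthantCone e ε) ≫ (h.linePowerChart ε).left) ≫
      (Pi.π (fun _ : Fin d => projectiveSpace 1) i).left =
      toricMap (τ := ⊥) (ρ := ⊥) (f i) (fun _ _ => mem_dualMonoid_bot _) ≫
        projTorus lineCoords 0 := fun ε i => by
    rw [Category.assoc, h.linePowerChart_proj, ← Category.assoc, affineChartMap_toricMap,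
      Category.assoc, simplexFrame_line.projectiveChart_fac]
  exact linePower_hom_ext ((h0 ε).trans (h0 δ).symm) fun i => (h1 ε i).trans (h1 δ i).symm

lemma OrthantFrame.linePowerChart_covers (h : OrthantFrame e f) (y : (linePower d).left) :
    ∃ ε x, (h.linePowerChart ε).left x = y := by
  choose ε x hx using fun i => simplexFrame_line.projectiveChart_covers
    ((Pi.π (fun _ : Fin d => projectiveSpace 1) i).left y)
  exact ⟨ε, (isOpenImmersion_piLift (fun i => lineChart (ε i)) (h.factorMap ε)
    (h.isLimit_factorMap ε)).2 y fun i => ⟨x i, hx i⟩⟩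

/-- The atlas of `(ℙ¹)ᵈ` by the products of the standard charts of `ℙ¹`, as charts of the orthants
of a basis. -/
noncomputable def OrthantFrame.linePowerAtlas (h : OrthantFrame e f) :
    ToricAtlas (linePower d) (orthantCone e) where
  torus := affineChartMap bot_le ≫ (h.linePowerChart 0).left
  chart ε := (h.linePowerChart ε).left
  isOpenImmersion_torus := by
    have _ := h.isOpenImmersion_linePowerChart 0
    have _ := isOpenImmersion_affineChartMap (isRationalPolyhedral_orthantCone e 0)
      (h.isFace_bot 0)
    infer_instance
  isOpenImmersion_chart := h.isOpenImmersion_linePowerChart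
  torus_over := by
    have h1 : (h.linePowerChart 0).left ≫ (linePower d).hom = affineChartStr _ :=
      Over.w (h.linePowerChart 0)
    rw [Category.assoc, h1, affineChartMap_str]
  fac ε := h.linePowerChart_fac ε 0
  covers := h.linePowerChart_covers

lemma linePower_affineChart_hom_ext [Module.Free ℤ N] (τ : PointedCone ℝ (ℝ ⊗[ℤ] N))
    (g g' : affineChart τ ⟶ (linePower d).left)
    (hg : g ≫ (linePower d).hom = affineChartStr τ)
    (hg' : g' ≫ (linePower d).hom = affineChartStr τ)
    (h : affineChartMap (bot_le : ⊥ ≤ τ) ≫ g = affineChartMap bot_le ≫ g') : g = g' := by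
  have hover : ∀ i, (Pi.π (fun _ : Fin d => projectiveSpace 1) i).left ≫ (projectiveSpace 1).hom =
      (linePower d).hom := fun i => Over.w (Pi.π (fun _ : Fin d => projectiveSpace 1) i)
  refine linePower_hom_ext (hg.trans hg'.symm) fun i => affineChart_hom_ext τ _ _ ?_ ?_ ?_
  · rw [Category.assoc, hover, hg]
  · rw [Category.assoc, hover, hg']
  · rw [← Category.assoc, h, Category.assoc]

end LinePower

/-! ### The extremal cases -/

section Recognition

/-- The primitive vectors `-∑ eᵢ, e₁, …, e_d` of the standard fan of `ℙᵈ`. -/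
def stdSimplexRays (d : ℕ) : Fin (d + 1) → Fin d → ℤ :=
  Fin.cons (fun _ => -1) fun i => Pi.single i 1

/-- The coordinate functions of the standard fan of `ℙᵈ`, with `0` in the place `0`. -/
noncomputable def stdSimplexCoords (d : ℕ) : Fin (d + 1) → Module.Dual ℤ (Fin d → ℤ) :=
  Fin.cons 0 fun i => LinearMap.proj i

lemma eq_zero_of_single {d : ℕ} {m : Module.Dual ℤ (Fin d → ℤ)}
    (h : ∀ i, m (Pi.single i 1) = 0) : m = 0 :=
  LinearMap.pi_ext' fun i => LinearMap.ext_ring (by simpa using h i)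

lemma simplexFrame_std (d : ℕ) : SimplexFrame (stdSimplexRays d) (stdSimplexCoords d) where
  sum_eq := by
    ext j
    simp [Fin.sum_univ_succ, stdSimplexRays, Finset.sum_apply, Pi.single_apply]
  dual j k := by
    refine Fin.cases ?_ (fun j => ?_) j <;> refine Fin.cases ?_ (fun k => ?_) k <;>
      simp [stdSimplexRays, stdSimplexCoords, Pi.single_apply, Fin.ext_iff]
  ext m h := eq_zero_of_single fun i => h i.succ

lemma orthantFrame_std (d : ℕ) : OrthantFrame (fun i : Fin d => Pi.single i (1 : ℤ))
    (fun i => (LinearMap.proj i : Module.Dual ℤ (Fin d → ℤ))) where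
  dual i j := by simp [Pi.single_apply]
  ext _ h := eq_zero_of_single h

variable {d : ℕ} {N : Type} [AddCommGroup N] [Module.Free ℤ N] [Module.Finite ℤ N] {Δ : Fan N}

/-- The value `2d` forces the rays, then the cones, of the fan of `(ℙ¹)ᵈ`. Conversely an isomorphism with
`(ℙ¹)ᵈ` makes the Lie algebra of vector fields perfect, of dimension `3d`. -/
theorem Fan.IsComplete.nonempty_iso_linePower_iff (hd : Module.finrank ℤ N = d)
    (hΔ : Δ.IsComplete) : (Δ.eta Δ.roots).encard = ((2 * d : ℕ) : ℕ∞) ↔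
      Nonempty (Δ.toricVarietyOver ≅ linePower d) := by
  have hP := hΔ.positivelySpans
  obtain ⟨T, hT⟩ : ∃ T : Finset N, ∀ v, v ∈ T ↔ v ∈ nonReps Δ.rayGenerators :=
    ⟨(nonReps_finite Δ.rayGenerators_finite).toFinset, fun v => Set.Finite.mem_toFinset _⟩
  constructor
  · intro h
    rw [← hd] at h
    obtain ⟨hcard, hinj⟩ := card_nonReps_of_encard_eta_eq hP hT h
    obtain ⟨e, f, hf, hw⟩ := exists_orthantFrame hd hP zero_not_mem_rayGenerators
      (fun v hv => (hT v).1 hv) hcard hinj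
    obtain ⟨hσ, hmax⟩ := orthantCone_of_rays hf hΔ hw
    exact Δ.nonempty_iso_of_atlas hf.linePowerAtlas hσ hmax hf.exists_separating
      linePower_affineChart_hom_ext
  · rintro ⟨i⟩
    have hstd := orthantFrame_std d
    -- the two invariants of the Lie algebra of vector fields: perfectness, then dimension
    have hcard := card_nonReps_of_span hT evalComplex ((Δ.toricAtlas hΔ.bot_mem).corootsSpan
      hstd.linePowerAtlas Δ.isRaySet hstd.isRaySet hP hstd.positivelySpans i hstd.corootsSpan)
    have hroots := (Δ.toricAtlas hΔ.bot_mem).encard_rootsOf_eq hstd.linePowerAtlas Δ.isRaySet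
      hstd.isRaySet hP hstd.positivelySpans (by rw [hd, Module.finrank_fin_fun]) i
    rw [hstd.encard_rootsOf, ← hd] at hroots
    rw [← hd]
    exact encard_eta_eq_of_encard_rootsOf_eq hP hT hcard hroots

/-- The value `d² + d` forces the rays, then the cones, of the fan of `ℙᵈ`. Conversely an isomorphism
with `ℙᵈ` makes the Lie algebra of vector fields perfect, so that all roots are semisimple, and of
dimension `d² + 2d`. -/
theorem Fan.IsComplete.nonempty_iso_projectiveSpace_iff (hd : Module.finrank ℤ N = d)
    (hΔ : Δ.IsComplete) : Δ.semisimpleRoots.encard = ((d ^ 2 + d : ℕ) : ℕ∞) ↔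
      Nonempty (Δ.toricVarietyOver ≅ projectiveSpace d) := by
  have hP := hΔ.positivelySpans
  obtain ⟨T, hT⟩ : ∃ T : Finset N, ∀ v, v ∈ T ↔ v ∈ nonReps Δ.rayGenerators :=
    ⟨(nonReps_finite Δ.rayGenerators_finite).toFinset, fun v => Set.Finite.mem_toFinset _⟩
  constructor
  · intro h
    rw [← hd] at h
    obtain ⟨hcard, hclass⟩ := card_nonReps_of_encard_ssRootsOf_eq hP hT h
    obtain ⟨v, u, hf, hw⟩ := exists_simplexFrame hd hP zero_not_mem_rayGenerators
      (fun v hv => (hT v).1 hv) hcard hclass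
    obtain ⟨hσ, hmax⟩ := simplexCone_of_rays hf hΔ hw
    exact Δ.nonempty_iso_of_atlas hf.projectiveAtlas hσ hmax hf.exists_separating
      affineChart_hom_ext
  · rintro ⟨i⟩
    rcases eq_or_ne d 0 with rfl | hd0
    · -- in rank `0` there are no rays, whereas the simplex frame consists of the vector `0`
      have hN : Subsingleton N := Module.finrank_zero_iff.1 hd
      have h0 : Δ.semisimpleRoots = ∅ := Set.eq_empty_of_forall_notMem fun m hm => by
        obtain ⟨v, -, hv, -⟩ := hm.1
        rw [Subsingleton.elim v 0, map_zero] at hv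
        norm_num at hv
      rw [h0]
      simp
    have hstd := simplexFrame_std d
    have hcard := card_nonReps_of_span hT evalComplex ((Δ.toricAtlas hΔ.bot_mem).corootsSpan
      hstd.projectiveAtlas Δ.isRaySet (hstd.isRaySet hd0) hP hstd.positivelySpans i
      hstd.corootsSpan)
    have hroots := (Δ.toricAtlas hΔ.bot_mem).encard_rootsOf_eq hstd.projectiveAtlas Δ.isRaySet
      (hstd.isRaySet hd0) hP hstd.positivelySpans (by rw [hd, Module.finrank_fin_fun]) i
    rw [hstd.encard_rootsOf, rootsOf_eq_ssRootsOf hP Δ.rayGenerators_finite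
      (fun v hv => (hT v).1 hv) hcard] at hroots
    exact hroots

end Recognition

end Toric

theorem mainTheorem4 (d : ℕ) (N : Type) [AddCommGroup N] [Module.Free ℤ N] [Module.Finite ℤ N]
    (hd : Module.finrank ℤ N = d) (Δ : Toric.Fan N) (hΔ : Δ.IsComplete) :
    ((Δ.eta Δ.unipotentRoots).encard ≤ (d : ℕ∞) ∧
      (Δ.eta Δ.unipotentRoots \ Δ.eta Δ.semisimpleRoots).encard ≤
        (Module.finrank ℝ
          ((ℝ ⊗[ℤ] Module.Dual ℤ N) ⧸ Toric.linHull Δ.semisimpleRoots) : ℕ∞)) ∧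
    ((Δ.eta Δ.roots).encard ≤ ((2 * d : ℕ) : ℕ∞) ∧
      ((Δ.eta Δ.roots).encard = ((2 * d : ℕ) : ℕ∞) ↔
        Nonempty (Δ.toricVarietyOver ≅ ∏ᶜ fun _ : Fin d => Toric.projectiveSpace 1))) ∧
    (Δ.semisimpleRoots.encard ≤ ((d ^ 2 + d : ℕ) : ℕ∞) ∧
      (Δ.semisimpleRoots.encard = ((d ^ 2 + d : ℕ) : ℕ∞) ↔
        Nonempty (Δ.toricVarietyOver ≅ Toric.projectiveSpace d))) := by
  have hP := hΔ.positivelySpans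
  obtain ⟨T, hT⟩ : ∃ T : Finset N, ∀ v, v ∈ T ↔ v ∈ Toric.nonReps Δ.rayGenerators :=
    ⟨(Toric.nonReps_finite Δ.rayGenerators_finite).toFinset, fun v => Set.Finite.mem_toFinset _⟩
  refine ⟨⟨?_, Toric.encard_eta_unipotent_diff_le hP⟩, ⟨?_, hΔ.nonempty_iso_linePower_iff hd⟩,
    ?_, hΔ.nonempty_iso_projectiveSpace_iff hd⟩
  · rw [← hd]
    exact Toric.encard_eta_unipotent_le_rank hP
  · rw [← hd]
    exact Toric.encard_eta_roots_le hP hT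
  · refine (Toric.encard_ssRootsOf_le hP hT).trans (Nat.cast_le.2 ?_)
    have h1 : T.card ≤ d := hd ▸ Toric.card_nonReps_le_rank fun v hv => (hT v).1 hv
    calc T.card * (T.card + 1) ≤ d * (d + 1) := Nat.mul_le_mul h1 (Nat.succ_le_succ h1)
      _ = d ^ 2 + d := by ring
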